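/- Let $k \ge 0$ and $n \ge 2k$ be integers, let $\lambda = [\lambda_1,\lambda_2,\dots]\vdash n$, put $\lambda^* = [\lambda_2,\lambda_3,\dots]$ and $m = |\lambda^*|$, and suppose $m \le k$. **Notation.** Let $\mathcal P_k$ be the set of set-partition diagrams with two rows of $k$ vertices. For $d_1,d_2\in\mathcal P_k$ let $d_1\circ d_2$ be their concatenation ($d_1$ above $d_2$) and $\ell(d_1,d_2)$ the number of connected components lying entirely in the middle row. The partition algebra $P_k(n)$ is the $\mathbb C$-algebra with basis $\mathcal P_k$ and product $d_1d_2 = n^{\ell(d_1,d_2)}\, d_1\circ d_2$. A *set-partition tableau* $T$ of shape $\lambda$ is a bijective filling of the boxes of $\lambda/[n-t]$ with the blocks of a set partition $\pi$ (the content) of $\{1,\dots,k\}$ into $t$ blocks, $m\le t\le n$. Its blocks below the first row are called propagating. Blocks are ordered by their maximal entries. $T$ is *standard* if its rows and columns increase. Let $\overline{SPT}(\lambda,k)\supseteq SSPT(\lambda,k)$ be the sets of the tableaux with increasing first row and of the standard tableaux. For $d\in\mathcal P_k$, concatenate $d$ with $\pi$ viewed as a one-line diagram; let $\ell(d,T)$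 be the number of components removed. Let $d(T)$ be obtained from $T$ by replacing each propagating block with the block of the top row of $d\circ\pi$ connected to it, and writing the remaining blocks of the top row of $d\circ\pi$ increasingly in the first row; put $d(T)=0$ if this does not give a set-partition tableau. Let $P^\lambda_k$ be the complex vector space with basis $\{N_T : T \in SSPT(\lambda,k)\}$. A *symmetric $m$-diagram* is a diagram $w=w^T\in\mathcal P_k$ ($w^T$ is the reflection in the horizontal axis) with exactly $m$ propagating blocks (blocks meeting both rows), each of which is connected to its mirror image. Let $W^m$ be the complex vector space with basis the symmetric $m$-diagrams, let $S^{\lambda^*}=(\mathbb C S_m)\,p_{\lambda^*}$, where $p_{\lambda^*}=\sum_{\gamma}\sum_{\rho}\mathrm{sign}(\gamma)\gamma\rho$ is the Young symmetrizer ($\gamma$ in the column group and $\rho$ in the row group of the column-reading tableau), and let $\mathbf P^\lambda_k = W^m\otimes S^{\lambda^*}$ with $$d\cdot(w\otimes v) = n^{\ell(d,w)}\,(d\circ w\circ d^T)\otimes \sigma_{d,w}v$$ if $d\circ w\circ d^T$ has $m$ propagating blocks, and $d\cdot (w\otimes v)=0$ otherwise. Here $\sigma_{d,w}\in S_m$ is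 the permutation for which $d$ sends the $i$th propagating block of $w$ to the $\sigma_{d,w}(i)$th propagating block of $d\circ w\circ d^T$, in max-entry order. **Theorem.** 1. There is exactly one way to extend $T\mapsto N_T$ from $SSPT(\lambda,k)$ to a map $\overline{SPT}(\lambda,k)\to P^\lambda_k$ such that the following relations among fillings of the boxes below the first row hold: $N_{T\circ g} = \mathrm{sign}(g) N_T$ for all permutations $g$ of these boxes that preserve every column; and the Garnir relations $\sum_{g} \mathrm{sign}(g) N_{T\circ g} = 0$, where, for two adjacent boxes $(i,j),(i,j+1)$ of $\lambda^*$, $g$ runs through the permutations of the set consisting of the boxes of column $j$ in rows $\ge i$ and the boxes of column $j+1$ in rows $\le i$. The coefficients of each $N_T$ in the basis are integers. 2. With these $N_T$, the rule $$d\cdot N_T = \begin{cases} n^{\ell(d,T)} N_{d(T)} & \text{if } d(T) \text{ is a set-partition tableau},\\ 0 & \text{if } d(T)=0,\end{cases}\qquad d\in\mathcal P_k,\ T\in SSPT(\lambda,k),$$ makes $P^\lambda_k$ into a $P_k(n)$-module. 3. $\mathbf P^\lambda_k$ is an irreducible $P_k(n)$-module, and $P^\lambda_k\cong \mathbf P^\lambda_k$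 as $P_k(n)$-modules. -/

import Mathlib

open scoped TensorProduct

namespace PartAlg

/-! ### Set-partition diagrams and the partition algebra -/

/-- A set-partition diagram with top row `α` (the summand `inl`) and bottom row `β` (the summand
`inr`): a set partition of the disjoint union of the rows, given as an equivalence relation whose
classes are the blocks. -/
abbrev Diag (α β : Type) : Type := Setoid (α ⊕ β)

section Concatenation

variable {α β γ δ : Type}

/-- The top two rows inside three rows. -/
def up : α ⊕ β → α ⊕ β ⊕ γ := Sum.map id Sum.inl

/-- The bottom two rows inside three rows. -/
def down : β ⊕ γ → α ⊕ β ⊕ γ := Sum.inr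

/-- The two outer rows inside three rows. -/
def outer : α ⊕ γ → α ⊕ β ⊕ γ := Sum.map id Sum.inr

/-- The middle row inside three rows. -/
def mid : β → α ⊕ β ⊕ γ := fun b => Sum.inr (Sum.inl b)

/-- The joined diagram on three rows: `d₁` is placed above `d₂`, the bottom row of `d₁` is
identified with the top row of `d₂`; the classes are the connected components. -/
def glue (d₁ : Diag α β) (d₂ : Diag β γ) : Setoid (α ⊕ β ⊕ γ) :=
  d₁.map up ⊔ d₂.map down

/-- Concatenation `d₁ ∘ d₂` of diagrams. -/
def comp (d₁ : Diag α β) (d₂ : Diag β γ) : Diag α γ := (glue d₁ d₂).comap outer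

/-- The classes of `r` contained in `U`. -/
def inside {X : Type} (r : Setoid X) (U : Set X) : Set (Set X) := {c | c ∈ r.classes ∧ c ⊆ U}

/-- `ℓ(d₁, d₂)`: the number of connected components that lie entirely in the middle row of the
joined diagram, and are deleted in `d₁ ∘ d₂`. -/
noncomputable def loops (d₁ : Diag α β) (d₂ : Diag β γ) : ℕ :=
  (inside (glue d₁ d₂) (Set.range mid)).ncard

/-- The identity diagram, with blocks `{i, i'}`. -/
def idDiag (α : Type) : Diag α α := Setoid.ker (Sum.elim id id)

/-- The reflection `dᵀ` of a diagram over the horizontal axis. -/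
def flip (d : Diag α β) : Diag β α := d.comap Sum.swap

/-- The set partition induced on the top row. -/
def top (d : Diag α β) : Setoid α := d.comap Sum.inl

/-- A set partition of `α`, viewed as a one-line diagram (the other row is empty). -/
def oneLine (p : Setoid α) : Diag α Empty := p.comap (Equiv.sumEmpty α Empty)

/-- The propagating blocks of a diagram: those with vertices from both rows. -/
def propBlocks (d : Diag α β) : Set (Set (α ⊕ β)) :=
  {c | c ∈ d.classes ∧ (∃ a, Sum.inl a ∈ c) ∧ ∃ b, Sum.inr b ∈ c}

/-- The propagating number (rank) of a diagram. -/
noncomputable def pn (d : Diag α β) : ℕ := (propBlocks d).ncard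

/-! Facts needed for the associativity of the partition algebra. -/

section Facts

variable {X Y Z : Type}

theorem map_le_iff {r : Setoid X} {f : X → Y} {s : Setoid Y} : r.map f ≤ s ↔ r ≤ s.comap f := by
  constructor
  · intro h x y hxy
    exact h (Setoid.le_comap_map hxy)
  · intro h
    refine Setoid.eqvGen_le ?_
    rintro _ _ ⟨x, y, hxy, rfl, rfl⟩
    exact h hxy

theorem map_rel {r : Setoid X} {f : X → Y} (hf : Function.Injective f) {x y : Y} :
    r.map f x y ↔ x = y ∨ ∃ a b, f a = x ∧ f b = y ∧ r a b := by
  have hk : Setoid.ker f ≤ r := by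
    intro a b hab
    rw [hf hab]
  have := congrFun (congrFun (Setoid.coe_map_of_ker_le r f hk) x) y
  constructor
  · intro h
    rw [this] at h
    rcases h with ⟨a, b, hab, ha, hb⟩ | h
    · exact Or.inr ⟨a, b, ha, hb, hab⟩
    · exact Or.inl h
  · rintro (rfl | ⟨a, b, rfl, rfl, hab⟩)
    · exact (r.map f).refl x
    · exact Setoid.le_comap_map hab

theorem map_map (r : Setoid X) (f : X → Y) (g : Y → Z) : (r.map f).map g = r.map (g ∘ f) := by
  apply le_antisymm
  · rw [map_le_iff, map_le_iff, ← Setoid.comap_comp]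
    exact Setoid.le_comap_map
  · rw [map_le_iff, Setoid.comap_comp, ← map_le_iff, ← map_le_iff]

theorem map_sup (r s : Setoid X) (f : X → Y) : (r ⊔ s).map f = r.map f ⊔ s.map f := by
  apply le_antisymm
  · rw [map_le_iff]
    exact sup_le (map_le_iff.1 le_sup_left) (map_le_iff.1 le_sup_right)
  · exact sup_le (map_le_iff.2 (le_sup_left.trans Setoid.le_comap_map))
      (map_le_iff.2 (le_sup_right.trans Setoid.le_comap_map))

/-- Describes the join of `r` with a relation supported on the image of `f`. -/
theorem sup_map_rel (r : Setoid X) (s : Setoid Y) (f : Y → X) {x y : X}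
    (h : (r ⊔ s.map f) x y) :
    r x y ∨ ∃ b b', r x (f b) ∧ (r.comap f ⊔ s) b b' ∧ r (f b') y := by
  let q : Setoid Y := r.comap f ⊔ s
  have hq : r.comap f ≤ q := le_sup_left
  let t : Setoid X :=
    { r := fun x y => r x y ∨ ∃ b b', r x (f b) ∧ q b b' ∧ r (f b') y
      iseqv :=
        { refl := fun x => Or.inl (r.refl x)
          symm := by
            rintro x y (h | ⟨b, b', h1, h2, h3⟩)
            · exact Or.inl (r.symm h)
            · exact Or.inr ⟨b', b, r.symm h3, q.symm h2, r.symm h1⟩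
          trans := by
            rintro x y z (h | ⟨b, b', h1, h2, h3⟩) (k | ⟨c, c', k1, k2, k3⟩)
            · exact Or.inl (r.trans h k)
            · exact Or.inr ⟨c, c', r.trans h k1, k2, k3⟩
            · exact Or.inr ⟨b, b', h1, h2, r.trans h3 k⟩
            · refine Or.inr ⟨b, c', h1, q.trans h2 (q.trans (hq ?_) k2), k3⟩
              exact r.trans h3 k1 } }
  have h1 : r ≤ t := fun _ _ h => Or.inl h
  have h2 : s.map f ≤ t := by
    rw [map_le_iff]
    intro a b hab
    exact Or.inr ⟨a, b, r.refl _, (le_sup_right : s ≤ q) hab, r.refl _⟩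
  exact (sup_le h1 h2) h

theorem comap_sup_map (r : Setoid X) (s : Setoid Y) (f : Y → X) :
    (r ⊔ s.map f).comap f = r.comap f ⊔ s := by
  apply le_antisymm
  · intro a b hab
    rcases sup_map_rel r s f hab with h | ⟨c, c', h1, h2, h3⟩
    · exact (le_sup_left : r.comap f ≤ _) h
    · exact Setoid.trans' _ ((le_sup_left : r.comap f ≤ r.comap f ⊔ s) h1)
        (Setoid.trans' _ h2 ((le_sup_left : r.comap f ≤ r.comap f ⊔ s) h3))
  · exact sup_le (fun _ _ h => (le_sup_left : r ≤ r ⊔ s.map f) h)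
      (map_le_iff.1 le_sup_right)

theorem mem_inside {r : Setoid X} {U : Set X} {c : Set X} :
    c ∈ inside r U ↔ ∃ x, c = {y | r y x} ∧ ∀ y, r y x → y ∈ U := by
  constructor
  · rintro ⟨⟨x, rfl⟩, h⟩
    exact ⟨x, rfl, fun y hy => h hy⟩
  · rintro ⟨x, rfl, h⟩
    exact ⟨⟨x, rfl⟩, fun y hy => h y hy⟩

theorem ncard_inside_map (r : Setoid X) {f : X → Y} (hf : Function.Injective f) (U : Set X) :
    (inside (r.map f) (f '' U)).ncard = (inside r U).ncard := by
  have key : inside (r.map f) (f '' U) = (fun c => f '' c) '' inside r U := by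
    ext c
    simp only [Set.mem_image, mem_inside]
    constructor
    · rintro ⟨x, rfl, h⟩
      obtain ⟨x, hx, rfl⟩ := h x (Setoid.refl' _ x)
      refine ⟨{y | r y x}, ⟨x, rfl, fun y hy => ?_⟩, ?_⟩
      · obtain ⟨z, hz, hzy⟩ := h (f y) (Setoid.le_comap_map hy)
        exact hf hzy ▸ hz
      · ext z
        constructor
        · rintro ⟨y, hy, rfl⟩
          exact Setoid.le_comap_map hy
        · intro hz
          obtain ⟨y, -, rfl⟩ := h z hz
          have : (r.map f).comap f y x := hz
          rw [Setoid.comap_map_eq f r hf] at this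
          exact ⟨y, this, rfl⟩
    · rintro ⟨_, ⟨x, rfl, h⟩, rfl⟩
      have key : ∀ z, r.map f z (f x) ↔ ∃ y, r y x ∧ f y = z := by
        intro z
        constructor
        · intro hz
          rcases (map_rel hf).1 hz with rfl | ⟨a, b, rfl, hb, hab⟩
          · exact ⟨x, r.refl x, rfl⟩
          · exact ⟨a, hf hb ▸ hab, rfl⟩
        · rintro ⟨y, hy, rfl⟩
          exact Setoid.le_comap_map hy
      refine ⟨f x, ?_, ?_⟩
      · ext z
        exact (key z).symm
      · intro z hz
        obtain ⟨y, hy, rfl⟩ := (key z).1 hz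
        exact ⟨y, h y hy, rfl⟩
  rw [key, Set.ncard_image_of_injective _ hf.image_injective]

theorem ncard_inside_sup [Finite X] (r : Setoid X) (s : Setoid Y) (f : Y → X) (U : Set X)
    (hU : (Set.range f)ᶜ ⊆ U) :
    (inside (r ⊔ s.map f) U).ncard =
      (inside r (Set.range f)ᶜ).ncard + (inside (r.comap f ⊔ s) (f ⁻¹' U)).ncard := by
  set J := r ⊔ s.map f with hJ
  have hr : r ≤ J := le_sup_left
  have hrel : ∀ {x y}, (∀ b, ¬ r x (f b)) → (J x y ↔ r x y) := by
    intro x y hx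
    constructor
    · intro h
      rcases sup_map_rel r s f h with h | ⟨b, _, h1, _⟩
      · exact h
      · exact absurd h1 (hx b)
    · exact fun h => hr h
  have hcls : ∀ {x}, (∀ b, ¬ r x (f b)) → {y | J y x} = {y | r y x} := by
    intro x hx
    ext y
    exact ⟨fun h => r.symm ((hrel hx).1 (J.symm h)), fun h => hr h⟩
  have hsplit : inside J U = inside r (Set.range f)ᶜ ∪ {c | c ∈ inside J U ∧ ∃ b, f b ∈ c} := by
    ext c
    constructor
    · intro hc
      by_cases hb : ∃ b, f b ∈ c
      · exact Or.inr ⟨hc, hb⟩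
      · left
        obtain ⟨x, rfl, h⟩ := mem_inside.1 hc
        have hx : ∀ b, ¬ r x (f b) := fun b hxb => hb ⟨b, hr (r.symm hxb)⟩
        refine mem_inside.2 ⟨x, hcls hx, ?_⟩
        rintro y hy ⟨b, rfl⟩
        exact hx b (r.symm hy)
    · rintro (hc | hc)
      · obtain ⟨x, rfl, h⟩ := mem_inside.1 hc
        have hx : ∀ b, ¬ r x (f b) := fun b hxb => h _ (r.symm hxb) ⟨b, rfl⟩
        refine mem_inside.2 ⟨x, (hcls hx).symm, fun y hy => hU (h y ?_)⟩
        exact r.symm ((hrel hx).1 (J.symm hy))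
      · exact hc.1
  have hdisj : Disjoint (inside r (Set.range f)ᶜ) {c | c ∈ inside J U ∧ ∃ b, f b ∈ c} := by
    rw [Set.disjoint_left]
    rintro c ⟨-, hc⟩ ⟨-, b, hb⟩
    exact hc hb ⟨b, rfl⟩
  rw [hsplit, Set.ncard_union_eq hdisj (Set.toFinite _) (Set.toFinite _)]
  congr 1
  rw [← comap_sup_map r s f]
  have himg : inside (J.comap f) (f ⁻¹' U) =
      (fun c => f ⁻¹' c) '' {c | c ∈ inside J U ∧ ∃ b, f b ∈ c} := by
    ext c
    constructor
    · intro hc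
      obtain ⟨b, rfl, h⟩ := mem_inside.1 hc
      refine ⟨{y | J y (f b)}, ⟨mem_inside.2 ⟨f b, rfl, ?_⟩, b, J.refl _⟩, rfl⟩
      intro y hy
      by_cases hyr : y ∈ Set.range f
      · obtain ⟨a, rfl⟩ := hyr
        exact h a hy
      · exact hU hyr
    · rintro ⟨c, ⟨hc, b, hb⟩, rfl⟩
      obtain ⟨x, rfl, h⟩ := mem_inside.1 hc
      refine mem_inside.2 ⟨b, ?_, fun a ha => h _ (J.trans ha hb)⟩
      ext a
      exact ⟨fun ha => J.trans ha (J.symm hb), fun ha => J.trans ha hb⟩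
  rw [himg, Set.InjOn.ncard_image]
  rintro c ⟨hc, b, hb⟩ c' ⟨hc', b', hb'⟩ h
  have hbc' : f b ∈ c' := by
    have : b ∈ f ⁻¹' c := hb
    have h' : f ⁻¹' c = f ⁻¹' c' := h
    rw [h'] at this
    exact this
  exact Setoid.eq_of_mem_classes hc.1 hb hc'.1 hbc'

theorem up_injective : Function.Injective (up : α ⊕ β → α ⊕ β ⊕ γ) :=
  Function.injective_id.sumMap Sum.inl_injective

theorem down_injective : Function.Injective (down : β ⊕ γ → α ⊕ β ⊕ γ) := Sum.inr_injective

theorem outer_injective : Function.Injective (outer : α ⊕ γ → α ⊕ β ⊕ γ) :=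
  Function.injective_id.sumMap Sum.inr_injective

/-- Pull-back of a pushed-forward relation along a cartesian square of injections. -/
theorem comap_map_square {W : Type} (r : Setoid X) {e : X → Z} {f : Y → Z} (he : Function.Injective e)
    (hf : Function.Injective f) (i : W → X) (j : W → Y) (hj : Function.Injective j)
    (hc : ∀ w, e (i w) = f (j w))
    (hp : ∀ x y, e x = f y → ∃ w, i w = x ∧ j w = y) :
    (r.map e).comap f = (r.comap i).map j := by
  ext y y'
  change r.map e (f y) (f y') ↔ _
  rw [map_rel he, map_rel hj]
  constructor
  · rintro (h | ⟨a, b, ha, hb, hab⟩)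
    · exact Or.inl (hf h)
    · obtain ⟨w, rfl, rfl⟩ := hp a y ha
      obtain ⟨w', rfl, rfl⟩ := hp b y' hb
      exact Or.inr ⟨w, w', rfl, rfl, hab⟩
  · rintro (rfl | ⟨w, w', rfl, rfl, h⟩)
    · exact Or.inl rfl
    · exact Or.inr ⟨i w, i w', hc w, hc w', h⟩

/-- Rows `1, 2, 3` inside four rows. -/
def r123 : α ⊕ β ⊕ γ → α ⊕ β ⊕ γ ⊕ δ := Sum.map id (Sum.map id Sum.inl)
/-- Rows `1, 3, 4` inside four rows. -/
def r134 : α ⊕ γ ⊕ δ → α ⊕ β ⊕ γ ⊕ δ := Sum.map id Sum.inr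
/-- Rows `1, 2, 4` inside four rows. -/
def r124 : α ⊕ β ⊕ δ → α ⊕ β ⊕ γ ⊕ δ := Sum.map id (Sum.map id Sum.inr)
/-- Rows `2, 3, 4` inside four rows. -/
def r234 : β ⊕ γ ⊕ δ → α ⊕ β ⊕ γ ⊕ δ := Sum.inr

theorem r123_injective : Function.Injective (r123 : α ⊕ β ⊕ γ → α ⊕ β ⊕ γ ⊕ δ) :=
  Function.injective_id.sumMap (Function.injective_id.sumMap Sum.inl_injective)
theorem r134_injective : Function.Injective (r134 : α ⊕ γ ⊕ δ → α ⊕ β ⊕ γ ⊕ δ) :=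
  Function.injective_id.sumMap Sum.inr_injective
theorem r124_injective : Function.Injective (r124 : α ⊕ β ⊕ δ → α ⊕ β ⊕ γ ⊕ δ) :=
  Function.injective_id.sumMap (Function.injective_id.sumMap Sum.inr_injective)
theorem r234_injective : Function.Injective (r234 : β ⊕ γ ⊕ δ → α ⊕ β ⊕ γ ⊕ δ) :=
  Sum.inr_injective

/-- The joined diagram on four rows. -/
def glue₄ (d₁ : Diag α β) (d₂ : Diag β γ) (d₃ : Diag γ δ) : Setoid (α ⊕ β ⊕ γ ⊕ δ) :=
  (glue d₁ d₂).map r123 ⊔ (d₃.map down).map r134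

theorem glue₄_eq (d₁ : Diag α β) (d₂ : Diag β γ) (d₃ : Diag γ δ) :
    glue₄ d₁ d₂ d₃ = (glue d₂ d₃).map r234 ⊔ (d₁.map up).map r124 := by
  have h1 : (r123 ∘ up : α ⊕ β → α ⊕ β ⊕ γ ⊕ δ) = r124 ∘ up := by
    funext x; rcases x with x | x <;> rfl
  have h2 : (r123 ∘ down : β ⊕ γ → α ⊕ β ⊕ γ ⊕ δ) = r234 ∘ up := by
    funext x; rcases x with x | x <;> rfl
  have h3 : (r134 ∘ down : γ ⊕ δ → α ⊕ β ⊕ γ ⊕ δ) = r234 ∘ down := by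
    funext x; rcases x with x | x <;> rfl
  simp only [glue₄, glue, map_sup, map_map, h1, h2, h3]
  ac_rfl

theorem comap_r134 (d₁ : Diag α β) (d₂ : Diag β γ) :
    ((glue d₁ d₂).map (r123 : _ → α ⊕ β ⊕ γ ⊕ δ)).comap r134 = (comp d₁ d₂).map up := by
  refine comap_map_square _ r123_injective r134_injective outer up up_injective ?_ ?_
  · rintro (w | w) <;> rfl
  · rintro (x | x | x) (y | y | y) h <;>
      simp only [r123, r134, Sum.map_inl, Sum.map_inr, id, Sum.inl.injEq, Sum.inr.injEq,
        reduceCtorEq] at h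
    · exact ⟨Sum.inl x, rfl, by rw [h]; rfl⟩
    · exact ⟨Sum.inr x, rfl, by rw [h]; rfl⟩

theorem comap_r124 (d₂ : Diag β γ) (d₃ : Diag γ δ) :
    ((glue d₂ d₃).map (r234 : _ → α ⊕ β ⊕ γ ⊕ δ)).comap r124 = (comp d₂ d₃).map down := by
  refine comap_map_square _ r234_injective r124_injective outer down down_injective ?_ ?_
  · rintro (w | w) <;> rfl
  · rintro (x | x | x) (y | y | y) h <;>
      simp only [r234, r124, Sum.map_inl, Sum.map_inr, id, Sum.inl.injEq, Sum.inr.injEq,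
        reduceCtorEq] at h
    · exact ⟨Sum.inl x, rfl, by rw [h]; rfl⟩
    · exact ⟨Sum.inr x, rfl, by rw [h]; rfl⟩

theorem comap_glue₄_r134 (d₁ : Diag α β) (d₂ : Diag β γ) (d₃ : Diag γ δ) :
    (glue₄ d₁ d₂ d₃).comap r134 = glue (comp d₁ d₂) d₃ := by
  rw [glue₄, comap_sup_map, comap_r134, glue]

theorem comap_glue₄_r124 (d₁ : Diag α β) (d₂ : Diag β γ) (d₃ : Diag γ δ) :
    (glue₄ d₁ d₂ d₃).comap r124 = glue d₁ (comp d₂ d₃) := by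
  rw [glue₄_eq, comap_sup_map, comap_r124, glue, sup_comm]

theorem comp_assoc (d₁ : Diag α β) (d₂ : Diag β γ) (d₃ : Diag γ δ) :
    comp (comp d₁ d₂) d₃ = comp d₁ (comp d₂ d₃) := by
  have h : (r134 ∘ outer : α ⊕ δ → α ⊕ β ⊕ γ ⊕ δ) = r124 ∘ outer := by
    funext x; rcases x with x | x <;> rfl
  have e : ∀ s : Setoid (α ⊕ β ⊕ γ ⊕ δ), (s.comap r134).comap outer = (s.comap r124).comap outer :=
    fun s => congrArg s.comap h
  rw [comp, comp.eq_1 d₁ (comp d₂ d₃), ← comap_glue₄_r134, ← comap_glue₄_r124, e]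

theorem loops_assoc [Finite α] [Finite β] [Finite γ] [Finite δ]
    (d₁ : Diag α β) (d₂ : Diag β γ) (d₃ : Diag γ δ) :
    loops d₁ d₂ + loops (comp d₁ d₂) d₃ = loops d₂ d₃ + loops d₁ (comp d₂ d₃) := by
  let U : Set (α ⊕ β ⊕ γ ⊕ δ) :=
    {x | Sum.elim (fun _ => False) (Sum.elim (fun _ => True) (Sum.elim (fun _ => True)
      (fun _ => False))) x}
  have h1 : (inside (glue₄ d₁ d₂ d₃) U).ncard = loops d₁ d₂ + loops (comp d₁ d₂) d₃ := by
    have e1 : (Set.range (r134 : _ → α ⊕ β ⊕ γ ⊕ δ))ᶜ = r123 '' Set.range mid := by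
      ext x; rcases x with x | x | x | x <;> simp [r134, r123, mid]
    have e2 : (r134 : _ → α ⊕ β ⊕ γ ⊕ δ) ⁻¹' U = Set.range mid := by
      ext x; rcases x with x | x | x <;> simp [r134, U, mid]
    have e3 : (Set.range (r134 : _ → α ⊕ β ⊕ γ ⊕ δ))ᶜ ⊆ U := by
      intro x hx; rcases x with x | x | x | x <;> simp [r134, U] at hx ⊢
    rw [glue₄, ncard_inside_sup _ _ _ _ e3, comap_r134, e1, e2, ncard_inside_map _ r123_injective]
    rfl
  have h2 : (inside (glue₄ d₁ d₂ d₃) U).ncard = loops d₂ d₃ + loops d₁ (comp d₂ d₃) := by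
    have e1 : (Set.range (r124 : _ → α ⊕ β ⊕ γ ⊕ δ))ᶜ = r234 '' Set.range mid := by
      ext x; rcases x with x | x | x | x <;> simp [r124, r234, mid]
    have e2 : (r124 : _ → α ⊕ β ⊕ γ ⊕ δ) ⁻¹' U = Set.range mid := by
      ext x; rcases x with x | x | x <;> simp [r124, U, mid]
    have e3 : (Set.range (r124 : _ → α ⊕ β ⊕ γ ⊕ δ))ᶜ ⊆ U := by
      intro x hx; rcases x with x | x | x | x <;> simp [r124, U] at hx ⊢
    rw [glue₄_eq, ncard_inside_sup _ _ _ _ e3, comap_r124, e1, e2,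
      ncard_inside_map _ r234_injective, sup_comm]
    rfl
  rw [← h1, ← h2]

theorem glue_id (d : Diag α β) :
    glue d (idDiag β) = d.comap (Sum.elim Sum.inl (Sum.elim Sum.inr Sum.inr)) := by
  apply le_antisymm
  · apply sup_le
    · rw [map_le_iff, ← Setoid.comap_comp]
      intro x y h
      rcases x with x | x <;> rcases y with y | y <;> exact h
    · rw [map_le_iff, ← Setoid.comap_comp]
      intro x y h
      have h' : (Sum.elim id id x : β) = Sum.elim id id y := h
      rcases x with x | x <;> rcases y with y | y <;> (obtain rfl : x = y := h'; exact Setoid.refl' _ _)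
  · have key : ∀ x : α ⊕ β ⊕ β, glue d (idDiag β) x
        (up (Sum.elim Sum.inl (Sum.elim Sum.inr Sum.inr) x)) := by
      rintro (x | x | x)
      · exact Setoid.refl' _ _
      · exact Setoid.refl' _ _
      · have : (idDiag β).map (down : _ → α ⊕ β ⊕ β) ≤ glue d (idDiag β) := le_sup_right
        exact this (Setoid.le_comap_map (r := idDiag β) (f := down)
          (show idDiag β (Sum.inr x) (Sum.inl x) from rfl))
    intro x y h
    have h1 : d.map up ≤ glue d (idDiag β) := le_sup_left
    exact Setoid.trans' _ (key x) (Setoid.trans' _ (h1 (Setoid.le_comap_map h))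
      (Setoid.symm' _ (key y)))

theorem id_glue (d : Diag α β) :
    glue (idDiag α) d = d.comap (Sum.elim Sum.inl id) := by
  apply le_antisymm
  · apply sup_le
    · rw [map_le_iff, ← Setoid.comap_comp]
      intro x y h
      have h' : (Sum.elim id id x : α) = Sum.elim id id y := h
      rcases x with x | x <;> rcases y with y | y <;> (obtain rfl : x = y := h'; exact Setoid.refl' _ _)
    · rw [map_le_iff, ← Setoid.comap_comp]
      intro x y h
      exact h
  · have key : ∀ x : α ⊕ α ⊕ β, glue (idDiag α) d x (down (Sum.elim Sum.inl id x)) := by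
      rintro (x | x)
      · have : (idDiag α).map (up : _ → α ⊕ α ⊕ β) ≤ glue (idDiag α) d := le_sup_left
        exact this (Setoid.le_comap_map (r := idDiag α) (f := up)
          (show idDiag α (Sum.inl x) (Sum.inr x) from rfl))
      · exact Setoid.refl' _ _
    intro x y h
    have h1 : d.map down ≤ glue (idDiag α) d := le_sup_right
    exact Setoid.trans' _ (key x) (Setoid.trans' _ (h1 (Setoid.le_comap_map h))
      (Setoid.symm' _ (key y)))

theorem comp_id (d : Diag α β) : comp d (idDiag β) = d := by
  rw [comp, glue_id, ← Setoid.comap_comp]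
  ext x y
  rcases x with x | x <;> rcases y with y | y <;> rfl

theorem id_comp (d : Diag α β) : comp (idDiag α) d = d := by
  rw [comp, id_glue, ← Setoid.comap_comp]
  ext x y
  rcases x with x | x <;> rcases y with y | y <;> rfl

theorem loops_id (d : Diag α β) : loops d (idDiag β) = 0 := by
  have : inside (glue d (idDiag β)) (Set.range mid) = ∅ := by
    rw [Set.eq_empty_iff_forall_notMem]
    intro c hc
    obtain ⟨x, rfl, h⟩ := mem_inside.1 hc
    obtain ⟨b, rfl⟩ := h x (Setoid.refl' _ x)
    obtain ⟨b', hb'⟩ := h (Sum.inr (Sum.inr b)) (by rw [glue_id]; exact d.refl _)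
    simp [mid] at hb'
  rw [loops, this, Set.ncard_empty]

theorem id_loops (d : Diag α β) : loops (idDiag α) d = 0 := by
  have : inside (glue (idDiag α) d) (Set.range mid) = ∅ := by
    rw [Set.eq_empty_iff_forall_notMem]
    intro c hc
    obtain ⟨x, rfl, h⟩ := mem_inside.1 hc
    obtain ⟨b, rfl⟩ := h x (Setoid.refl' _ x)
    obtain ⟨b', hb'⟩ := h (Sum.inl b) (by rw [id_glue]; exact d.refl _)
    simp [mid] at hb'
  rw [loops, this, Set.ncard_empty]

end Facts

end Concatenation

/-- The partition algebra `P_k(n)`: the complex vector space with basis the diagrams with two rows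
of `k` vertices. -/
def PartitionAlgebra (k : ℕ) (_n : ℂ) : Type := Diag (Fin k) (Fin k) →₀ ℂ

namespace PartitionAlgebra

variable {k : ℕ} {n : ℂ}

noncomputable instance : AddCommGroup (PartitionAlgebra k n) :=
  inferInstanceAs (AddCommGroup (Diag (Fin k) (Fin k) →₀ ℂ))

noncomputable instance : Module ℂ (PartitionAlgebra k n) :=
  inferInstanceAs (Module ℂ (Diag (Fin k) (Fin k) →₀ ℂ))

/-- The basis element of `P_k(n)` given by a diagram. -/
noncomputable def diagram (n : ℂ) (d : Diag (Fin k) (Fin k)) : PartitionAlgebra k n :=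
  Finsupp.single d 1

/-- The linear extension to `P_k(n)` of a function on diagrams. -/
noncomputable def lift {M : Type} [AddCommGroup M] [Module ℂ M] (f : Diag (Fin k) (Fin k) → M) :
    PartitionAlgebra k n →ₗ[ℂ] M :=
  Finsupp.linearCombination ℂ f

theorem lift_diagram {M : Type} [AddCommGroup M] [Module ℂ M] (f : Diag (Fin k) (Fin k) → M)
    (d : Diag (Fin k) (Fin k)) : lift f (diagram n d) = f d := by
  have := Finsupp.linearCombination_single ℂ (v := f) 1 d
  rw [one_smul] at this
  exact this

/-- The bilinear product with `d₁ d₂ = n ^ ℓ(d₁, d₂) (d₁ ∘ d₂)` on diagrams. -/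
noncomputable def mulHom (k : ℕ) (n : ℂ) :
    PartitionAlgebra k n →ₗ[ℂ] PartitionAlgebra k n →ₗ[ℂ] PartitionAlgebra k n :=
  lift fun d₁ => lift fun d₂ => n ^ loops d₁ d₂ • diagram n (comp d₁ d₂)

noncomputable instance : Mul (PartitionAlgebra k n) := ⟨fun a b => mulHom k n a b⟩

noncomputable instance : One (PartitionAlgebra k n) := ⟨diagram n (idDiag (Fin k))⟩

theorem mul_def (a b : PartitionAlgebra k n) : a * b = mulHom k n a b := rfl

theorem one_def : (1 : PartitionAlgebra k n) = diagram n (idDiag (Fin k)) := rfl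

theorem diagram_mul (d₁ d₂ : Diag (Fin k) (Fin k)) :
    diagram n d₁ * diagram n d₂ = n ^ loops d₁ d₂ • diagram n (comp d₁ d₂) := by
  rw [mul_def, mulHom, lift_diagram, lift_diagram]

theorem hom_ext {M : Type} [AddCommGroup M] [Module ℂ M] {f g : PartitionAlgebra k n →ₗ[ℂ] M}
    (h : ∀ d, f (diagram n d) = g (diagram n d)) : f = g :=
  Finsupp.lhom_ext' fun d => LinearMap.ext_ring (h d)

theorem mul_assoc' (a b c : PartitionAlgebra k n) : a * b * c = a * (b * c) := by
  let L : PartitionAlgebra k n →ₗ[ℂ] PartitionAlgebra k n →ₗ[ℂ] PartitionAlgebra k n →ₗ[ℂ]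
      PartitionAlgebra k n :=
    (mulHom k n).compr₂ (mulHom k n)
  let R : PartitionAlgebra k n →ₗ[ℂ] PartitionAlgebra k n →ₗ[ℂ] PartitionAlgebra k n →ₗ[ℂ]
      PartitionAlgebra k n :=
    LinearMap.mk₂ ℂ (fun a b => (mulHom k n a).comp (mulHom k n b))
      (by intros; ext; simp) (by intros; ext; simp) (by intros; ext; simp) (by intros; ext; simp)
  have hLR : L = R := by
    refine hom_ext fun d₁ => hom_ext fun d₂ => hom_ext fun d₃ => ?_
    change diagram n d₁ * diagram n d₂ * diagram n d₃ = diagram n d₁ * (diagram n d₂ * diagram n d₃)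
    rw [diagram_mul, diagram_mul, mul_def, mul_def, map_smul, map_smul, LinearMap.smul_apply,
      ← mul_def, ← mul_def, diagram_mul, diagram_mul, smul_smul, smul_smul, ← pow_add, ← pow_add,
      comp_assoc, loops_assoc]
  exact LinearMap.congr_fun (LinearMap.congr_fun (LinearMap.congr_fun hLR a) b) c

theorem one_mul' (a : PartitionAlgebra k n) : 1 * a = a := by
  have : mulHom k n 1 = LinearMap.id := by
    refine hom_ext fun d => ?_
    change diagram n (idDiag (Fin k)) * diagram n d = diagram n d
    rw [diagram_mul, id_loops, id_comp, pow_zero, one_smul]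
  exact LinearMap.congr_fun this a

theorem mul_one' (a : PartitionAlgebra k n) : a * 1 = a := by
  have : (mulHom k n).flip 1 = LinearMap.id := by
    refine hom_ext fun d => ?_
    change diagram n d * diagram n (idDiag (Fin k)) = diagram n d
    rw [diagram_mul, loops_id, comp_id, pow_zero, one_smul]
  exact LinearMap.congr_fun this a

noncomputable instance : Ring (PartitionAlgebra k n) :=
  { (inferInstance : AddCommGroup (PartitionAlgebra k n)) with
    mul := (· * ·)
    one := 1
    left_distrib := fun a b c => map_add (mulHom k n a) b c
    right_distrib := fun a b c => by
      change mulHom k n (a + b) c = mulHom k n a c + mulHom k n b c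
      rw [map_add, LinearMap.add_apply]
    zero_mul := fun a => by
      change mulHom k n 0 a = 0
      rw [map_zero, LinearMap.zero_apply]
    mul_zero := fun a => map_zero (mulHom k n a)
    mul_assoc := mul_assoc'
    one_mul := one_mul'
    mul_one := mul_one' }

noncomputable instance : Algebra ℂ (PartitionAlgebra k n) :=
  Algebra.ofModule
    (fun r a b => by
      change mulHom k n (r • a) b = r • mulHom k n a b
      rw [map_smul, LinearMap.smul_apply])
    (fun r a b => map_smul (mulHom k n a) r b)

end PartitionAlgebra

/-! ### Young symmetrizers and Specht modules -/

/-- The reading order of the cells of a Young diagram: down the columns, the columns from left to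
right. -/
def columnKey : ℕ × ℕ ↪ ℕ ×ₗ ℕ :=
  (Equiv.prodComm ℕ ℕ).toEmbedding.trans (toLex : ℕ × ℕ ≃ ℕ ×ₗ ℕ).toEmbedding

/-- The column-reading tableau `t_c` of shape `μ`, as the function sending the entry `i` to the
cell (row, column) that contains it. -/
def columnTableau (μ : YoungDiagram) (i : Fin μ.card) : ℕ × ℕ :=
  (ofLex ((μ.cells.map columnKey).orderEmbOfFin (Finset.card_map _) i)).swap

/-- The group algebra `ℂ S_m`. -/
abbrev SymGroupAlgebra (m : ℕ) : Type := MonoidAlgebra ℂ (Equiv.Perm (Fin m))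

/-- The Young symmetrizer `p_μ = ∑_γ ∑_ρ sign(γ) γ ρ`, where `γ` runs through the column group and
`ρ` through the row group of the column-reading tableau. -/
noncomputable def youngSymmetrizer (μ : YoungDiagram) : SymGroupAlgebra μ.card :=
  ∑ γ : Equiv.Perm (Fin μ.card) with ∀ i, (columnTableau μ (γ i)).2 = (columnTableau μ i).2,
    ∑ ρ : Equiv.Perm (Fin μ.card) with ∀ i, (columnTableau μ (ρ i)).1 = (columnTableau μ i).1,
      ((Equiv.Perm.sign γ : ℤ) : ℂ) • MonoidAlgebra.of ℂ _ (γ * ρ)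

/-- The irreducible `S_m`-module indexed by `μ`: the left ideal `(ℂ S_m) p_μ`. -/
noncomputable abbrev Specht (μ : YoungDiagram) : Submodule (SymGroupAlgebra μ.card)
    (SymGroupAlgebra μ.card) :=
  Submodule.span (SymGroupAlgebra μ.card) {youngSymmetrizer μ}

/-! ### Symmetric diagrams and the twisted conjugation action -/

section Symmetric

variable {k m : ℕ}

/-- Symmetric `m`-diagrams: `w = wᵀ`, there are `m` propagating blocks, and each of them is
connected to its mirror image. -/
def IsSymDiagram (m : ℕ) (w : Diag (Fin k) (Fin k)) : Prop :=
  flip w = w ∧ pn w = m ∧ ∀ c ∈ propBlocks w, ∀ a, Sum.inl a ∈ c → Sum.inr a ∈ c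

/-- The set of symmetric `m`-diagrams. -/
abbrev SymDiagram (k m : ℕ) : Type := {w : Diag (Fin k) (Fin k) // IsSymDiagram m w}

open Classical in
/-- The maximum entries, in the top row, of the propagating blocks. -/
noncomputable def propMax (w : Diag (Fin k) (Fin k)) : Finset (Fin k) :=
  {a | ∃ c ∈ propBlocks w, Sum.inl a ∈ c ∧ ∀ b, Sum.inl b ∈ c → b ≤ a}

theorem card_propMax (w : Diag (Fin k) (Fin k)) : (propMax w).card = pn w := by
  classical
  rw [pn, ← Set.ncard_coe_finset]
  refine Set.ncard_congr (fun a _ => {x | w x (Sum.inl a)}) ?_ ?_ ?_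
  · intro a ha
    obtain ⟨c, hc, hac, -⟩ : ∃ c ∈ propBlocks w, Sum.inl a ∈ c ∧ ∀ b, Sum.inl b ∈ c → b ≤ a := by
      simpa [propMax] using ha
    have : c = {x | w x (Sum.inl a)} :=
      Setoid.eq_of_mem_classes hc.1 hac (Setoid.mem_classes w _) (w.refl _)
    exact this ▸ hc
  · intro a b ha hb hab
    obtain ⟨c, hc, hac, ha'⟩ : ∃ c ∈ propBlocks w, Sum.inl a ∈ c ∧ ∀ b, Sum.inl b ∈ c → b ≤ a := by
      simpa [propMax] using ha
    obtain ⟨e, he, hbe, hb'⟩ : ∃ c ∈ propBlocks w, Sum.inl b ∈ c ∧ ∀ a, Sum.inl a ∈ c → a ≤ b := by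
      simpa [propMax] using hb
    have h1 : c = {x | w x (Sum.inl a)} :=
      Setoid.eq_of_mem_classes hc.1 hac (Setoid.mem_classes w _) (w.refl _)
    have h2 : e = {x | w x (Sum.inl b)} :=
      Setoid.eq_of_mem_classes he.1 hbe (Setoid.mem_classes w _) (w.refl _)
    have hce : c = e := by rw [h1, h2]; exact hab
    subst hce
    exact le_antisymm (hb' a hac) (ha' b hbe)
  · intro c hc
    obtain ⟨a₀, ha₀⟩ := hc.2.1
    have hne : (Finset.univ.filter fun a : Fin k => Sum.inl a ∈ c).Nonempty := ⟨a₀, by simpa⟩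
    have hmem := Finset.max'_mem _ hne
    set a := (Finset.univ.filter fun a : Fin k => Sum.inl a ∈ c).max' hne with ha
    have hac : Sum.inl a ∈ c := by simpa using hmem
    refine ⟨a, ?_, ?_⟩
    · simp only [propMax, Finset.coe_filter, Finset.mem_univ, true_and, Set.mem_ofPred_eq]
      exact ⟨c, hc, hac, fun b hb => Finset.le_max' _ b (by simpa using hb)⟩
    · exact Setoid.eq_of_mem_classes (Setoid.mem_classes w _) (w.refl _) hc.1 hac

/-- The maximum entry of the `i`th propagating block of a symmetric `m`-diagram, in max-entry
order. -/
noncomputable def propEnum (w : SymDiagram k m) : Fin m ↪o Fin k :=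
  (propMax w.1).orderEmbOfFin ((card_propMax w.1).trans w.2.2.1)

/-- The conjugate `d ∘ w ∘ dᵀ`. -/
def conj (d w : Diag (Fin k) (Fin k)) : Diag (Fin k) (Fin k) := comp d (comp w (flip d))

/-- In the diagram `d` placed above `w`, the `i`th propagating block of `w` is connected to the
`σ i`th propagating block of `w' = d ∘ w ∘ dᵀ`. -/
def IsTwist (d : Diag (Fin k) (Fin k)) (w w' : SymDiagram k m) (σ : Equiv.Perm (Fin m)) : Prop :=
  ∀ i, glue d w.1 (Sum.inl (propEnum w' (σ i))) (mid (propEnum w i))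

open Classical in
/-- The twist `σ_{d,w}` of the conjugation of `w` by `d`. -/
noncomputable def twist (d : Diag (Fin k) (Fin k)) (w w' : SymDiagram k m) : Equiv.Perm (Fin m) :=
  if h : ∃ σ, IsTwist d w w' σ then h.choose else 1

/-- The space `W ⊗ S^μ`, where `W` has the symmetric `|μ|`-diagrams as a basis. -/
abbrev SymModule (k : ℕ) (μ : YoungDiagram) : Type :=
  (SymDiagram k μ.card →₀ ℂ) ⊗[ℂ] (Specht μ)

open Classical in
/-- The value `d · (w ⊗ v)` of the twisted conjugation action. The diagram `d ∘ w ∘ dᵀ` always is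
a symmetric `m'`-diagram, where `m'` is its propagating number, so that the condition of the
case distinction says that its propagating number is still `|μ|`. -/
noncomputable def twistedAction (n : ℂ) {μ : YoungDiagram} (d : Diag (Fin k) (Fin k))
    (w : SymDiagram k μ.card) (v : Specht μ) : SymModule k μ :=
  if h : IsSymDiagram μ.card (conj d w.1) then
    n ^ loops d w.1 • (Finsupp.single (⟨conj d w.1, h⟩ : SymDiagram k μ.card) (1 : ℂ) ⊗ₜ[ℂ]
      (MonoidAlgebra.of ℂ _ (twist d w ⟨conj d w.1, h⟩) • v))
  else 0

end Symmetric

/-! ### Set-partition tableaux -/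

/-- The Young diagram `λ*` obtained from `λ` by removing the first row. -/
def removeFirstRow (lam : YoungDiagram) : YoungDiagram where
  cells := (lam.cells.filter fun c => 1 ≤ c.1).image fun c => (c.1 - 1, c.2)
  isLowerSet := by
    rintro ⟨a, b⟩ ⟨a', b'⟩ ⟨h1, h2⟩ h
    simp only [Finset.coe_image, Finset.coe_filter, Set.mem_image, Set.mem_ofPred_eq,
      YoungDiagram.mem_cells, Prod.exists, Prod.mk.injEq] at h ⊢
    obtain ⟨i, j, ⟨hij, hi⟩, rfl, rfl⟩ := h
    simp only at h1 h2
    exact ⟨a' + 1, b', ⟨lam.up_left_mem (by omega) h2 hij, by omega⟩, by omega, rfl⟩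

theorem mem_removeFirstRow {lam : YoungDiagram} {i j : ℕ} :
    (i, j) ∈ removeFirstRow lam ↔ (i + 1, j) ∈ lam := by
  rw [← YoungDiagram.mem_cells]
  simp only [removeFirstRow, Finset.mem_image, Finset.mem_filter, YoungDiagram.mem_cells,
    Prod.exists, Prod.mk.injEq]
  constructor
  · rintro ⟨a, b, ⟨h, ha⟩, rfl, rfl⟩
    rwa [Nat.sub_add_cancel ha]
  · intro h
    exact ⟨i + 1, j, ⟨h, by omega⟩, rfl, rfl⟩

/-- The cells (row, column) of the skew shape `λ/[n-t]`, where `λ` is a partition of `n`. -/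
def skewCells (lam : YoungDiagram) (t : ℕ) : Set (ℕ × ℕ) :=
  {c | c ∈ lam ∧ (c.1 = 0 → lam.card - t ≤ c.2)}

/-- A set-partition tableau of shape `λ ⊢ n`, with content a set partition of a `k`-element set
into `t` blocks, where `|λ*| ≤ t ≤ n`: the cells of `λ/[n-t]` are filled bijectively with the
blocks. By convention, `box` is empty outside `λ/[n-t]`. -/
@[ext]
structure SPTableau (lam : YoungDiagram) (k : ℕ) where
  /-- the content -/
  content : Setoid (Fin k)
  lower_le : (removeFirstRow lam).card ≤ content.classes.ncard
  le_card : content.classes.ncard ≤ lam.card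
  /-- the block in a given cell -/
  box : ℕ × ℕ → Set (Fin k)
  bijOn : Set.BijOn box (skewCells lam content.classes.ncard) content.classes
  box_empty : ∀ c, c ∉ skewCells lam content.classes.ncard → box c = ∅

/-- Max-entry order on nonempty disjoint blocks. -/
def MaxLT {k : ℕ} (A B : Set (Fin k)) : Prop := ∃ b ∈ B, ∀ a ∈ A, a < b

theorem MaxLT.trans {k : ℕ} {A B C : Set (Fin k)} (h : MaxLT A B) (h' : MaxLT B C) : MaxLT A C := by
  obtain ⟨b, hb, hab⟩ := h
  obtain ⟨c, hc, hbc⟩ := h'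
  exact ⟨c, hc, fun a ha => (hab a ha).trans (hbc b hb)⟩

theorem MaxLT.irrefl {k : ℕ} (A : Set (Fin k)) : ¬ MaxLT A A := by
  rintro ⟨a, ha, h⟩
  exact lt_irrefl _ (h a ha)

namespace SPTableau

variable {lam : YoungDiagram} {k : ℕ}

/-- The cells occupied by a set-partition tableau. -/
def cells (T : SPTableau lam k) : Set (ℕ × ℕ) := skewCells lam T.content.classes.ncard

/-- The first row increases from left to right. -/
def FirstRowIncreasing (T : SPTableau lam k) : Prop :=
  ∀ j j', j < j' → (0, j) ∈ T.cells → (0, j') ∈ T.cells → MaxLT (T.box (0, j)) (T.box (0, j'))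

/-- Standard set-partition tableaux: the rows increase from left to right and the columns increase
from top to bottom. -/
def IsStandard (T : SPTableau lam k) : Prop :=
  (∀ i j j', j < j' → (i, j) ∈ T.cells → (i, j') ∈ T.cells →
    MaxLT (T.box (i, j)) (T.box (i, j'))) ∧
  ∀ i i' j, i < i' → (i, j) ∈ T.cells → (i', j) ∈ T.cells → MaxLT (T.box (i, j)) (T.box (i', j))

theorem IsStandard.firstRowIncreasing {T : SPTableau lam k} (h : T.IsStandard) :
    T.FirstRowIncreasing := h.1 0

/-- The permutation of cells that fixes the first row and acts as `g` on the copy of the shape `λ*`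
below the first row. -/
def lowerPerm (g : Equiv.Perm (removeFirstRow lam).cells) : ℕ × ℕ → ℕ × ℕ
  | (0, j) => (0, j)
  | (i + 1, j) =>
    ((Equiv.Perm.ofSubtype g (i, j)).1 + 1, (Equiv.Perm.ofSubtype g (i, j)).2)

theorem lowerPerm_lowerPerm (g h : Equiv.Perm (removeFirstRow lam).cells) (c : ℕ × ℕ) :
    lowerPerm g (lowerPerm h c) = lowerPerm (g * h) c := by
  rcases c with ⟨_ | i, j⟩ <;> simp [lowerPerm]

theorem lowerPerm_one (c : ℕ × ℕ) :
    lowerPerm (1 : Equiv.Perm (removeFirstRow lam).cells) c = c := by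
  rcases c with ⟨_ | i, j⟩ <;> simp [lowerPerm]

theorem lowerPerm_mem (g : Equiv.Perm (removeFirstRow lam).cells) (t : ℕ) {c : ℕ × ℕ}
    (hc : c ∈ skewCells lam t) : lowerPerm g c ∈ skewCells lam t := by
  rcases c with ⟨_ | i, j⟩
  · exact hc
  · have h : (i, j) ∈ (removeFirstRow lam).cells := mem_removeFirstRow.2 hc.1
    refine ⟨?_, fun h => by simp [lowerPerm] at h⟩
    simp only [lowerPerm, Equiv.Perm.ofSubtype_apply_of_mem g h]
    exact mem_removeFirstRow.1 (g ⟨(i, j), h⟩).2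

theorem lowerPerm_bijective (g : Equiv.Perm (removeFirstRow lam).cells) (t : ℕ) :
    Set.BijOn (lowerPerm g) (skewCells lam t) (skewCells lam t) := by
  have h1 : ∀ c, lowerPerm g⁻¹ (lowerPerm g c) = c := fun c => by
    rw [lowerPerm_lowerPerm, inv_mul_cancel, lowerPerm_one]
  have h2 : ∀ c, lowerPerm g (lowerPerm g⁻¹ c) = c := fun c => by
    rw [lowerPerm_lowerPerm, mul_inv_cancel, lowerPerm_one]
  refine ⟨fun c hc => lowerPerm_mem g t hc, fun c _ c' _ h => ?_, fun c hc => ?_⟩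
  · rw [← h1 c, ← h1 c']
    exact congrArg _ h
  · exact ⟨_, lowerPerm_mem g⁻¹ t hc, h2 c⟩

/-- The tableau obtained by permuting the positions of the propagating blocks: the cell `c` of
the new tableau contains the block in the cell `g c` of the old one. -/
def permute (T : SPTableau lam k) (g : Equiv.Perm (removeFirstRow lam).cells) : SPTableau lam k where
  content := T.content
  lower_le := T.lower_le
  le_card := T.le_card
  box := fun c => T.box (lowerPerm g c)
  bijOn := T.bijOn.comp (lowerPerm_bijective g _)
  box_empty := fun c hc => T.box_empty _ fun h => hc (by
    have := lowerPerm_mem g⁻¹ _ h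
    rwa [lowerPerm_lowerPerm, inv_mul_cancel, lowerPerm_one] at this)

theorem FirstRowIncreasing.permute {T : SPTableau lam k} (h : T.FirstRowIncreasing)
    (g : Equiv.Perm (removeFirstRow lam).cells) : (T.permute g).FirstRowIncreasing := h

/-- The set of points of the top row of `d` that are connected to the block in the cell `c` of `T`
when `d` is placed above `T`. -/
def connected (d : Diag (Fin k) (Fin k)) (T : SPTableau lam k) (c : ℕ × ℕ) : Set (Fin k) :=
  {x | ∃ y ∈ T.box c, glue d (oneLine T.content) (Sum.inl x) (mid y)}

/-- `T' = d(T)`: the blocks of `T'` are the blocks of `top (d ∘ π)`, where `π` is the content of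
`T`; each propagating block of `T` is replaced with the block it is connected to; the other blocks
of `top (d ∘ π)` are non-propagating, and they increase along the first row. -/
def IsAct (d : Diag (Fin k) (Fin k)) (T T' : SPTableau lam k) : Prop :=
  T'.content = top (comp d (oneLine T.content)) ∧
  (∀ i j, (i + 1, j) ∈ lam → T'.box (i + 1, j) = connected d T (i + 1, j)) ∧
  T'.FirstRowIncreasing

theorem IsAct.unique {d : Diag (Fin k) (Fin k)} {T T₁ T₂ : SPTableau lam k} (h₁ : IsAct d T T₁)
    (h₂ : IsAct d T T₂) : T₁ = T₂ := by
  have hcon : T₁.content = T₂.content := h₁.1.trans h₂.1.symm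
  have hcells : T₁.cells = T₂.cells := by rw [cells, cells, hcon]
  have hlow : ∀ i j, T₁.box (i + 1, j) = T₂.box (i + 1, j) := by
    intro i j
    by_cases hij : (i + 1, j) ∈ lam
    · rw [h₁.2.1 i j hij, h₂.2.1 i j hij]
    · rw [T₁.box_empty _ fun h => hij h.1, T₂.box_empty _ fun h => hij h.1]
  -- a block in the first row of one tableau is in the first row of the other
  have main : ∀ {S₁ S₂ : SPTableau lam k}, S₁.content = S₂.content → S₁.cells = S₂.cells →
      (∀ i j, S₁.box (i + 1, j) = S₂.box (i + 1, j)) → ∀ j, (0, j) ∈ S₁.cells →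
      ∃ j', (0, j') ∈ S₁.cells ∧ S₁.box (0, j) = S₂.box (0, j') := by
    intro S₁ S₂ hc hs hl j hj
    have : S₁.box (0, j) ∈ S₂.content.classes := hc ▸ S₁.bijOn.mapsTo hj
    obtain ⟨⟨_ | i, j'⟩, hj', he⟩ := S₂.bijOn.surjOn this
    · exact ⟨j', hs ▸ hj', he.symm⟩
    · have h := S₁.bijOn.injOn hj (hs ▸ hj' : _ ∈ S₁.cells) (he.symm.trans (hl i j').symm)
      simp at h
  have hrow : ∀ j, (0, j) ∈ T₁.cells → T₁.box (0, j) = T₂.box (0, j) := by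
    intro j
    induction j using Nat.strong_induction_on with
    | _ j ih =>
      intro hj
      obtain ⟨a, ha, hja⟩ := main hcon hcells hlow j hj
      obtain ⟨b, hb, hjb⟩ :=
        main hcon.symm hcells.symm (fun i j => (hlow i j).symm) j (hcells ▸ hj)
      rw [← hcells] at hb
      have hja' : j ≤ a := by
        by_contra hlt
        push Not at hlt
        have h := T₁.bijOn.injOn hj ha (hja.trans (ih a hlt ha).symm)
        simp only [Prod.mk.injEq, true_and] at h
        omega
      have hjb' : j ≤ b := by
        by_contra hlt
        push Not at hlt
        have h := T₂.bijOn.injOn (hcells ▸ hj : _ ∈ T₂.cells) (hcells ▸ hb : _ ∈ T₂.cells)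
          (hjb.trans (ih b hlt hb))
        simp only [Prod.mk.injEq, true_and] at h
        omega
      rcases hja'.eq_or_lt with rfl | hja'
      · exact hja
      rcases hjb'.eq_or_lt with rfl | hjb'
      · exact hjb.symm
      · have e1 := h₁.2.2 j b hjb' hj hb
        have e2 := h₂.2.2 j a hja' (hcells ▸ hj) (hcells ▸ ha)
        rw [← hja, hjb] at e2
        exact absurd (e1.trans e2) (MaxLT.irrefl _)
  refine SPTableau.ext hcon ?_
  funext ⟨i, j⟩
  rcases i with _ | i
  · by_cases hj : (0, j) ∈ T₁.cells
    · exact hrow j hj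
    · rw [T₁.box_empty _ hj, T₂.box_empty _ (fun h => hj (hcells ▸ h))]
  · exact hlow i j

end SPTableau

/-- The set-partition tableaux whose first row is increasing. -/
abbrev SPTbar (lam : YoungDiagram) (k : ℕ) : Type :=
  {T : SPTableau lam k // T.FirstRowIncreasing}

/-- The standard set-partition tableaux. -/
abbrev SSPT (lam : YoungDiagram) (k : ℕ) : Type := {T : SPTableau lam k // T.IsStandard}

section Natural

variable {lam : YoungDiagram} {k : ℕ}

/-- Permuting the positions of the propagating blocks. -/
def SPTbar.permute (T : SPTbar lam k) (g : Equiv.Perm (removeFirstRow lam).cells) : SPTbar lam k :=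
  ⟨T.1.permute g, T.2.permute g⟩

open Classical in
/-- The action of a diagram on set-partition tableaux; `none` stands for `d(T) = 0`, the case where
the construction does not produce a set-partition tableau. -/
noncomputable def act (d : Diag (Fin k) (Fin k)) (T : SPTableau lam k) : Option (SPTbar lam k) :=
  if h : ∃ T', T.IsAct d T' then some ⟨h.choose, h.choose_spec.2.2⟩ else none

/-- The space with basis `N_T`, where `T` runs through the standard set-partition tableaux. -/
abbrev NaturalModule (lam : YoungDiagram) (k : ℕ) : Type := SSPT lam k →₀ ℂ

/-- The basis vector `N_T` of a standard set-partition tableau. -/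
noncomputable def naturalBasis (T : SSPT lam k) : NaturalModule lam k := Finsupp.single T 1

/-- The cells of the Garnir belt of `(i, j)`: the cells weakly below `(i, j)` in column `j` and the
cells weakly above `(i, j + 1)` in column `j + 1`. -/
def GarnirBelt (i j : ℕ) (c : ℕ × ℕ) : Prop :=
  (c.2 = j ∧ i ≤ c.1) ∨ (c.2 = j + 1 ∧ c.1 ≤ i)

open Classical in
/-- `N` assigns to every set-partition tableau `T` with increasing first row, standard or not, a
vector `N_T`, in such a way that standard tableaux have their basis vectors and that the
propagating blocks satisfy the relations of Young's natural basis: the vectors are alternating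
under the permutations that preserve the columns, and they satisfy the Garnir relations. -/
structure IsStraightening (N : SPTbar lam k → NaturalModule lam k) : Prop where
  standard : ∀ T : SSPT lam k, N ⟨T.1, T.2.firstRowIncreasing⟩ = naturalBasis T
  column : ∀ (T : SPTbar lam k) (g : Equiv.Perm (removeFirstRow lam).cells),
    (∀ c, (g c).1.2 = c.1.2) → N (T.permute g) = ((Equiv.Perm.sign g : ℤ) : ℂ) • N T
  garnir : ∀ (T : SPTbar lam k) (i j : ℕ), (i, j + 1) ∈ removeFirstRow lam →
    ∑ g : Equiv.Perm (removeFirstRow lam).cells with ∀ c, ¬ GarnirBelt i j c.1 → g c = c,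
      ((Equiv.Perm.sign g : ℤ) : ℂ) • N (T.permute g) = 0

/-- The vector `n ^ ℓ(d,T) N_{d(T)}`, or `0` if `d(T) = 0`; here `ℓ(d,T)` is the number of connected
components removed when `d` is placed above the content of `T`. -/
noncomputable def naturalAction (n : ℂ) (N : SPTbar lam k → NaturalModule lam k)
    (d : Diag (Fin k) (Fin k)) (T : SSPT lam k) : NaturalModule lam k :=
  match act d T.1 with
  | some T' => n ^ loops d (oneLine T.1.content) • N T'
  | none => 0

end Natural

end PartAlg

open PartAlg

/-!
The proof realizes both modules inside the functions of colourings `f : (Fin k → Fin n) → ℂ`, that is,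
in the `k`-th tensor power of `ℂⁿ` (`ColourSpace`). A diagram acts there by the matrix whose entry at
two colourings of its rows is `1` if the colourings are constant on the blocks and `0` otherwise
(`colourMap`); summing over the colourings of the middle row produces the factor `n ^ ℓ(d₁, d₂)`, so
that these matrices multiply as the diagrams do (`colourMap_colourMap`).

A set partition `π` with `m` marked blocks gives a function of colourings (`markedFunction`): it is
supported on the colourings that are constant on the blocks of `π`, and the `i`th marked block
contributes the factor `1`, `-1` or `0` according to whether its colour is `2i`, `2i + 1` or another
one. Since every marked block carries a function that is odd under the transposition of `2i` and
`2i + 1`, a diagram kills the function if it merges two marked blocks or disconnects one of them from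
the top row; otherwise it acts by the concatenation of set partitions
(`colourMap_markedFunction`, `colourMap_markedFunction_eq_zero`). For `n ≥ 2k` the functions of
different marked set partitions are linearly independent (`linearIndependent_markedFunction`).

A symmetric `m`-diagram is the same thing as a set partition with a set of `m` marked blocks
(`eq_symOf`), and conjugation by `d` becomes concatenation (`conj_symOf`). Therefore `W ⊗ S^{λ*}`
embeds into the functions of colourings compatibly with the diagrams (`realization_injective`,
`realization_twistedOp`), and the twisted conjugation action inherits associativity. It is
irreducible because the matrices of the symmetric diagrams are symmetric: a non-zero vector `u` is not
orthogonal to all marked functions, as it is realized by a combination of them and the Hermitian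
form is positive definite. Hence some symmetric `m`-diagram `w` does not kill `u`, and the image is a
vector `w ⊗ v` because conjugation by `w` cannot produce another symmetric `m`-diagram
(`exists_twistedOp_eq_tmul`). From `w ⊗ v` the diagrams reach all `w' ⊗ σ v` (`exists_link`), and
`S^{λ*}` is irreducible by the classical properties of Young symmetrizers.

A tableau `T` is sent to `w ⊗ σ p_{λ*}`, where `w` has the content of `T` as its rows and the blocks
below the first row of `T` as its propagating blocks, and `σ` records their order (`SPTableau.vec`).
The Specht module satisfies the column and Garnir relations, so these vectors do. The straightening
algorithm (`straightening`) shows that a function satisfying the relations takes its values in the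
integral span of its values at standard tableaux: this is the uniqueness and integrality of `N`, and
it shows that the vectors of standard tableaux span. They are linearly independent because the
standard polytabloids are (`linearIndependent_polytabloid`). Thus they form a basis, and `N` is the
coordinate map. Finally `d` acts on the vector of `T` by `n ^ ℓ(d, T)` times the vector of `d(T)`
(`SPTableau.twistedOp_vec`), which makes the coordinate map an isomorphism of modules.
-/

open PartAlg

namespace PartAlg

/-! ### Young symmetrizers -/

section Symmetrizer

variable {ι : Type}

theorem fiber_inv {b : ι → ℕ} {γ : Equiv.Perm ι} (h : ∀ i, b (γ i) = b i) (i : ι) :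
    b (γ⁻¹ i) = b i := by
  conv_rhs => rw [← γ.apply_symm_apply i, h]
  rfl

theorem coeff_of_mul (γ : Equiv.Perm ι) (x : MonoidAlgebra ℂ (Equiv.Perm ι)) (σ : Equiv.Perm ι) :
    (MonoidAlgebra.of ℂ _ γ * x).coeff σ = x.coeff (γ⁻¹ * σ) := by
  rw [MonoidAlgebra.of_apply, MonoidAlgebra.coeff_single_mul_apply, one_mul]

/-- Rearrangement: a filling that increases down the columns has the largest sum of `row * entry`
among its column permutations. -/
theorem sum_mul_perm_lt [Fintype ι] {a b v : ι → ℕ} (hab : ∀ i j, a i = a j → b i = b j → i = j)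
    (hv : ∀ i j, b i = b j → a i < a j → v i < v j) {γ : Equiv.Perm ι} (hγ : ∀ i, b (γ i) = b i)
    (hne : γ ≠ 1) : ∑ i, a i * v (γ i) < ∑ i, a i * v i := by
  -- with large multiples of `b` added, `a` and `v` are ordered alike across all fibres of `b`
  obtain ⟨L, hLa, hLv⟩ : ∃ L, (∀ i, a i < L) ∧ ∀ i, v i < L :=
    ⟨∑ i, a i + ∑ i, v i + 1, fun i => by
      have := Finset.single_le_sum (f := a) (fun _ _ => Nat.zero_le _) (Finset.mem_univ i)
      omega, fun i => by
      have := Finset.single_le_sum (f := v) (fun _ _ => Nat.zero_le _) (Finset.mem_univ i)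
      omega⟩
  have hlt : ∀ {f : ι → ℕ} (_ : ∀ i, f i < L) {i j : ι}, b i < b j →
      f i + L * b i < f j + L * b j := by
    intro f hf i j hij
    have : L * (b i + 1) ≤ L * b j := Nat.mul_le_mul_left _ hij
    have := hf i
    rw [mul_add] at *
    omega
  have hmono : ∀ {i j : ι}, v i + L * b i < v j + L * b j → a i + L * b i < a j + L * b j := by
    intro i j h
    rcases lt_trichotomy (b i) (b j) with hb | hb | hb
    · exact hlt hLa hb
    · rw [hb] at h ⊢
      rcases lt_trichotomy (a i) (a j) with ha | ha | ha
      · omega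
      · rw [hab i j ha hb] at h
        omega
      · have := hv j i hb.symm ha
        omega
    · have := hlt hLv hb
      omega
  have hmono' : ∀ {i j : ι}, a i + L * b i < a j + L * b j → v i + L * b i < v j + L * b j := by
    intro i j h
    rcases lt_trichotomy (b i) (b j) with hb | hb | hb
    · exact hlt hLv hb
    · rw [hb] at h ⊢
      have := hv i j hb (by omega)
      omega
    · have := hlt hLa hb
      omega
  have hM : Monovary (fun i => a i + L * b i) (fun i => v i + L * b i) :=
    fun i j h => (hmono h).le
  have key := (hM.sum_smul_comp_perm_lt_sum_smul_iff (σ := γ)).2 (by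
    intro h
    refine hne ?_
    -- `γ` preserves the strict order, so it is the identity
    let f : ι → ℕ := fun i => a i + L * b i
    have hinj : Function.Injective f := by
      intro i j hij
      rcases lt_trichotomy (b i) (b j) with hb | hb | hb
      · exact absurd hij (hlt hLa hb).ne
      · refine hab i j ?_ hb
        have hij : a i + L * b i = a j + L * b j := hij
        rw [hb] at hij
        omega
      · exact absurd hij (hlt hLa hb).ne'
    have hstep : ∀ i j, f (γ i) < f (γ j) → f i < f j := by
      intro i j hij
      have h1 : f i ≤ f j := h (hmono' hij)
      refine lt_of_le_of_ne h1 fun he => ?_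
      rw [hinj he] at hij
      exact lt_irrefl _ hij
    have hstep' : ∀ i j, f i < f j → f (γ i) < f (γ j) := by
      intro i j hij
      rcases lt_trichotomy (f (γ i)) (f (γ j)) with hh | hh | hh
      · exact hh
      · rw [γ.injective (hinj hh)] at hij
        exact absurd hij (lt_irrefl _)
      · exact absurd hij (hstep _ _ hh).asymm
    let : LinearOrder ι := LinearOrder.lift' f hinj
    let e : ι ≃o ι := ⟨γ, by
      intro i j
      rw [← not_lt, ← not_lt]
      exact not_congr ⟨hstep _ _, hstep' _ _⟩⟩
    have : e = OrderIso.refl ι := Subsingleton.elim _ _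
    ext i
    exact DFunLike.congr_fun this i)
  simp only [smul_eq_mul, mul_add, add_mul, Finset.sum_add_distrib, hγ] at key
  have e1 : ∑ i, L * b i * v (γ i) = ∑ i, L * b i * v i := by
    rw [← Equiv.sum_comp γ fun i => L * b i * v i]
    simp only [hγ]
  rw [e1] at key
  omega

variable [Fintype ι] [DecidableEq ι]

/-- The signed sum over the permutations that preserve the fibres of `b`. For `b` the column
function of a tableau this is its column antisymmetrizer. -/
noncomputable def antisymmetrizer (b : ι → ℕ) : MonoidAlgebra ℂ (Equiv.Perm ι) :=
  ∑ γ : Equiv.Perm ι with ∀ i, b (γ i) = b i,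
    ((Equiv.Perm.sign γ : ℤ) : ℂ) • MonoidAlgebra.of ℂ _ γ

/-- The sum over the permutations that preserve the fibres of `a`. For `a` the row function of a
tableau this is its row symmetrizer. -/
noncomputable def symmetrizer (a : ι → ℕ) : MonoidAlgebra ℂ (Equiv.Perm ι) :=
  ∑ ρ : Equiv.Perm ι with ∀ i, a (ρ i) = a i, MonoidAlgebra.of ℂ _ ρ

theorem sign_mul_sign_self (γ : Equiv.Perm ι) :
    ((Equiv.Perm.sign γ : ℤ) : ℂ) * ((Equiv.Perm.sign γ : ℤ) : ℂ) = 1 := by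
  rcases Int.units_eq_one_or (Equiv.Perm.sign γ) with h | h <;> simp [h]

theorem of_mul_antisymmetrizer {b : ι → ℕ} {γ : Equiv.Perm ι} (h : ∀ i, b (γ i) = b i) :
    MonoidAlgebra.of ℂ _ γ * antisymmetrizer b =
      ((Equiv.Perm.sign γ : ℤ) : ℂ) • antisymmetrizer b := by
  rw [antisymmetrizer, Finset.mul_sum, Finset.smul_sum]
  refine Finset.sum_equiv (Equiv.mulLeft γ) (fun δ => ?_) fun δ _ => ?_
  · simp [h]
  · rw [Equiv.coe_mulLeft, map_mul, map_mul, mul_smul_comm, smul_smul, Units.val_mul, Int.cast_mul,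
      ← mul_assoc, sign_mul_sign_self, one_mul]

theorem antisymmetrizer_mul_of {b : ι → ℕ} {γ : Equiv.Perm ι} (h : ∀ i, b (γ i) = b i) :
    antisymmetrizer b * MonoidAlgebra.of ℂ _ γ =
      ((Equiv.Perm.sign γ : ℤ) : ℂ) • antisymmetrizer b := by
  rw [antisymmetrizer, Finset.sum_mul, Finset.smul_sum]
  refine Finset.sum_equiv (Equiv.mulRight γ) (fun δ => ?_) fun δ _ => ?_
  · simp only [Finset.mem_filter, Finset.mem_univ, true_and, Equiv.coe_mulRight,
      Equiv.Perm.mul_apply]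
    constructor
    · intro hδ i
      rw [hδ, h]
    · intro hδ i
      have h1 : b ((δ * γ) (γ⁻¹ i)) = b (γ⁻¹ i) := hδ _
      rwa [fiber_inv h, ← Equiv.Perm.mul_apply, mul_inv_cancel_right] at h1
  · rw [Equiv.coe_mulRight, map_mul, map_mul, smul_mul_assoc, smul_smul, Units.val_mul,
      Int.cast_mul, mul_comm ((Equiv.Perm.sign δ : ℤ) : ℂ), ← mul_assoc, sign_mul_sign_self,
      one_mul]

theorem of_mul_symmetrizer {a : ι → ℕ} {ρ : Equiv.Perm ι} (h : ∀ i, a (ρ i) = a i) :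
    MonoidAlgebra.of ℂ _ ρ * symmetrizer a = symmetrizer a := by
  rw [symmetrizer, Finset.mul_sum]
  refine Finset.sum_equiv (Equiv.mulLeft ρ) (fun δ => ?_) fun δ _ => ?_
  · simp [h]
  · rw [Equiv.coe_mulLeft, map_mul]

/-- A transposition conjugated by `σ` from the rows to the columns kills the product: it changes
the sign of the left factor and is absorbed by the right factor. -/
theorem antisymmetrizer_mul_of_mul_symmetrizer_eq_zero {a : ι → ℕ} {b : ι → ℕ} {σ : Equiv.Perm ι}
    {i j : ι} (hij : i ≠ j) (hb : b i = b j) (ha : a (σ⁻¹ i) = a (σ⁻¹ j)) :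
    antisymmetrizer b * MonoidAlgebra.of ℂ _ σ * symmetrizer a = 0 := by
  have h1 : ∀ x, b (Equiv.swap i j x) = b x := by
    intro x
    by_cases hx : x = i
    · rw [hx, Equiv.swap_apply_left, hb]
    · by_cases hx' : x = j
      · rw [hx', Equiv.swap_apply_right, hb]
      · rw [Equiv.swap_apply_of_ne_of_ne hx hx']
  have h2 : ∀ x, a (Equiv.swap (σ⁻¹ i) (σ⁻¹ j) x) = a x := by
    intro x
    by_cases hx : x = σ⁻¹ i
    · rw [hx, Equiv.swap_apply_left, ha]
    · by_cases hx' : x = σ⁻¹ j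
      · rw [hx', Equiv.swap_apply_right, ha]
      · rw [Equiv.swap_apply_of_ne_of_ne hx hx']
  have h3 : σ * Equiv.swap (σ⁻¹ i) (σ⁻¹ j) = Equiv.swap i j * σ := by
    rw [Equiv.mul_swap_eq_swap_mul]
    simp
  have key : antisymmetrizer b * MonoidAlgebra.of ℂ _ σ * symmetrizer a =
      -(antisymmetrizer b * MonoidAlgebra.of ℂ _ σ * symmetrizer a) := by
    conv_lhs => rw [← of_mul_symmetrizer h2, mul_assoc, ← mul_assoc (MonoidAlgebra.of ℂ _ σ),
      ← map_mul, h3, map_mul, ← mul_assoc, ← mul_assoc, antisymmetrizer_mul_of h1,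
      Equiv.Perm.sign_swap hij]
    simp
  have h2' : (2 : ℂ) • (antisymmetrizer b * MonoidAlgebra.of ℂ _ σ * symmetrizer a) = 0 := by
    rw [two_smul]
    nth_rewrite 1 [key]
    exact neg_add_cancel _
  exact (smul_eq_zero.1 h2').resolve_left two_ne_zero

open Classical in
/-- The signed sum over the permutations supported in `S`. -/
noncomputable def garnirElement (S : ι → Prop) : MonoidAlgebra ℂ (Equiv.Perm ι) :=
  ∑ g : Equiv.Perm ι with ∀ c, ¬ S c → g c = c,
    ((Equiv.Perm.sign g : ℤ) : ℂ) • MonoidAlgebra.of ℂ _ g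

/-- A transposition inside `S` changes the sign of the Garnir element; if `γ⁻¹` carries it to a row,
then it is absorbed by the row symmetrizer. -/
theorem garnirElement_mul_of_mul_symmetrizer {S : ι → Prop} {a : ι → ℕ} {γ : Equiv.Perm ι}
    {i j : ι} (hi : S i) (hj : S j) (hij : i ≠ j) (ha : a (γ⁻¹ i) = a (γ⁻¹ j)) :
    garnirElement S * MonoidAlgebra.of ℂ _ γ * symmetrizer a = 0 := by
  classical
  have h2 : ∀ x, a (Equiv.swap (γ⁻¹ i) (γ⁻¹ j) x) = a x := by
    intro x
    by_cases hx : x = γ⁻¹ i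
    · rw [hx, Equiv.swap_apply_left, ha]
    · by_cases hx' : x = γ⁻¹ j
      · rw [hx', Equiv.swap_apply_right, ha]
      · rw [Equiv.swap_apply_of_ne_of_ne hx hx']
  have h3 : γ * Equiv.swap (γ⁻¹ i) (γ⁻¹ j) = Equiv.swap i j * γ := by
    rw [Equiv.mul_swap_eq_swap_mul]
    simp
  have h1 : garnirElement S * MonoidAlgebra.of ℂ _ (Equiv.swap i j) = - garnirElement S := by
    rw [garnirElement, Finset.sum_mul, ← Finset.sum_neg_distrib]
    refine Finset.sum_equiv (Equiv.mulRight (Equiv.swap i j)) (fun δ => ?_) fun δ _ => ?_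
    · simp only [Finset.mem_filter, Finset.mem_univ, true_and, Equiv.coe_mulRight,
        Equiv.Perm.mul_apply]
      refine forall₂_congr fun c hc => ?_
      have h1 : c ≠ i := by rintro rfl; exact hc hi
      have h2 : c ≠ j := by rintro rfl; exact hc hj
      rw [Equiv.swap_apply_of_ne_of_ne h1 h2]
    · rw [Equiv.coe_mulRight, map_mul, map_mul, Equiv.Perm.sign_swap hij]
      simp
  have key : garnirElement S * MonoidAlgebra.of ℂ _ γ * symmetrizer a =
      -(garnirElement S * MonoidAlgebra.of ℂ _ γ * symmetrizer a) := by
    conv_lhs => rw [← of_mul_symmetrizer h2, mul_assoc, ← mul_assoc (MonoidAlgebra.of ℂ _ γ),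
      ← map_mul, h3, map_mul, ← mul_assoc, ← mul_assoc, h1]
    simp
  have h2' : (2 : ℂ) • (garnirElement S * MonoidAlgebra.of ℂ _ γ * symmetrizer a) = 0 := by
    rw [two_smul]
    nth_rewrite 1 [key]
    exact neg_add_cancel _
  exact (smul_eq_zero.1 h2').resolve_left two_ne_zero

/-- The belt `S` is too large for its cells to lie in different rows after a column permutation,
by the hypothesis; this is why the Garnir element annihilates the Young symmetrizer. -/
theorem garnirElement_mul_eq_zero {S : ι → Prop} {a b : ι → ℕ}
    (h : ∀ γ : Equiv.Perm ι, (∀ i, b (γ i) = b i) → ∃ i j, S i ∧ S j ∧ i ≠ j ∧ a (γ i) = a (γ j)) :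
    garnirElement S * (antisymmetrizer b * symmetrizer a) = 0 := by
  rw [← mul_assoc, antisymmetrizer, Finset.mul_sum, Finset.sum_mul]
  refine Finset.sum_eq_zero fun γ hγ => ?_
  obtain ⟨i, j, hi, hj, hij, ha⟩ := h γ⁻¹ (fiber_inv (Finset.mem_filter.1 hγ).2)
  rw [mul_smul_comm, smul_mul_assoc, garnirElement_mul_of_mul_symmetrizer hi hj hij ha, smul_zero]

end Symmetrizer

/-! ### The left ideal of a Young symmetrizer -/

section LeftIdeal

/-- Among the finite sets of naturals of a given cardinality, the initial segment has the least
sum. -/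
theorem sum_le_of_isInitial {A D : Finset ℕ} (hA : ∀ x ∈ A, ∀ y < x, y ∈ A)
    (h : D.card = A.card) : ∑ x ∈ A, x ≤ ∑ x ∈ D, x ∧ (∑ x ∈ A, x = ∑ x ∈ D, x → D = A) := by
  have hc : (A \ D).card = (D \ A).card := Finset.card_sdiff_comm h.symm
  have e1 : ∑ x ∈ A, x = ∑ x ∈ A ∩ D, x + ∑ x ∈ A \ D, x := (Finset.sum_inter_add_sum_sdiff A D _).symm
  have e2 : ∑ x ∈ D, x = ∑ x ∈ A ∩ D, x + ∑ x ∈ D \ A, x := by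
    rw [Finset.inter_comm]
    exact (Finset.sum_inter_add_sum_sdiff D A _).symm
  rcases (A \ D).eq_empty_or_nonempty with he | hne
  · have he' : D \ A = ∅ := Finset.card_eq_zero.1 (by rw [← hc, he, Finset.card_empty])
    rw [e1, e2, he, he']
    exact ⟨le_rfl, fun _ => Finset.Subset.antisymm (Finset.sdiff_eq_empty_iff_subset.1 he')
      (Finset.sdiff_eq_empty_iff_subset.1 he)⟩
  · have hlt : ∑ x ∈ A \ D, x < ∑ x ∈ D \ A, x := by
      set M := (A \ D).max' hne
      have h1 : ∑ x ∈ A \ D, x ≤ (A \ D).card * M := by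
        simpa using Finset.sum_le_card_nsmul (A \ D) (fun x => x) M fun x hx => Finset.le_max' _ x hx
      have h2 : (D \ A).card * (M + 1) ≤ ∑ x ∈ D \ A, x := by
        rw [← smul_eq_mul]
        refine Finset.card_nsmul_le_sum (D \ A) (fun x => x) (M + 1) fun x hx => ?_
        by_contra hlt
        have hM := (A \ D).max'_mem hne
        rw [Finset.mem_sdiff] at hx hM
        rcases (show x ≤ M by omega).eq_or_lt with rfl | hxM
        · exact hx.2 hM.1
        · exact hx.2 (hA _ hM.1 _ hxM)
      have h3 : 0 < (A \ D).card := Finset.card_pos.2 hne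
      rw [← hc, mul_add, mul_one] at h2
      omega
    exact ⟨by omega, fun _ => by omega⟩

variable {ι : Type} [Fintype ι]

/-- If no two cells in a column of the second tableau lie in a row of the first one, then the
permutation that relates the two tableaux is a product of a column and a row permutation. The cell
`i` is moved within its column to the row of `σ⁻¹ i`; this lands inside the shape because the sum of
the row indices is the same for both tableaux and is minimal for a shape with columns of given
lengths. -/
theorem exists_eq_mul_of_no_collision {a b : ι → ℕ} (hab : ∀ i j, a i = a j → b i = b j → i = j)
    (hcol : ∀ i, ∀ y < a i, ∃ i', a i' = y ∧ b i' = b i) {σ : Equiv.Perm ι}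
    (h : ∀ i j, b i = b j → a (σ⁻¹ i) = a (σ⁻¹ j) → i = j) :
    ∃ γ ρ : Equiv.Perm ι, (∀ i, b (γ i) = b i) ∧ (∀ i, a (ρ i) = a i) ∧ σ = γ * ρ := by
  classical
  let col : ℕ → Finset ι := fun j => Finset.univ.filter fun i => b i = j
  let A : ℕ → Finset ℕ := fun j => (col j).image a
  let D : ℕ → Finset ℕ := fun j => (col j).image fun i => a (σ⁻¹ i)
  have hAinj : ∀ j, Set.InjOn a (col j) := by
    intro j x hx y hy hxy
    simp only [col, Finset.coe_filter, Finset.mem_univ, true_and, Set.mem_ofPred_eq] at hx hy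
    exact hab x y hxy (hx.trans hy.symm)
  have hDinj : ∀ j, Set.InjOn (fun i => a (σ⁻¹ i)) (col j) := by
    intro j x hx y hy hxy
    simp only [col, Finset.coe_filter, Finset.mem_univ, true_and, Set.mem_ofPred_eq] at hx hy
    exact h x y (hx.trans hy.symm) hxy
  have hA : ∀ j, ∀ x ∈ A j, ∀ y < x, y ∈ A j := by
    intro j x hx y hy
    obtain ⟨i, hi, rfl⟩ := Finset.mem_image.1 hx
    obtain ⟨i', rfl, hi'⟩ := hcol i y hy
    refine Finset.mem_image.2 ⟨i', ?_, rfl⟩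
    simp only [col, Finset.mem_filter, Finset.mem_univ, true_and] at hi ⊢
    rw [hi', hi]
  have hcard : ∀ j, (D j).card = (A j).card := by
    intro j
    rw [Finset.card_image_of_injOn (hAinj j), Finset.card_image_of_injOn (hDinj j)]
  have hsum : ∑ j ∈ Finset.univ.image b, ∑ x ∈ A j, x = ∑ j ∈ Finset.univ.image b, ∑ x ∈ D j, x := by
    have e1 : ∀ j, ∑ x ∈ A j, x = ∑ i ∈ col j, a i := fun j => Finset.sum_image (hAinj j)
    have e2 : ∀ j, ∑ x ∈ D j, x = ∑ i ∈ col j, a (σ⁻¹ i) := fun j => Finset.sum_image (hDinj j)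
    simp only [e1, e2]
    rw [Finset.sum_fiberwise_of_maps_to (fun i _ => Finset.mem_image_of_mem b (Finset.mem_univ i)),
      Finset.sum_fiberwise_of_maps_to (fun i _ => Finset.mem_image_of_mem b (Finset.mem_univ i))]
    exact (Equiv.sum_comp σ⁻¹ a).symm
  have hDA : ∀ j ∈ Finset.univ.image b, D j = A j := fun j hj =>
    (sum_le_of_isInitial (hA j) (hcard j)).2
      ((Finset.sum_eq_sum_iff_of_le fun j _ => (sum_le_of_isInitial (hA j) (hcard j)).1).1 hsum j hj)
  have hex : ∀ i, ∃ i', a i' = a (σ⁻¹ i) ∧ b i' = b i := by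
    intro i
    have : a (σ⁻¹ i) ∈ A (b i) := by
      rw [← hDA _ (Finset.mem_image_of_mem b (Finset.mem_univ i))]
      exact Finset.mem_image.2 ⟨i, by simp [col], rfl⟩
    obtain ⟨i', hi', he⟩ := Finset.mem_image.1 this
    exact ⟨i', he, by simpa [col] using hi'⟩
  choose f hfa hfb using hex
  have hf : Function.Injective f := by
    intro i j hij
    exact h i j (by rw [← hfb i, hij, hfb]) (by rw [← hfa i, hij, hfa])
  let φ : Equiv.Perm ι := Equiv.ofBijective f (Finite.injective_iff_bijective.1 hf)
  have hφ : ∀ i, φ i = f i := fun _ => rfl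
  refine ⟨φ⁻¹, φ * σ, fiber_inv fun i => by rw [hφ, hfb], fun i => ?_, by simp⟩
  rw [Equiv.Perm.mul_apply, hφ, hfa]
  simp

variable [DecidableEq ι]

/-- Von Neumann's lemma on Young symmetrizers. -/
theorem antisymmetrizer_mul_mul_symmetrizer {a b : ι → ℕ}
    (hab : ∀ i j, a i = a j → b i = b j → i = j)
    (hcol : ∀ i, ∀ y < a i, ∃ i', a i' = y ∧ b i' = b i) (x : MonoidAlgebra ℂ (Equiv.Perm ι)) :
    ∃ c : ℂ, antisymmetrizer b * x * symmetrizer a = c • (antisymmetrizer b * symmetrizer a) := by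
  induction x using MonoidAlgebra.induction_on with
  | of σ =>
    by_cases h : ∀ i j, b i = b j → a (σ⁻¹ i) = a (σ⁻¹ j) → i = j
    · obtain ⟨γ, ρ, hγ, hρ, rfl⟩ := exists_eq_mul_of_no_collision hab hcol h
      refine ⟨((Equiv.Perm.sign γ : ℤ) : ℂ), ?_⟩
      rw [map_mul, ← mul_assoc, antisymmetrizer_mul_of hγ, mul_assoc, of_mul_symmetrizer hρ,
        smul_mul_assoc]
    · push Not at h
      obtain ⟨i, j, hb, ha, hij⟩ := h
      exact ⟨0, by rw [antisymmetrizer_mul_of_mul_symmetrizer_eq_zero hij hb ha, zero_smul]⟩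
  | add x y hx hy =>
    obtain ⟨c, hc⟩ := hx
    obtain ⟨d, hd⟩ := hy
    exact ⟨c + d, by rw [mul_add, add_mul, hc, hd, add_smul]⟩
  | smul r x hx =>
    obtain ⟨c, hc⟩ := hx
    exact ⟨r * c, by rw [mul_smul_comm, smul_mul_assoc, hc, smul_smul]⟩

theorem coeff_antisymmetrizer_mul_symmetrizer {a b : ι → ℕ} {τ : Equiv.Perm ι}
    (h : (antisymmetrizer b * symmetrizer a).coeff τ ≠ 0) :
    ∃ γ ρ : Equiv.Perm ι, (∀ i, b (γ i) = b i) ∧ (∀ i, a (ρ i) = a i) ∧ τ = γ * ρ := by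
  by_contra hne
  push Not at hne
  refine h ?_
  rw [antisymmetrizer, symmetrizer, Finset.sum_mul, MonoidAlgebra.coeff_sum, Finsupp.finsetSum_apply]
  refine Finset.sum_eq_zero fun γ hγ => ?_
  rw [Finset.mul_sum, MonoidAlgebra.coeff_sum, Finsupp.finsetSum_apply]
  refine Finset.sum_eq_zero fun ρ hρ => ?_
  rw [smul_mul_assoc, ← map_mul, MonoidAlgebra.coeff_smul_apply, MonoidAlgebra.of_apply,
    MonoidAlgebra.coeff_single, Finsupp.single_eq_of_ne, smul_zero]
  exact hne γ ρ (Finset.mem_filter.1 hγ).2 (Finset.mem_filter.1 hρ).2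

/-- Only `γ = ρ = 1` contributes to the identity, since a permutation that preserves all rows and all
columns is trivial. -/
theorem coeff_one_antisymmetrizer_mul_symmetrizer {a b : ι → ℕ}
    (hab : ∀ i j, a i = a j → b i = b j → i = j) :
    (antisymmetrizer b * symmetrizer a).coeff 1 = 1 := by
  rw [antisymmetrizer, symmetrizer, Finset.sum_mul, MonoidAlgebra.coeff_sum, Finsupp.finsetSum_apply]
  simp only [Finset.mul_sum, MonoidAlgebra.coeff_sum, Finsupp.finsetSum_apply, smul_mul_assoc,
    MonoidAlgebra.coeff_smul_apply, MonoidAlgebra.of_apply, MonoidAlgebra.single_mul_single, mul_one,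
    MonoidAlgebra.coeff_single]
  rw [Finset.sum_eq_single 1, Finset.sum_eq_single 1]
  · simp
  · intro ρ _ hρ
    rw [one_mul, Finsupp.single_eq_of_ne hρ.symm, smul_zero]
  · intro h
    simp at h
  · intro γ hγ hγ1
    refine Finset.sum_eq_zero fun ρ hρ => ?_
    rw [Finsupp.single_eq_of_ne, smul_zero]
    intro h
    refine hγ1 (Equiv.ext fun i => hab _ _ ?_ ((Finset.mem_filter.1 hγ).2 i))
    rw [eq_inv_of_mul_eq_one_left h.symm]
    exact fiber_inv (Finset.mem_filter.1 hρ).2 i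
  · intro h
    simp at h

/-- The adjoint `∑ conj (v σ) σ⁻¹` of an element of a group algebra. -/
noncomputable def adjoint (v : MonoidAlgebra ℂ (Equiv.Perm ι)) : MonoidAlgebra ℂ (Equiv.Perm ι) :=
  ∑ σ, (starRingEnd ℂ) (v.coeff σ) • MonoidAlgebra.of ℂ _ σ⁻¹

theorem coeff_adjoint_mul (v u : MonoidAlgebra ℂ (Equiv.Perm ι)) (τ : Equiv.Perm ι) :
    (adjoint v * u).coeff τ = ∑ σ, (starRingEnd ℂ) (v.coeff σ) * u.coeff (σ * τ) := by
  rw [adjoint, Finset.sum_mul, MonoidAlgebra.coeff_sum, Finsupp.finsetSum_apply]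
  refine Finset.sum_congr rfl fun σ _ => ?_
  rw [smul_mul_assoc, MonoidAlgebra.coeff_smul_apply, coeff_of_mul, inv_inv, smul_eq_mul]

theorem adjoint_eq_self_of_adjoint_mul (v : MonoidAlgebra ℂ (Equiv.Perm ι)) :
    adjoint (adjoint v * v) = adjoint v * v := by
  ext τ
  conv_lhs => rw [← mul_one (adjoint (adjoint v * v)), coeff_adjoint_mul]
  rw [Finset.sum_eq_single τ⁻¹]
  · rw [inv_mul_cancel, MonoidAlgebra.coeff_one_one, mul_one, coeff_adjoint_mul, coeff_adjoint_mul,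
      map_sum, ← Equiv.sum_comp (Equiv.mulRight τ)]
    refine Finset.sum_congr rfl fun σ _ => ?_
    rw [map_mul, Complex.conj_conj, Equiv.coe_mulRight, mul_inv_cancel_right, mul_comm]
  · intro σ _ hσ
    rw [MonoidAlgebra.one_def, MonoidAlgebra.coeff_single, Finsupp.single_eq_of_ne, mul_zero]
    intro h
    exact hσ (eq_inv_of_mul_eq_one_left h)
  · simp

/-- The coefficient of the identity in `v* v` is the squared norm of `v`. -/
theorem adjoint_mul_self_ne_zero {v : MonoidAlgebra ℂ (Equiv.Perm ι)} (hv : v ≠ 0) :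
    adjoint v * v ≠ 0 := by
  intro h
  refine hv ?_
  have h1 := coeff_adjoint_mul v v 1
  rw [h] at h1
  simp only [mul_one, MonoidAlgebra.coeff_zero, Finsupp.coe_zero, Pi.zero_apply,
    ← Complex.normSq_eq_conj_mul_self] at h1
  have h2 : ∑ σ, Complex.normSq (v.coeff σ) = 0 := by exact_mod_cast h1.symm
  ext σ
  exact Complex.normSq_eq_zero.1
    ((Finset.sum_eq_zero_iff_of_nonneg fun _ _ => Complex.normSq_nonneg _).1 h2 σ (Finset.mem_univ σ))

/-- The left ideal generated by a Young symmetrizer `p` is minimal. An element `v` with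
`p x v = 0` for all `x` would generate a left ideal with square zero, contradicting
`u ^ 2 = u* u ≠ 0` for `u = v* v`. -/
theorem symmetrizer_mem_span_of_mem {a b : ι → ℕ} (hab : ∀ i j, a i = a j → b i = b j → i = j)
    (hcol : ∀ i, ∀ y < a i, ∃ i', a i' = y ∧ b i' = b i) {v : MonoidAlgebra ℂ (Equiv.Perm ι)}
    (hv : v ≠ 0) (hmem : ∃ z, v = z * (antisymmetrizer b * symmetrizer a)) :
    ∃ x, x * v = antisymmetrizer b * symmetrizer a := by
  obtain ⟨z, hz⟩ := hmem
  set p := antisymmetrizer b * symmetrizer a with hp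
  have key : ∀ y, ∃ c : ℂ, p * y * p = c • p := by
    intro y
    obtain ⟨c, hc⟩ := antisymmetrizer_mul_mul_symmetrizer hab hcol
      (symmetrizer a * y * antisymmetrizer b)
    exact ⟨c, by rw [hp, ← hc]; simp only [mul_assoc]⟩
  by_cases h : ∀ x, p * (x * v) = 0
  · exfalso
    refine adjoint_mul_self_ne_zero (adjoint_mul_self_ne_zero hv) ?_
    rw [adjoint_eq_self_of_adjoint_mul]
    nth_rewrite 2 [hz]
    rw [mul_assoc, mul_assoc, h, mul_zero, mul_zero]
  · push Not at h
    obtain ⟨x, hx⟩ := h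
    obtain ⟨c, hc⟩ := key (x * z)
    have e : p * (x * v) = c • p := by rw [hz, ← hc]; simp only [mul_assoc]
    have hc0 : c ≠ 0 := by
      rintro rfl
      rw [e, zero_smul] at hx
      exact hx rfl
    refine ⟨c⁻¹ • (p * x), ?_⟩
    rw [smul_mul_assoc, mul_assoc, e, smul_smul, inv_mul_cancel₀ hc0, one_smul]

end LeftIdeal

/-! ### Linear independence of the standard polytabloids -/

section Standard

variable {m : ℕ}

/-- The filling of the cells `(a i, b i)` with the entries `v i` increases along rows and
columns. -/
def IsStandardFilling {ι : Type} (a b v : ι → ℕ) : Prop :=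
  (∀ i j, a i = a j → b i < b j → v i < v j) ∧ ∀ i j, b i = b j → a i < a j → v i < v j

/-- The standard polytabloids are linearly independent: the sum of `row * entry` is larger for a
standard tableau than for all other tabloids in its polytabloid. -/
theorem linearIndependent_standard {a b : Fin m → ℕ}
    (hab : ∀ i j, a i = a j → b i = b j → i = j) :
    LinearIndependent ℂ fun σ : {σ : Equiv.Perm (Fin m) // IsStandardFilling a b fun i => (σ i : ℕ)} =>
      MonoidAlgebra.of ℂ _ σ.1 * (antisymmetrizer b * symmetrizer a) := by
  classical
  rw [linearIndependent_iff']
  intro s g hg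
  by_contra hne
  push Not at hne
  let M : Equiv.Perm (Fin m) → ℕ := fun σ => ∑ i, a i * (σ i : ℕ)
  let N : Equiv.Perm (Fin m) → ℕ := fun σ => ∑ i, b i * (σ i : ℕ)
  have hs : (s.filter fun σ => g σ ≠ 0).Nonempty := by
    obtain ⟨σ, hσ, h⟩ := hne
    exact ⟨σ, Finset.mem_filter.2 ⟨hσ, h⟩⟩
  obtain ⟨σ₀, hσ₀, hmax⟩ := Finset.exists_max_image _ (fun σ => M σ.1) hs
  rw [Finset.mem_filter] at hσ₀
  refine hσ₀.2 ?_
  have h1 := congrArg (fun x => x.coeff σ₀.1) hg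
  simp only [MonoidAlgebra.coeff_sum, Finsupp.finsetSum_apply, MonoidAlgebra.coeff_smul_apply,
    coeff_of_mul, MonoidAlgebra.coeff_zero, Finsupp.coe_zero, Pi.zero_apply, smul_eq_mul] at h1
  rw [Finset.sum_eq_single σ₀] at h1
  · rwa [inv_mul_cancel, coeff_one_antisymmetrizer_mul_symmetrizer hab, mul_one] at h1
  · intro σ hσ hσne
    by_cases h0 : g σ = 0
    · rw [h0, zero_mul]
    by_contra hc
    obtain ⟨γ, ρ, hγ, hρ, he⟩ := coeff_antisymmetrizer_mul_symmetrizer (right_ne_zero_of_mul hc)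
    have he' : σ₀.1 = σ.1 * γ * ρ := by rw [mul_assoc, ← he, mul_inv_cancel_left]
    have hM : M σ₀.1 = ∑ i, a i * (σ.1 (γ i) : ℕ) := by
      rw [← Equiv.sum_comp ρ]
      simp only [M, he', Equiv.Perm.mul_apply, hρ]
    have hγ1 : γ = 1 := by
      by_contra hγ1
      have h2 := sum_mul_perm_lt hab σ.2.2 hγ hγ1
      have h3 := hmax σ (Finset.mem_filter.2 ⟨hσ, h0⟩)
      rw [hM] at h3
      exact absurd h2 (not_lt.2 h3)
    rw [hγ1, mul_one] at he'
    have hρ1 : ρ ≠ 1 := by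
      rintro rfl
      exact hσne (Subtype.ext (by rw [he', mul_one]))
    have h4 := sum_mul_perm_lt (fun i j h h' => hab i j h' h) σ.2.1 hρ hρ1
    have h5 := sum_mul_perm_lt (fun i j h h' => hab i j h' h) σ₀.2.1 (fiber_inv hρ)
      (inv_ne_one.2 hρ1)
    have h6 : ∀ i, σ.1 (ρ i) = σ₀.1 i := fun i => by rw [he']; rfl
    have h7 : ∀ i, σ₀.1 (ρ⁻¹ i) = σ.1 i := fun i => by rw [he']; simp
    simp only [h6] at h4
    simp only [h7] at h5
    exact lt_asymm h4 h5
  · intro h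
    exact absurd hσ₀.1 h

end Standard

/-! ### Straightening -/

section Straightening

/-- Rearrangement on a set `s` where `f` and `v` are ordered oppositely, so that their pairing is minimal
there: a permutation supported in `s` that breaks the opposite order increases the pairing. -/
theorem sum_mul_lt_sum_mul_perm {ι : Type} [Fintype ι] {s : Finset ι} {f v : ι → ℕ}
    {h : Equiv.Perm ι} (hs : ∀ x, x ∉ s → h x = x)
    (hfv : ∀ x ∈ s, ∀ y ∈ s, f x < f y → v y ≤ v x)
    (hex : ∃ x ∈ s, ∃ y ∈ s, f x < f y ∧ v (h x) < v (h y)) :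
    ∑ x, f x * v x < ∑ x, f x * v (h x) := by
  classical
  have hanti : AntivaryOn f v s := by
    intro x hx y hy hxy
    by_contra hlt
    push Not at hlt
    exact absurd hxy (not_lt.2 (hfv x hx y hy hlt))
  have key := (hanti.sum_smul_lt_sum_smul_comp_perm_iff (σ := h) (fun x hx => by
    by_contra hxs
    exact hx (hs x hxs))).2 (by
      obtain ⟨x, hx, y, hy, hxy, hv⟩ := hex
      intro hh
      exact absurd hxy (not_lt.2 (hh hx hy hv)))
  simp only [smul_eq_mul] at key
  rw [← Finset.sum_add_sum_compl s, ← Finset.sum_add_sum_compl s fun x => f x * v (h x)]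
  refine add_lt_add_of_lt_of_le key (le_of_eq (Finset.sum_congr rfl fun x hx => ?_))
  rw [hs x (Finset.mem_compl.1 hx)]

/-- Summation over a group of a function that is constant on the left cosets of a subgroup. -/
theorem sum_eq_card_nsmul_sum_quotient {G V : Type*} [Group G] [Fintype G] [AddCommGroup V]
    (H : Subgroup G) [Fintype (G ⧸ H)] (f : G → V) (hf : ∀ g, ∀ h ∈ H, f (g * h) = f g) :
    ∑ g, f g = Nat.card H • ∑ q : G ⧸ H, f q.out := by
  classical
  rw [← Finset.sum_fiberwise Finset.univ (fun g : G => (g : G ⧸ H)), Finset.smul_sum]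
  refine Finset.sum_congr rfl fun q _ => ?_
  have h1 : ∀ g ∈ Finset.univ.filter (fun g : G => (g : G ⧸ H) = q), f g = f q.out := by
    intro g hg
    have hg' : (g : G ⧸ H) = (q.out : G ⧸ H) := by
      rw [QuotientGroup.out_eq']
      exact (Finset.mem_filter.1 hg).2
    rw [← hf g _ (QuotientGroup.eq.1 hg'), mul_inv_cancel_left]
  rw [Finset.sum_congr rfl h1, Finset.sum_const]
  congr 1
  have h2 := QuotientGroup.card_preimage_mk H {q}
  rw [Nat.card_unique (α := ({q} : Set (G ⧸ H))), mul_one] at h2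
  rw [← h2]
  exact (Nat.subtype_card _ fun g => by simp).symm

/-- The Garnir relation, solved for the summand of the identity. The signed sum over the belt
permutations is constant on the cosets of the column-preserving ones, so that it may be divided by
their number. -/
theorem mem_of_garnir {G V : Type*} [Group G] [Fintype G] [AddCommGroup V] [Module ℂ V]
    (H : Subgroup G) (f : G → V) (hf : ∀ g, ∀ h ∈ H, f (g * h) = f g) (hsum : ∑ g, f g = 0)
    (P : AddSubgroup V) (hP : ∀ g, g ∉ H → f g ∈ P) : f 1 ∈ P := by
  classical
  rw [sum_eq_card_nsmul_sum_quotient H f hf, ← Nat.cast_smul_eq_nsmul ℂ] at hsum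
  have h0 := (smul_eq_zero.1 hsum).resolve_left (Nat.cast_ne_zero.2 Nat.card_pos.ne')
  rw [← Finset.add_sum_erase _ _ (Finset.mem_univ ((1 : G) : G ⧸ H))] at h0
  have h1 : f (Quotient.out ((1 : G) : G ⧸ H)) = f 1 := by
    have : (1 : G)⁻¹ * Quotient.out ((1 : G) : G ⧸ H) ∈ H :=
      QuotientGroup.eq.1 (QuotientGroup.out_eq' _).symm
    rw [← hf 1 _ this, inv_one, one_mul, one_mul]
  rw [h1] at h0
  rw [eq_neg_of_add_eq_zero_left h0]
  refine P.neg_mem (P.sum_mem fun q hq => hP _ fun hmem => (Finset.mem_erase.1 hq).1 ?_)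
  rw [← QuotientGroup.out_eq' q, QuotientGroup.eq, mul_one]
  exact H.inv_mem hmem

/-- The permutations that preserve the fibres of a function. -/
def fiberSubgroup {ι : Type} (b : ι → ℕ) : Subgroup (Equiv.Perm ι) where
  carrier := {γ | ∀ i, b (γ i) = b i}
  mul_mem' := fun h h' i => by rw [Equiv.Perm.mul_apply, h, h']
  one_mem' := fun _ => rfl
  inv_mem' := fun h => fiber_inv h

/-- The permutations supported in a set. -/
def supportedSubgroup {ι : Type} (S : ι → Prop) : Subgroup (Equiv.Perm ι) where
  carrier := {γ | ∀ i, ¬ S i → γ i = i}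
  mul_mem' := fun h h' i hi => by rw [Equiv.Perm.mul_apply, h' i hi, h i hi]
  one_mem' := fun _ _ => rfl
  inv_mem' := fun {γ} h i hi => by rw [Equiv.Perm.inv_eq_iff_eq, h i hi]

/-- Adjacent comparisons suffice for a filling to be standard. -/
theorem isStandardFilling_of_adjacent {μ : YoungDiagram} {v : μ.cells → ℕ}
    (hc : ∀ x y : μ.cells, x.1.2 = y.1.2 → x.1.1 < y.1.1 → v x < v y)
    (hr : ∀ x y : μ.cells, x.1.1 = y.1.1 → x.1.2 + 1 = y.1.2 → v x < v y) :
    IsStandardFilling (fun x : μ.cells => x.1.1) (fun x => x.1.2) v := by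
  refine ⟨?_, hc⟩
  have key : ∀ n : ℕ, ∀ x y : μ.cells, x.1.1 = y.1.1 → x.1.2 + (n + 1) = y.1.2 → v x < v y := by
    intro n
    induction n with
    | zero => exact hr
    | succ n ih =>
      intro x y h1 h2
      have hz : (y.1.1, x.1.2 + (n + 1)) ∈ μ.cells :=
        μ.up_left_mem le_rfl (by omega) (show (y.1.1, y.1.2) ∈ μ from y.2)
      exact (ih x ⟨_, hz⟩ h1 rfl).trans (hr ⟨_, hz⟩ y rfl (by simp only; omega))
  intro x y h1 h2
  simp only at h1 h2
  exact key (y.1.2 - x.1.2 - 1) x y h1 (by omega)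

theorem mem_of_perm_mem {ι : Type} {T : Finset ι} {h : Equiv.Perm ι} (hT : ∀ x ∈ T, h x ∈ T)
    {x : ι} (hx : h x ∈ T) : x ∈ T := by
  have h1 : T.map h.toEmbedding = T := by
    refine Finset.eq_of_subset_of_card_le (fun y hy => ?_) (Finset.card_map _).ge
    obtain ⟨z, hz, rfl⟩ := Finset.mem_map.1 hy
    exact hT z hz
  rw [← h1] at hx
  obtain ⟨z, hz, he⟩ := Finset.mem_map.1 hx
  rwa [← h.injective he]

/-- A permutation of the union of two disjoint sets that does not preserve them moves elements in
both directions. -/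
theorem exists_exchange {ι : Type} {A B : Finset ι} {h : Equiv.Perm ι}
    (hAB : ∀ x, x ∈ A ∨ x ∈ B → h x ∈ A ∨ h x ∈ B) (hd : ∀ x, x ∈ A → x ∉ B)
    (hne : (∃ x ∈ A, h x ∈ B) ∨ ∃ y ∈ B, h y ∈ A) : ∃ x ∈ A, h x ∈ B ∧ ∃ y ∈ B, h y ∈ A := by
  by_contra hcon
  push Not at hcon
  rcases hne with ⟨x, hx, hxB⟩ | ⟨y, hy, hyA⟩
  · have h1 : ∀ y ∈ B, h y ∈ B := fun y hy => (hAB y (Or.inr hy)).resolve_left (hcon x hx hxB y hy)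
    exact hd x hx (mem_of_perm_mem h1 hxB)
  · have h1 : ∀ x ∈ A, h x ∈ A := fun x hx =>
      (hAB x (Or.inl hx)).resolve_right fun hxB => hcon x hx hxB y hy hyA
    exact hd y (mem_of_perm_mem h1 hyA) hy

open Classical in
/-- Straightening: a function on the fillings of a Young diagram that is alternating on columns and
satisfies the Garnir relations takes its values in every subgroup that contains its values at the
standard fillings. The sum of `column * entry`, and then the sum of `row * entry`, grow along the
algorithm: a Garnir relation moves larger entries to the right, and leaves the first sum unchanged
only for column permutations. -/
theorem straightening {V : Type*} [AddCommGroup V] [Module ℂ V] {μ : YoungDiagram} {v : μ.cells → ℕ}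
    (hv : Function.Injective v) {F : Equiv.Perm μ.cells → V}
    (hcol : ∀ g h : Equiv.Perm μ.cells, (∀ c, (h c).1.2 = c.1.2) →
      F (g * h) = ((Equiv.Perm.sign h : ℤ) : ℂ) • F g)
    (hgar : ∀ (g : Equiv.Perm μ.cells) (i j : ℕ), (i, j + 1) ∈ μ →
      ∑ h : Equiv.Perm μ.cells with ∀ c, ¬ GarnirBelt i j c.1 → h c = c,
        ((Equiv.Perm.sign h : ℤ) : ℂ) • F (g * h) = 0)
    (P : AddSubgroup V)
    (hP : ∀ g, IsStandardFilling (fun x : μ.cells => x.1.1) (fun x => x.1.2) (fun c => v (g c)) →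
      F g ∈ P) (g : Equiv.Perm μ.cells) : F g ∈ P := by
  let M : Equiv.Perm μ.cells → ℕ ×ₗ ℕ := fun g =>
    toLex (∑ c : μ.cells, c.1.2 * v (g c), ∑ c : μ.cells, c.1.1 * v (g c))
  let r : Equiv.Perm μ.cells → Equiv.Perm μ.cells → Prop := fun g g' => M g' < M g
  have : IsTrans _ r := ⟨fun _ _ _ h h' => h'.trans h⟩
  have : Std.Irrefl r := ⟨fun _ => lt_irrefl _⟩
  refine (Finite.wellFounded_of_trans_of_irrefl r).induction (C := fun g => F g ∈ P) g ?_
  intro g ih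
  by_cases hc : ∀ x y : μ.cells, x.1.2 = y.1.2 → x.1.1 < y.1.1 → v (g x) < v (g y)
  swap
  · -- an inversion in a column: exchange the two entries
    push Not at hc
    obtain ⟨x, y, h1, h2, h3⟩ := hc
    have hxy : x ≠ y := by
      rintro rfl
      exact lt_irrefl _ h2
    have hlt : v (g y) < v (g x) :=
      lt_of_le_of_ne h3 fun h => hxy (g.injective (hv h)).symm
    have hsw : ∀ c : μ.cells, (Equiv.swap x y c).1.2 = c.1.2 := by
      intro c
      by_cases hcx : c = x
      · rw [hcx, Equiv.swap_apply_left, h1]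
      · by_cases hcy : c = y
        · rw [hcy, Equiv.swap_apply_right, h1]
        · rw [Equiv.swap_apply_of_ne_of_ne hcx hcy]
    have hF := hcol g _ hsw
    rw [Equiv.Perm.sign_swap hxy] at hF
    have hF' : F g = -F (g * Equiv.swap x y) := by
      rw [hF]
      simp
    rw [hF']
    refine P.neg_mem (ih _ (Prod.Lex.toLex_lt_toLex.2 (Or.inr ⟨?_, ?_⟩)))
    · simp only [Equiv.Perm.mul_apply]
      rw [← Equiv.sum_comp (Equiv.swap x y)]
      simp only [hsw]
    · simp only [Equiv.Perm.mul_apply]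
      refine sum_mul_lt_sum_mul_perm (s := {x, y}) (v := fun c => v (g c)) ?_ ?_ ?_
      · intro c hc
        simp only [Finset.mem_insert, Finset.mem_singleton, not_or] at hc
        exact Equiv.swap_apply_of_ne_of_ne hc.1 hc.2
      · intro a ha b hb hab
        simp only [Finset.mem_insert, Finset.mem_singleton] at ha hb
        rcases ha with rfl | rfl <;> rcases hb with rfl | rfl <;> omega
      · exact ⟨x, by simp, y, by simp, h2, by simpa using hlt⟩
  by_cases hr : ∀ x y : μ.cells, x.1.1 = y.1.1 → x.1.2 + 1 = y.1.2 → v (g x) < v (g y)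
  · exact hP g (isStandardFilling_of_adjacent hc hr)
  -- an inversion of adjacent entries in a row: use the Garnir relation
  push Not at hr
  obtain ⟨x, y, h1, h2, h3⟩ := hr
  obtain ⟨⟨i, j⟩, hx⟩ := x
  obtain ⟨⟨i', j'⟩, hy⟩ := y
  obtain rfl : i = i' := h1
  obtain rfl : j + 1 = j' := h2
  set x : μ.cells := ⟨(i, j), hx⟩
  set y : μ.cells := ⟨(i, j + 1), hy⟩
  have hlt : v (g y) < v (g x) := by
    refine lt_of_le_of_ne h3 fun h => ?_
    have := congrArg (fun z : μ.cells => z.1.2) (g.injective (hv h))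
    simp [x, y] at this
  let A : Finset μ.cells := Finset.univ.filter fun c => c.1.2 = j ∧ i ≤ c.1.1
  let B : Finset μ.cells := Finset.univ.filter fun c => c.1.2 = j + 1 ∧ c.1.1 ≤ i
  have hA : ∀ {c}, c ∈ A ↔ c.1.2 = j ∧ i ≤ c.1.1 := by simp [A]
  have hB : ∀ {c}, c ∈ B ↔ c.1.2 = j + 1 ∧ c.1.1 ≤ i := by simp [B]
  have hAv : ∀ c ∈ A, v (g x) ≤ v (g c) := by
    intro c hcA
    rw [hA] at hcA
    rcases hcA.2.eq_or_lt with h | h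
    · have : c = x := Subtype.ext (Prod.ext h.symm hcA.1)
      rw [this]
    · exact (hc x c hcA.1.symm h).le
  have hBv : ∀ c ∈ B, v (g c) ≤ v (g y) := by
    intro c hcB
    rw [hB] at hcB
    rcases hcB.2.eq_or_lt with h | h
    · have : c = y := Subtype.ext (Prod.ext h hcB.1)
      rw [this]
    · exact (hc c y hcB.1 h).le
  let G := supportedSubgroup fun c : μ.cells => GarnirBelt i j c.1
  let H : Subgroup G := (fiberSubgroup fun c : μ.cells => c.1.2).subgroupOf G
  have hsum : ∑ h : G, ((Equiv.Perm.sign h.1 : ℤ) : ℂ) • F (g * h) = 0 := by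
    rw [← hgar g i j hy]
    exact (Finset.sum_subtype _ (fun h => by simp [G, supportedSubgroup])
      fun h : Equiv.Perm μ.cells => ((Equiv.Perm.sign h : ℤ) : ℂ) • F (g * h)).symm
  have key := mem_of_garnir H (fun h : G => ((Equiv.Perm.sign h.1 : ℤ) : ℂ) • F (g * h))
    (fun h h' hh' => ?_) hsum P fun h hh => ?_
  · simpa using key
  · have hh'' : ∀ c, (h'.1 c).1.2 = c.1.2 := hh'
    rw [Subgroup.coe_mul, ← mul_assoc, hcol _ _ hh'', smul_smul, map_mul, Units.val_mul,
      Int.cast_mul, mul_assoc, sign_mul_sign_self, mul_one]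
  · -- a belt permutation that moves entries between the two columns
    have hmem : ∀ c, ¬ (c ∈ A ∨ c ∈ B) → h.1 c = c := by
      intro c hcAB
      rw [hA, hB] at hcAB
      exact h.2 c hcAB
    have hmaps : ∀ c, c ∈ A ∨ c ∈ B → h.1 c ∈ A ∨ h.1 c ∈ B := by
      intro c hcAB
      by_contra hcon
      have := hmem _ hcon
      rw [h.1.injective this] at hcon
      exact hcon hcAB
    have hne : ∃ c, (h.1 c).1.2 ≠ c.1.2 := by
      by_contra hcon
      push Not at hcon
      exact hh hcon
    have hd : ∀ c, c ∈ A → c ∉ B := by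
      intro c hcA hcB
      rw [hA] at hcA
      rw [hB] at hcB
      omega
    obtain ⟨a, ha, haB, b, hb, hbA⟩ : ∃ a ∈ A, h.1 a ∈ B ∧ ∃ b ∈ B, h.1 b ∈ A := by
      refine exists_exchange hmaps hd ?_
      obtain ⟨c, hcne⟩ := hne
      have hcAB : c ∈ A ∨ c ∈ B := by
        by_contra hcon
        rw [hmem c hcon] at hcne
        exact hcne rfl
      rcases hcAB with hcA | hcB
      · refine Or.inl ⟨c, hcA, (hmaps c (Or.inl hcA)).resolve_left fun hcon => hcne ?_⟩
        rw [(hA.1 hcon).1, (hA.1 hcA).1]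
      · refine Or.inr ⟨c, hcB, (hmaps c (Or.inr hcB)).resolve_right fun hcon => hcne ?_⟩
        rw [(hB.1 hcon).1, (hB.1 hcB).1]
    have hgrow : M g < M (g * h) := by
      refine Prod.Lex.toLex_lt_toLex.2 (Or.inl ?_)
      simp only [Equiv.Perm.mul_apply]
      refine sum_mul_lt_sum_mul_perm (s := A ∪ B) (v := fun c => v (g c)) ?_ ?_ ?_
      · intro c hcAB
        exact hmem c (by simpa using hcAB)
      · intro c hcm c' hcm' hlt'
        rw [Finset.mem_union] at hcm hcm'
        have e1 : c ∈ A := by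
          refine hcm.resolve_right fun hcB => ?_
          rw [(hB.1 hcB).1] at hlt'
          rcases hcm' with h' | h'
          · rw [(hA.1 h').1] at hlt'
            omega
          · rw [(hB.1 h').1] at hlt'
            omega
        have e2 : c' ∈ B := by
          refine hcm'.resolve_left fun hcA => ?_
          rw [(hA.1 hcA).1, (hA.1 e1).1] at hlt'
          omega
        exact (hBv c' e2).trans (hlt.le.trans (hAv c e1))
      · refine ⟨a, Finset.mem_union_left _ ha, b, Finset.mem_union_right _ hb, ?_, ?_⟩
        · rw [(hA.1 ha).1, (hB.1 hb).1]
          omega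
        · exact (hBv _ haB).trans_lt (hlt.trans_le (hAv _ hbA))
    have hFP := ih _ hgrow
    rcases Int.units_eq_one_or (Equiv.Perm.sign h.1) with hs | hs
    · simpa [hs] using hFP
    · simpa [hs] using hFP

end Straightening

/-! ### Specht modules -/

section SpechtModule

variable {μ : YoungDiagram}

theorem columnTableau_injective (μ : YoungDiagram) : Function.Injective (columnTableau μ) := by
  intro i j h
  have h1 := Prod.swap_injective h
  exact (Finset.orderEmbOfFin _ _).injective (ofLex.injective h1)

theorem columnTableau_mem (i : Fin μ.card) : columnTableau μ i ∈ μ.cells := by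
  have h := Finset.orderEmbOfFin_mem (μ.cells.map columnKey) (Finset.card_map _) i
  obtain ⟨c, hc, he⟩ := Finset.mem_map.1 h
  have : columnTableau μ i = c := by
    rw [columnTableau, ← he]
    rfl
  rwa [this]

/-- The column-reading tableau as a bijection. -/
noncomputable def cellEquiv (μ : YoungDiagram) : Fin μ.card ≃ μ.cells :=
  Equiv.ofBijective (fun i => ⟨columnTableau μ i, columnTableau_mem i⟩)
    ((Fintype.bijective_iff_injective_and_card _).2
      ⟨fun _ _ h => columnTableau_injective μ (congrArg Subtype.val h), by
        simp [YoungDiagram.card]⟩)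

theorem coe_cellEquiv (i : Fin μ.card) : (cellEquiv μ i : ℕ × ℕ) = columnTableau μ i := rfl

theorem columnTableau_cellEquiv_symm (c : μ.cells) :
    columnTableau μ ((cellEquiv μ).symm c) = c.1 := by
  rw [← coe_cellEquiv, Equiv.apply_symm_apply]

theorem exists_columnTableau_eq {c : ℕ × ℕ} (hc : c ∈ μ) : ∃ i, columnTableau μ i = c :=
  ⟨(cellEquiv μ).symm ⟨c, hc⟩, columnTableau_cellEquiv_symm _⟩

/-- The row of an entry of the column-reading tableau. -/
noncomputable def rowOf (μ : YoungDiagram) (i : Fin μ.card) : ℕ := (columnTableau μ i).1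

/-- The column of an entry of the column-reading tableau. -/
noncomputable def colOf (μ : YoungDiagram) (i : Fin μ.card) : ℕ := (columnTableau μ i).2

theorem eq_of_rowOf_colOf (i j : Fin μ.card) (h : rowOf μ i = rowOf μ j)
    (h' : colOf μ i = colOf μ j) : i = j :=
  columnTableau_injective μ (Prod.ext h h')

theorem exists_above (i : Fin μ.card) (y : ℕ) (hy : y < rowOf μ i) :
    ∃ i', rowOf μ i' = y ∧ colOf μ i' = colOf μ i := by
  obtain ⟨i', hi'⟩ := exists_columnTableau_eq
    (μ.up_left_mem hy.le le_rfl (show (rowOf μ i, colOf μ i) ∈ μ from columnTableau_mem i))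
  exact ⟨i', by rw [rowOf, hi'], by rw [colOf, hi']⟩

theorem youngSymmetrizer_eq (μ : YoungDiagram) :
    youngSymmetrizer μ = antisymmetrizer (colOf μ) * symmetrizer (rowOf μ) := by
  rw [youngSymmetrizer, antisymmetrizer, symmetrizer, Finset.sum_mul]
  refine Finset.sum_congr (by congr!) fun γ _ => ?_
  rw [Finset.mul_sum]
  refine Finset.sum_congr (by congr!) fun ρ _ => ?_
  rw [smul_mul_assoc, map_mul]

theorem of_mul_youngSymmetrizer {γ : Equiv.Perm (Fin μ.card)} (h : ∀ i, colOf μ (γ i) = colOf μ i) :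
    MonoidAlgebra.of ℂ _ γ * youngSymmetrizer μ =
      ((Equiv.Perm.sign γ : ℤ) : ℂ) • youngSymmetrizer μ := by
  rw [youngSymmetrizer_eq, ← mul_assoc, of_mul_antisymmetrizer h, smul_mul_assoc]

/-- A Garnir belt for the columns `j` and `j + 1` has one cell more than the column `j`, so that two
of its cells are in the same row after a column permutation. -/
theorem garnirElement_mul_youngSymmetrizer {i j : ℕ} (hij : (i, j + 1) ∈ μ) :
    garnirElement (fun x => GarnirBelt i j (columnTableau μ x)) * youngSymmetrizer μ = 0 := by
  rw [youngSymmetrizer_eq]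
  refine garnirElement_mul_eq_zero fun γ hγ => ?_
  have hbelt : ∀ r : ℕ, r ≤ μ.colLen j → ∃ x : Fin μ.card,
      columnTableau μ x = if r ≤ i then (r, j + 1) else (r - 1, j) := by
    intro r hr
    refine exists_columnTableau_eq ?_
    split_ifs with h
    · exact μ.up_left_mem h le_rfl hij
    · rw [YoungDiagram.mem_iff_lt_colLen]
      omega
  have : Nonempty (Fin μ.card) := ⟨(exists_columnTableau_eq hij).choose⟩
  choose! f hf using hbelt
  have hfS : ∀ r ≤ μ.colLen j, GarnirBelt i j (columnTableau μ (f r)) := by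
    intro r hr
    rw [hf r hr, GarnirBelt]
    split_ifs with h
    · exact Or.inr ⟨rfl, h⟩
    · exact Or.inl ⟨rfl, by simp only; omega⟩
  obtain ⟨r, hr, r', hr', hne, he⟩ := Finset.exists_ne_map_eq_of_card_lt_of_maps_to
    (s := Finset.range (μ.colLen j + 1)) (t := Finset.range (μ.colLen j))
    (f := fun r => rowOf μ (γ (f r))) (by simp) (by
      intro r hr
      have hr : r ≤ μ.colLen j := by simpa [Nat.lt_succ_iff] using hr
      have h1 : (rowOf μ (γ (f r)), colOf μ (γ (f r))) ∈ μ := columnTableau_mem _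
      have h2 : (rowOf μ (γ (f r)), j) ∈ μ := by
        refine μ.up_left_mem le_rfl ?_ h1
        rw [hγ, colOf]
        rcases hfS r hr with h | h <;> omega
      simpa using YoungDiagram.mem_iff_lt_colLen.1 h2)
  rw [Finset.mem_range, Nat.lt_succ_iff] at hr hr'
  refine ⟨f r, f r', hfS r hr, hfS r' hr', fun h => hne ?_, he⟩
  have h1 := hf r hr
  rw [h, hf r' hr'] at h1
  split_ifs at h1 <;> simp only [Prod.mk.injEq] at h1 <;> omega

theorem youngSymmetrizer_mem (μ : YoungDiagram) : youngSymmetrizer μ ∈ Specht μ :=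
  Submodule.mem_span_singleton_self _

theorem youngSymmetrizer_ne_zero (μ : YoungDiagram) : youngSymmetrizer μ ≠ 0 := by
  intro h
  have h1 := coeff_one_antisymmetrizer_mul_symmetrizer (eq_of_rowOf_colOf (μ := μ))
  rw [← youngSymmetrizer_eq, h] at h1
  simp at h1

theorem exists_mul_eq_of_mem_specht {v u : SymGroupAlgebra μ.card} (hv : v ∈ Specht μ) (hv0 : v ≠ 0)
    (hu : u ∈ Specht μ) : ∃ x, x * v = u := by
  obtain ⟨z, hz⟩ := Submodule.mem_span_singleton.1 hv
  obtain ⟨y, hy⟩ := Submodule.mem_span_singleton.1 hu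
  rw [youngSymmetrizer_eq] at hz hy
  obtain ⟨x, hx⟩ := symmetrizer_mem_span_of_mem eq_of_rowOf_colOf exists_above hv0 ⟨z, hz.symm⟩
  exact ⟨y * x, by rw [mul_assoc, hx, ← hy, smul_eq_mul]⟩

/-- The polytabloid `σ p_μ`. -/
noncomputable def polytabloid (μ : YoungDiagram) (σ : Equiv.Perm (Fin μ.card)) : Specht μ :=
  MonoidAlgebra.of ℂ _ σ • ⟨youngSymmetrizer μ, youngSymmetrizer_mem μ⟩

theorem coe_polytabloid (σ : Equiv.Perm (Fin μ.card)) :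
    (polytabloid μ σ : SymGroupAlgebra μ.card) = MonoidAlgebra.of ℂ _ σ * youngSymmetrizer μ := rfl

theorem polytabloid_mul_of_column (σ : Equiv.Perm (Fin μ.card)) {γ : Equiv.Perm (Fin μ.card)}
    (h : ∀ i, colOf μ (γ i) = colOf μ i) :
    polytabloid μ (σ * γ) = ((Equiv.Perm.sign γ : ℤ) : ℂ) • polytabloid μ σ := by
  refine Subtype.ext ?_
  rw [coe_polytabloid, map_mul, mul_assoc, of_mul_youngSymmetrizer h, mul_smul_comm]
  rfl

open Classical in
theorem sum_polytabloid_garnir (σ : Equiv.Perm (Fin μ.card)) {i j : ℕ} (hij : (i, j + 1) ∈ μ) :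
    ∑ g : Equiv.Perm (Fin μ.card) with ∀ c, ¬ GarnirBelt i j (columnTableau μ c) → g c = c,
      ((Equiv.Perm.sign g : ℤ) : ℂ) • polytabloid μ (σ * g) = 0 := by
  refine Subtype.ext ?_
  rw [Submodule.coe_sum]
  have h := congrArg (MonoidAlgebra.of ℂ _ σ * ·) (garnirElement_mul_youngSymmetrizer hij)
  simp only [mul_zero, garnirElement, Finset.sum_mul, Finset.mul_sum] at h
  rw [Submodule.coe_zero, ← h]
  refine Finset.sum_congr rfl fun g _ => ?_
  rw [smul_mul_assoc, mul_smul_comm, ← mul_assoc, ← map_mul]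
  rfl

theorem span_polytabloid (μ : YoungDiagram) :
    Submodule.span ℂ (Set.range (polytabloid μ)) = ⊤ := by
  rw [eq_top_iff]
  rintro ⟨v, hv⟩ -
  obtain ⟨z, rfl⟩ := Submodule.mem_span_singleton.1 hv
  have key : ∀ z : SymGroupAlgebra μ.card, z • (⟨youngSymmetrizer μ, youngSymmetrizer_mem μ⟩ : Specht μ) ∈
      Submodule.span ℂ (Set.range (polytabloid μ)) := by
    intro z
    induction z using MonoidAlgebra.induction_on with
    | of σ => exact Submodule.subset_span ⟨σ, rfl⟩
    | add x y hx hy =>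
      rw [add_smul]
      exact Submodule.add_mem _ hx hy
    | smul r x hx =>
      rw [smul_assoc]
      exact Submodule.smul_mem _ r hx
  exact key z

/-- The standard fillings of the column-reading tableau. -/
abbrev StandardPerm (μ : YoungDiagram) : Type :=
  {σ : Equiv.Perm (Fin μ.card) // IsStandardFilling (rowOf μ) (colOf μ) fun i => (σ i : ℕ)}

theorem linearIndependent_polytabloid (μ : YoungDiagram) :
    LinearIndependent ℂ fun σ : StandardPerm μ => polytabloid μ σ.1 := by
  have h := linearIndependent_standard (eq_of_rowOf_colOf (μ := μ))
  rw [← youngSymmetrizer_eq] at h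
  exact LinearIndependent.of_comp ((Specht μ).subtype.restrictScalars ℂ) h

end SpechtModule

/-! ### Diagrams acting on functions of colourings -/

section Colourings

variable {α β γ : Type} {n : ℕ}

theorem glue_le_ker {d₁ : Diag α β} {d₂ : Diag β γ} {x : α → Fin n} {y : β → Fin n}
    {z : γ → Fin n} : glue d₁ d₂ ≤ Setoid.ker (Sum.elim x (Sum.elim y z)) ↔
      d₁ ≤ Setoid.ker (Sum.elim x y) ∧ d₂ ≤ Setoid.ker (Sum.elim y z) := by
  rw [glue, sup_le_iff, map_le_iff, map_le_iff, ← Setoid.comap_comp]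
  have h : Sum.elim x (Sum.elim y z) ∘ up = Sum.elim x y := by
    funext a
    rcases a with a | a <;> rfl
  rw [← h]
  rfl

/-- The number of ways to colour the middle row, given colours of the outer rows, such that the
colouring is constant on the blocks: the components inside the middle row may be coloured freely. -/
theorem card_colourings [Finite α] [Finite β] [Finite γ] (J : Setoid (α ⊕ β ⊕ γ))
    (x : α → Fin n) (z : γ → Fin n) (h : J.comap outer ≤ Setoid.ker (Sum.elim x z)) :
    Nat.card {y : β → Fin n // J ≤ Setoid.ker (Sum.elim x (Sum.elim y z))} =
      n ^ (inside J (Set.range mid)).ncard := by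
  classical
  have e : {y : β → Fin n // J ≤ Setoid.ker (Sum.elim x (Sum.elim y z))} ≃
      (inside J (Set.range mid) → Fin n) := by
    have hrep : ∀ c : inside J (Set.range (mid : β → α ⊕ β ⊕ γ)), ∃ b, c.1 = {v | J v (mid b)} := by
      rintro ⟨c, hc⟩
      obtain ⟨v, rfl, hv⟩ := mem_inside.1 hc
      obtain ⟨b, rfl⟩ := hv v (J.refl v)
      exact ⟨b, rfl⟩
    choose rep hrep' using hrep
    have hout : ∀ b : β, {v | J v (mid b)} ∉ inside J (Set.range (mid : β → α ⊕ β ⊕ γ)) →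
        ∃ o : α ⊕ γ, J (outer o) (mid b) := by
      intro b hb
      rw [mem_inside] at hb
      push Not at hb
      obtain ⟨v, hv, hne⟩ := hb (mid b) rfl
      rcases v with a | b' | c
      · exact ⟨Sum.inl a, hv⟩
      · exact absurd ⟨b', rfl⟩ hne
      · exact ⟨Sum.inr c, hv⟩
    choose o ho using hout
    have hx : ∀ (y : β → Fin n) (u : α ⊕ γ),
        Sum.elim x (Sum.elim y z) (outer u) = Sum.elim x z u := by
      rintro y (u | u) <;> rfl
    let f : (inside J (Set.range (mid : β → α ⊕ β ⊕ γ)) → Fin n) → β → Fin n := fun g b =>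
      if hb : {v | J v (mid b)} ∈ inside J (Set.range (mid : β → α ⊕ β ⊕ γ)) then g ⟨_, hb⟩
      else Sum.elim x z (o b hb)
    have hcls : ∀ {u v : α ⊕ β ⊕ γ}, J u v → {w | J w u} = {w | J w v} := fun huv =>
      Set.ext fun w => ⟨fun hw => J.trans hw huv, fun hw => J.trans hw (J.symm huv)⟩
    have hnot : ∀ (u : α ⊕ γ) (b : β), J (outer u) (mid b) →
        {v | J v (mid b)} ∉ inside J (Set.range (mid : β → α ⊕ β ⊕ γ)) := by
      intro u b hub hmem
      obtain ⟨b', hb'⟩ := hmem.2 hub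
      rcases u with u | u <;> simp [outer, mid] at hb'
    have hfb : ∀ g (u : α ⊕ γ) (b : β), J (outer u) (mid b) → Sum.elim x z u = f g b := by
      intro g u b hub
      have hb := hnot u b hub
      simp only [f, dif_neg hb]
      exact h (J.trans hub (J.symm (ho b hb)))
    have hfbb : ∀ g (b b' : β), J (mid b) (mid b') → f g b = f g b' := by
      intro g b b' hbb
      have hs := hcls hbb
      by_cases hb : {v | J v (mid b)} ∈ inside J (Set.range (mid : β → α ⊕ β ⊕ γ))
      · have hb' := hb
        rw [hs] at hb'
        simp only [f, dif_pos hb, dif_pos hb']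
        exact congrArg g (Subtype.ext hs)
      · simp only [f, dif_neg hb]
        exact hfb g (o b hb) b' (J.trans (ho b hb) hbb)
    have hf : ∀ g, J ≤ Setoid.ker (Sum.elim x (Sum.elim (f g) z)) := by
      intro g u v huv
      change Sum.elim x (Sum.elim (f g) z) u = Sum.elim x (Sum.elim (f g) z) v
      have hcases : ∀ u : α ⊕ β ⊕ γ, (∃ a, u = outer a) ∨ ∃ b, u = mid b := by
        rintro (a | b | c)
        · exact Or.inl ⟨Sum.inl a, rfl⟩
        · exact Or.inr ⟨b, rfl⟩
        · exact Or.inl ⟨Sum.inr c, rfl⟩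
      rcases hcases u with ⟨u, rfl⟩ | ⟨u, rfl⟩ <;> rcases hcases v with ⟨v, rfl⟩ | ⟨v, rfl⟩
      · rw [hx, hx]
        exact h huv
      · rw [hx]
        exact hfb g u v huv
      · rw [hx]
        exact (hfb g v u (J.symm huv)).symm
      · exact hfbb g u v huv
    refine ⟨fun y c => y.1 (rep c), fun g => ⟨f g, hf g⟩, ?_, ?_⟩
    · rintro ⟨y, hy⟩
      refine Subtype.ext (funext fun b => ?_)
      simp only [f]
      split_ifs with hb
      · have h1 : J (mid b) (mid (rep ⟨_, hb⟩)) := by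
          have h2 : (mid b : α ⊕ β ⊕ γ) ∈ {v | J v (mid b)} := J.refl _
          have h3 : {v | J v (mid b)} = {v | J v (mid (rep ⟨_, hb⟩))} := hrep' ⟨_, hb⟩
          rw [h3] at h2
          exact h2
        exact (hy h1).symm
      · have h1 := hy (ho b hb)
        rw [← hx y]
        exact h1
    · intro g
      funext c
      have hc : {v | J v (mid (rep c))} ∈ inside J (Set.range (mid : β → α ⊕ β ⊕ γ)) := by
        rw [← hrep' c]
        exact c.2
      simp only [f, dif_pos hc]
      exact congrArg g (Subtype.ext (hrep' c).symm)
  have : Finite (inside J (Set.range (mid : β → α ⊕ β ⊕ γ))) := Set.toFinite _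
  rw [Nat.card_congr e, Nat.card_fun, Nat.card_eq_fintype_card, Fintype.card_fin,
    Nat.card_coe_set_eq]

theorem comap_outer_le_ker {J : Setoid (α ⊕ β ⊕ γ)} {x : α → Fin n} {y : β → Fin n}
    {z : γ → Fin n} (h : J ≤ Setoid.ker (Sum.elim x (Sum.elim y z))) :
    J.comap outer ≤ Setoid.ker (Sum.elim x z) := by
  intro u v huv
  have h1 := h huv
  rcases u with u | u <;> rcases v with v | v <;> exact h1

open Classical in
/-- Summation over the colours of the middle row: the colourings compatible with a joined diagram are
counted by its components inside the middle row. -/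
theorem sum_colourings [Finite α] [Fintype β] [DecidableEq β] [Finite γ] (J : Setoid (α ⊕ β ⊕ γ))
    (x : α → Fin n) (z : γ → Fin n) :
    ∑ y : β → Fin n, (if J ≤ Setoid.ker (Sum.elim x (Sum.elim y z)) then (1 : ℂ) else 0) =
      if J.comap outer ≤ Setoid.ker (Sum.elim x z) then (n : ℂ) ^ (inside J (Set.range mid)).ncard
      else 0 := by
  split_ifs with h
  · rw [Finset.sum_boole, ← Fintype.card_subtype, ← Nat.card_eq_fintype_card,
      card_colourings J x z h, Nat.cast_pow]
  · refine Finset.sum_eq_zero fun y _ => if_neg fun hy => h (comap_outer_le_ker hy)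

/-- The functions of the colourings of `α` with `n` colours, a model of `(ℂⁿ)^{⊗ α}`. -/
abbrev ColourSpace (α : Type) (n : ℕ) : Type := (α → Fin n) → ℂ

open Classical in
/-- The operator of a diagram: its matrix entry is `1` at the pairs of colourings which are
together constant on the blocks, and `0` elsewhere. -/
noncomputable def colourMap [Fintype β] [DecidableEq β] (n : ℕ) (d : Diag α β) :
    ColourSpace β n →ₗ[ℂ] ColourSpace α n where
  toFun φ x := ∑ y : β → Fin n, if d ≤ Setoid.ker (Sum.elim x y) then φ y else 0
  map_add' φ ψ := by
    funext x
    rw [Pi.add_apply, ← Finset.sum_add_distrib]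
    refine Finset.sum_congr rfl fun y _ => ?_
    split_ifs <;> simp
  map_smul' r φ := by
    funext x
    simp only [RingHom.id_apply, Pi.smul_apply, Finset.smul_sum]
    refine Finset.sum_congr rfl fun y _ => ?_
    split_ifs <;> simp

open Classical in
theorem colourMap_apply [Fintype β] [DecidableEq β] (d : Diag α β) (φ : ColourSpace β n) (x : α → Fin n) :
    colourMap n d φ x = ∑ y : β → Fin n, if d ≤ Setoid.ker (Sum.elim x y) then φ y else 0 := rfl

/-- The operators of diagrams multiply as the basis of the partition algebra does. -/
theorem colourMap_colourMap [Finite α] [Fintype β] [DecidableEq β] [Fintype γ] [DecidableEq γ]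
    (d₁ : Diag α β) (d₂ : Diag β γ) (φ : ColourSpace γ n) : colourMap n d₁ (colourMap n d₂ φ) =
      (n : ℂ) ^ loops d₁ d₂ • colourMap n (comp d₁ d₂) φ := by
  classical
  funext x
  rw [Pi.smul_apply, colourMap_apply, colourMap_apply, Finset.smul_sum]
  simp only [colourMap_apply]
  have h1 : ∀ y : β → Fin n, (if d₁ ≤ Setoid.ker (Sum.elim x y) then
      ∑ z : γ → Fin n, (if d₂ ≤ Setoid.ker (Sum.elim y z) then φ z else 0) else 0) =
      ∑ z : γ → Fin n, (if glue d₁ d₂ ≤ Setoid.ker (Sum.elim x (Sum.elim y z)) then (1 : ℂ) else 0)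
        * φ z := by
    intro y
    simp only [glue_le_ker]
    by_cases hd : d₁ ≤ Setoid.ker (Sum.elim x y) <;> simp [hd]
  rw [Finset.sum_congr rfl fun y _ => h1 y, Finset.sum_comm]
  refine Finset.sum_congr rfl fun z _ => ?_
  rw [← Finset.sum_mul, sum_colourings]
  by_cases h : comp d₁ d₂ ≤ Setoid.ker (Sum.elim x z)
  · rw [if_pos h, if_pos (show (glue d₁ d₂).comap outer ≤ _ from h), smul_eq_mul, loops]
  · rw [if_neg h, if_neg (show ¬ (glue d₁ d₂).comap outer ≤ _ from h), smul_zero, zero_mul]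

theorem colourMap_idDiag [Fintype α] [DecidableEq α] (φ : ColourSpace α n) :
    colourMap n (idDiag α) φ = φ := by
  classical
  funext x
  rw [colourMap_apply, Finset.sum_eq_single x]
  · refine if_pos fun u v huv => ?_
    have h : (Sum.elim id id u : α) = Sum.elim id id v := huv
    rcases u with u | u <;> rcases v with v | v <;> exact congrArg x h
  · intro y _ hy
    refine if_neg fun h => hy (funext fun a => ?_)
    have h1 : idDiag α (Sum.inr a) (Sum.inl a) := rfl
    exact h h1
  · intro h
    exact absurd (Finset.mem_univ _) h

/-- The matrix of a diagram that equals its reflection is symmetric. -/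
theorem sum_mul_colourMap_of_flip_eq [Fintype α] [DecidableEq α] {d : Diag α α} (hd : flip d = d)
    (φ ψ : ColourSpace α n) :
    ∑ x, φ x * colourMap n d ψ x = ∑ x, colourMap n d φ x * ψ x := by
  classical
  have hsymm : ∀ x y : α → Fin n, d ≤ Setoid.ker (Sum.elim x y) → d ≤ Setoid.ker (Sum.elim y x) := by
    intro x y h u v huv
    rw [← hd] at huv
    have h1 := h huv
    rcases u with u | u <;> rcases v with v | v <;> exact h1
  simp only [colourMap_apply, Finset.mul_sum, Finset.sum_mul]
  rw [Finset.sum_comm]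
  refine Finset.sum_congr rfl fun y _ => Finset.sum_congr rfl fun x _ => ?_
  by_cases h : d ≤ Setoid.ker (Sum.elim x y)
  · rw [if_pos h, if_pos (hsymm x y h)]
  · rw [if_neg h, if_neg fun h' => h (hsymm y x h'), mul_zero, zero_mul]

end Colourings

/-! ### Marked set partitions as functions of colourings -/

section Marked

variable {k m n : ℕ}

/-- The difference of the indicator functions of the colours `2 i` and `2 i + 1`. -/
def colourSign (i : ℕ) (c : Fin n) : ℂ :=
  if (c : ℕ) = 2 * i then 1 else if (c : ℕ) = 2 * i + 1 then -1 else 0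

theorem colourSign_ne_zero {i : ℕ} {c : Fin n} (h : colourSign i c ≠ 0) :
    (c : ℕ) = 2 * i ∨ (c : ℕ) = 2 * i + 1 := by
  rw [colourSign] at h
  split_ifs at h with h1 h2
  · exact Or.inl h1
  · exact Or.inr h2
  · exact absurd rfl h

theorem colourSign_swap {i : ℕ} (h : 2 * i + 1 < n) (c : Fin n) :
    colourSign i (Equiv.swap (⟨2 * i, by omega⟩ : Fin n) ⟨2 * i + 1, h⟩ c) = -colourSign i c := by
  by_cases h1 : c = ⟨2 * i, by omega⟩
  · rw [h1, Equiv.swap_apply_left]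
    simp [colourSign]
  · by_cases h2 : c = ⟨2 * i + 1, h⟩
    · rw [h2, Equiv.swap_apply_right]
      simp [colourSign]
    · rw [Equiv.swap_apply_of_ne_of_ne h1 h2, colourSign, if_neg fun h => h1 (Fin.ext h),
        if_neg fun h => h2 (Fin.ext h), neg_zero]

open Classical in
/-- The function attached to a set partition `π` and to marked blocks, the `i`th of which is given
by its element `p i`: the diagram of `π` whose `i`th marked block propagates to the `i`th bottom
vertex, applied to the tensor `⨂ i, (e_{2i} - e_{2i+1})`. This tensor is annihilated by all diagrams
with fewer propagating blocks. -/
noncomputable def markedFunction (n : ℕ) (π : Setoid (Fin k)) (p : Fin m → Fin k) :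
    ColourSpace (Fin k) n :=
  fun x => if π ≤ Setoid.ker x then ∏ i : Fin m, colourSign (i : ℕ) (x (p i)) else 0

/-- The marked blocks of `π` are connected to different blocks of the top row of `d`, when `d` is
placed above `π`. -/
def Transports (d : Diag (Fin k) (Fin k)) (π : Setoid (Fin k)) (p : Fin m → Fin k) : Prop :=
  (∀ i, ∃ a, glue d (oneLine π) (Sum.inl a) (mid (p i))) ∧
    ∀ i j, glue d (oneLine π) (mid (p i)) (mid (p j)) → i = j

theorem oneLine_le_ker {π : Setoid (Fin k)} {x : Fin k → Fin n} :
    oneLine π ≤ Setoid.ker (Sum.elim x Empty.elim) ↔ π ≤ Setoid.ker x := by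
  constructor
  · intro h a b hab
    have h1 : oneLine π (Sum.inl a) (Sum.inl b) := hab
    exact h h1
  · rintro h (a | a) (b | b) hab
    · have h1 : π a b := hab
      exact h h1
    · exact b.elim
    · exact a.elim
    · exact a.elim

open Classical in
theorem colourMap_markedFunction_apply (d : Diag (Fin k) (Fin k)) (π : Setoid (Fin k))
    (p : Fin m → Fin k) (x : Fin k → Fin n) :
    colourMap n d (markedFunction n π p) x = ∑ y : Fin k → Fin n,
      (if glue d (oneLine π) ≤ Setoid.ker (Sum.elim x (Sum.elim y Empty.elim)) then (1 : ℂ) else 0) *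
        ∏ i : Fin m, colourSign (i : ℕ) (y (p i)) := by
  rw [colourMap_apply]
  refine Finset.sum_congr rfl fun y _ => ?_
  rw [markedFunction]
  simp only [glue_le_ker, oneLine_le_ker]
  by_cases h1 : d ≤ Setoid.ker (Sum.elim x y) <;> by_cases h2 : π ≤ Setoid.ker y <;> simp [h1, h2]

/-- A diagram acts on the functions of marked set partitions by concatenation. All compatible colourings
of the middle row have the same weight, because the marked blocks share the colours of the top row. -/
theorem colourMap_markedFunction (d : Diag (Fin k) (Fin k)) {π : Setoid (Fin k)}
    {p q : Fin m → Fin k} (hq : ∀ i, glue d (oneLine π) (Sum.inl (q i)) (mid (p i))) :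
    colourMap n d (markedFunction n π p) =
      (n : ℂ) ^ loops d (oneLine π) • markedFunction n (top (comp d (oneLine π))) q := by
  classical
  funext x
  rw [colourMap_markedFunction_apply]
  have h1 : ∀ y : Fin k → Fin n,
      (if glue d (oneLine π) ≤ Setoid.ker (Sum.elim x (Sum.elim y Empty.elim)) then (1 : ℂ) else 0) *
        ∏ i : Fin m, colourSign (i : ℕ) (y (p i)) =
      (if glue d (oneLine π) ≤ Setoid.ker (Sum.elim x (Sum.elim y Empty.elim)) then (1 : ℂ) else 0) *
        ∏ i : Fin m, colourSign (i : ℕ) (x (q i)) := by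
    intro y
    by_cases h : glue d (oneLine π) ≤ Setoid.ker (Sum.elim x (Sum.elim y Empty.elim))
    · congr 1
      refine Finset.prod_congr rfl fun i _ => ?_
      have h2 : x (q i) = y (p i) := h (hq i)
      rw [h2]
    · rw [if_neg h, zero_mul, zero_mul]
  rw [Finset.sum_congr rfl fun y _ => h1 y, ← Finset.sum_mul, sum_colourings, Pi.smul_apply,
    markedFunction, smul_eq_mul]
  have h3 : (glue d (oneLine π)).comap outer ≤ Setoid.ker (Sum.elim x Empty.elim) ↔
      top (comp d (oneLine π)) ≤ Setoid.ker x := by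
    constructor
    · intro h a b hab
      have h1 : (glue d (oneLine π)).comap outer (Sum.inl a) (Sum.inl b) := hab
      exact h h1
    · rintro h (a | a) (b | b) hab
      · have h1 : top (comp d (oneLine π)) a b := hab
        exact h h1
      · exact b.elim
      · exact a.elim
      · exact a.elim
  by_cases h : (glue d (oneLine π)).comap outer ≤ Setoid.ker (Sum.elim x Empty.elim)
  · rw [if_pos h, if_pos (h3.1 h), loops]
  · rw [if_neg h, if_neg fun h' => h (h3.2 h'), zero_mul, mul_zero]

/-- If a marked block is not connected to the top row, then exchanging the colours `2 i` and
`2 i + 1` on its component is a sign-reversing involution; two connected marked blocks have no common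
colour with non-zero weights. -/
theorem colourMap_markedFunction_eq_zero (hmn : 2 * m ≤ n) {d : Diag (Fin k) (Fin k)}
    {π : Setoid (Fin k)} {p : Fin m → Fin k} (h : ¬ Transports d π p) :
    colourMap n d (markedFunction n π p) = 0 := by
  classical
  funext x
  rw [colourMap_markedFunction_apply, Pi.zero_apply]
  set J := glue d (oneLine π) with hJ
  by_cases hc : ∀ i j, J (mid (p i)) (mid (p j)) → i = j
  swap
  · push Not at hc
    obtain ⟨i, j, hij, hne⟩ := hc
    refine Finset.sum_eq_zero fun y _ => ?_
    by_cases hy : J ≤ Setoid.ker (Sum.elim x (Sum.elim y Empty.elim))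
    swap
    · rw [if_neg hy, zero_mul]
    have h1 : y (p i) = y (p j) := hy hij
    have h2 : ∏ i : Fin m, colourSign (i : ℕ) (y (p i)) = 0 := by
      by_contra hprod
      rw [← ne_eq, Finset.prod_ne_zero_iff] at hprod
      have h3 := colourSign_ne_zero (hprod i (Finset.mem_univ i))
      have h4 := colourSign_ne_zero (hprod j (Finset.mem_univ j))
      rw [h1] at h3
      exact hne (Fin.ext (by omega))
    rw [h2, mul_zero]
  obtain ⟨i, hi⟩ : ∃ i, ∀ a, ¬ J (Sum.inl a) (mid (p i)) := by
    by_contra hcon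
    push Not at hcon
    exact h ⟨hcon, hc⟩
  have hin : 2 * (i : ℕ) + 1 < n := by omega
  let s : Equiv.Perm (Fin n) := Equiv.swap ⟨2 * i, by omega⟩ ⟨2 * i + 1, hin⟩
  let f : (Fin k → Fin n) → Fin k → Fin n := fun y b =>
    if J (mid b) (mid (p i)) then s (y b) else y b
  have hf : Function.Involutive f := by
    intro y
    funext b
    simp only [f]
    split_ifs
    · simp [s]
    · rfl
  have hcompat : ∀ y, J ≤ Setoid.ker (Sum.elim x (Sum.elim y Empty.elim)) →
      J ≤ Setoid.ker (Sum.elim x (Sum.elim (f y) Empty.elim)) := by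
    intro y hy
    have htop : ∀ a b, J (Sum.inl a) (mid b) → x a = f y b := by
      intro a b hab
      have h1 : x a = y b := hy hab
      simp only [f]
      rw [if_neg fun hb => hi a (J.trans hab hb), h1]
    rintro (a | a | a) (b | b | b) hab
    · exact hy hab
    · exact htop a b hab
    · exact b.elim
    · exact (htop b a (J.symm hab)).symm
    · have h1 : y a = y b := hy hab
      change f y a = f y b
      simp only [f]
      by_cases ha : J (mid a) (mid (p i))
      · have hb : J (mid b) (mid (p i)) := J.trans (J.symm hab) ha
        rw [if_pos ha, if_pos hb, h1]
      · have hb : ¬ J (mid b) (mid (p i)) := fun hb => ha (J.trans hab hb)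
        rw [if_neg ha, if_neg hb, h1]
    · exact b.elim
    · exact a.elim
    · exact a.elim
    · exact a.elim
  have hprod : ∀ y, ∏ j : Fin m, colourSign (j : ℕ) (f y (p j)) =
      -∏ j : Fin m, colourSign (j : ℕ) (y (p j)) := by
    intro y
    rw [← Finset.mul_prod_erase _ _ (Finset.mem_univ i),
      ← Finset.mul_prod_erase _ (fun j : Fin m => colourSign (j : ℕ) (y (p j))) (Finset.mem_univ i),
      ← neg_mul]
    congr 1
    · simp only [f]
      rw [if_pos (J.refl _)]
      exact colourSign_swap hin _
    · refine Finset.prod_congr rfl fun j hj => ?_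
      simp only [f]
      rw [if_neg fun hji => (Finset.mem_erase.1 hj).1 (hc j i hji)]
  have key : ∀ S : ℂ, S = -S → S = 0 := fun S hS => by
    have : (2 : ℂ) * S = 0 := by linear_combination hS
    exact (mul_eq_zero.1 this).resolve_left two_ne_zero
  refine key _ ?_
  conv_lhs => rw [← Equiv.sum_comp (hf.toPerm f)]
  rw [← Finset.sum_neg_distrib]
  refine Finset.sum_congr rfl fun y _ => ?_
  rw [Function.Involutive.coe_toPerm, hprod, mul_neg]
  congr 2
  have hiff : J ≤ Setoid.ker (Sum.elim x (Sum.elim (f y) Empty.elim)) ↔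
      J ≤ Setoid.ker (Sum.elim x (Sum.elim y Empty.elim)) := by
    refine ⟨fun h1 => ?_, hcompat y⟩
    have h2 := hcompat _ h1
    rwa [hf y] at h2
  simp only [hiff]

/-- A colouring with kernel `π` that gives the `i`th marked block the colour `2 i` and avoids the
colours `2 i + 1`. -/
theorem exists_separating_colouring (hn : 2 * k ≤ n) {π : Setoid (Fin k)} {p : Fin m → Fin k}
    (hp : ∀ i j, π (p i) (p j) → i = j) : ∃ x : Fin k → Fin n, (∀ a b, π a b ↔ x a = x b) ∧
      (∀ i, (x (p i) : ℕ) = 2 * i) ∧ ∀ a (i : Fin m), (x a : ℕ) ≠ 2 * i + 1 := by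
  classical
  let P : Fin m → Quotient π := fun i => Quotient.mk π (p i)
  have hP : Function.Injective P := fun i j h => hp i j (Quotient.exact h)
  have hcard : Fintype.card (Quotient π) ≤ k := by
    simpa using Fintype.card_quotient_le π
  have hmk : m ≤ Fintype.card (Quotient π) := by
    simpa using Fintype.card_le_of_injective P hP
  have hcompl : Fintype.card {c : Quotient π // c ∉ Set.range P} = Fintype.card (Quotient π) - m := by
    rw [Fintype.card_subtype_compl]
    congr 1
    rw [← Nat.card_eq_fintype_card]
    exact (Nat.card_range_of_injective hP).trans (Nat.card_fin m)
  obtain ⟨f⟩ : Nonempty ({c : Quotient π // c ∉ Set.range P} ↪ Fin (n - 2 * m)) :=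
    Function.Embedding.nonempty_of_card_le (by rw [hcompl, Fintype.card_fin]; omega)
  let χ : Quotient π → Fin n := fun c =>
    if h : c ∈ Set.range P then ⟨2 * h.choose, by have := h.choose.2; omega⟩
    else ⟨2 * m + f ⟨c, h⟩, by have := (f ⟨c, h⟩).2; omega⟩
  have h1 : ∀ i, (χ (P i) : ℕ) = 2 * i := by
    intro i
    have h : P i ∈ Set.range P := ⟨i, rfl⟩
    simp only [χ, dif_pos h]
    rw [hP h.choose_spec]
  have h2 : ∀ c, c ∉ Set.range P → ∃ h, (χ c : ℕ) = 2 * m + f ⟨c, h⟩ := by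
    intro c hc
    exact ⟨hc, by simp only [χ, dif_neg hc]⟩
  have hχ : Function.Injective χ := by
    intro c c' h
    have h' := congrArg (fun z : Fin n => (z : ℕ)) h
    by_cases hc : c ∈ Set.range P <;> by_cases hc' : c' ∈ Set.range P
    · obtain ⟨i, rfl⟩ := hc
      obtain ⟨j, rfl⟩ := hc'
      rw [h1, h1] at h'
      rw [Fin.ext (by omega : (i : ℕ) = j)]
    · obtain ⟨i, rfl⟩ := hc
      obtain ⟨_, he⟩ := h2 c' hc'
      rw [h1, he] at h'
      omega
    · obtain ⟨i, rfl⟩ := hc'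
      obtain ⟨_, he⟩ := h2 c hc
      rw [h1, he] at h'
      omega
    · obtain ⟨e1, he1⟩ := h2 c hc
      obtain ⟨e2, he2⟩ := h2 c' hc'
      rw [he1, he2] at h'
      exact congrArg Subtype.val (f.injective (Fin.ext (by omega) : f ⟨c, e1⟩ = f ⟨c', e2⟩))
  refine ⟨fun a => χ (Quotient.mk π a), fun a b => ?_, h1, fun a i => ?_⟩
  · exact ⟨fun h => congrArg χ (Quotient.sound h), fun h => Quotient.exact (hχ h)⟩
  · by_cases hc : Quotient.mk π a ∈ Set.range P
    · obtain ⟨j, hj⟩ := hc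
      simp only [← hj]
      rw [h1]
      omega
    · obtain ⟨_, he⟩ := h2 _ hc
      simp only [he]
      omega

/-- A family of different marked set partitions has linearly independent functions: a separating
colouring of a finest partition in a linear relation is not in the support of the other functions. -/
theorem linearIndependent_markedFunction (hn : 2 * k ≤ n) {I : Type*} {π : I → Setoid (Fin k)}
    {p : I → Fin m → Fin k} (hp : ∀ a i j, π a (p a i) (p a j) → i = j)
    (hinj : ∀ a b, π a = π b → (∀ i, π a (p a i) (p b i)) → a = b) :
    LinearIndependent ℂ fun a => markedFunction n (π a) (p a) := by
  classical
  rw [linearIndependent_iff']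
  intro s g hg
  by_contra hne
  push Not at hne
  have hs : (s.filter fun a => g a ≠ 0).Nonempty := by
    obtain ⟨a, ha, h⟩ := hne
    exact ⟨a, Finset.mem_filter.2 ⟨ha, h⟩⟩
  -- evaluate at a colouring whose kernel is a finest partition in the support
  obtain ⟨a₀, ha₀, hmin⟩ := Finset.exists_minimalFor π _ hs
  obtain ⟨x, hx, hxp, hxo⟩ := exists_separating_colouring hn (hp a₀)
  rw [Finset.mem_filter] at ha₀
  refine ha₀.2 ?_
  have h1 := congrFun hg x
  simp only [Finset.sum_apply, Pi.smul_apply, Pi.zero_apply, smul_eq_mul] at h1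
  rw [Finset.sum_eq_single a₀] at h1
  · rw [markedFunction, if_pos (show π a₀ ≤ Setoid.ker x from fun a b hab => (hx a b).1 hab),
      Finset.prod_eq_one, mul_one] at h1
    · exact h1
    · intro i _
      rw [colourSign, if_pos (hxp i)]
  · intro a ha hane
    by_cases h0 : g a = 0
    · rw [h0, zero_mul]
    by_contra hne
    have h2 := right_ne_zero_of_mul hne
    rw [markedFunction] at h2
    split_ifs at h2 with h3
    swap
    · exact h2 rfl
    have hle : π a ≤ π a₀ := fun u v huv => (hx u v).2 (h3 huv)
    have heq : π a₀ = π a := le_antisymm (hmin (Finset.mem_filter.2 ⟨ha, h0⟩) hle) hle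
    refine hane (hinj a₀ a heq fun i => (hx _ _).2 (Fin.ext ?_)).symm
    rw [hxp]
    rw [Finset.prod_ne_zero_iff] at h2
    exact ((colourSign_ne_zero (h2 i (Finset.mem_univ i))).resolve_right (hxo _ i)).symm
  · intro h
    exact absurd ha₀.1 h

end Marked

/-! ### Symmetric diagrams -/

section Fold

/-- Two copies of a set partition `J` that are glued along the blocks meeting `M`: the points `x`
and `y` are related if `f x` and `f y` are, and if moreover they have the same side `s` or lie over
a block meeting `M`. -/
def foldSetoid {X Y : Type} (J : Setoid Y) (f : X → Y) (s : X → Bool) (M : Set Y) : Setoid X where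
  r x y := J (f x) (f y) ∧ (s x = s y ∨ ∃ m ∈ M, J (f x) m)
  iseqv :=
    { refl := fun x => ⟨J.refl _, Or.inl rfl⟩
      symm := by
        rintro x y ⟨h, h'⟩
        refine ⟨J.symm h, ?_⟩
        rcases h' with h' | ⟨m, hm, h'⟩
        · exact Or.inl h'.symm
        · exact Or.inr ⟨m, hm, J.trans (J.symm h) h'⟩
      trans := by
        rintro x y z ⟨h, h'⟩ ⟨k, k'⟩
        refine ⟨J.trans h k, ?_⟩
        rcases h' with h' | ⟨m, hm, h'⟩
        · rcases k' with k' | ⟨m, hm, k'⟩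
          · exact Or.inl (h'.trans k')
          · exact Or.inr ⟨m, hm, J.trans h k'⟩
        · exact Or.inr ⟨m, hm, h'⟩ }

variable {k m : ℕ}

/-- The symmetric diagram with both rows equal to `π` whose propagating blocks are those meeting
`M`. -/
def symOf (π : Setoid (Fin k)) (M : Set (Fin k)) : Diag (Fin k) (Fin k) :=
  foldSetoid π (Sum.elim id id) Sum.isLeft M

theorem symOf_inl_inl {π : Setoid (Fin k)} {M : Set (Fin k)} {a b : Fin k} :
    symOf π M (Sum.inl a) (Sum.inl b) ↔ π a b :=
  ⟨fun h => h.1, fun h => ⟨h, Or.inl rfl⟩⟩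

theorem symOf_inr_inr {π : Setoid (Fin k)} {M : Set (Fin k)} {a b : Fin k} :
    symOf π M (Sum.inr a) (Sum.inr b) ↔ π a b :=
  ⟨fun h => h.1, fun h => ⟨h, Or.inl rfl⟩⟩

theorem symOf_inl_inr {π : Setoid (Fin k)} {M : Set (Fin k)} {a b : Fin k} :
    symOf π M (Sum.inl a) (Sum.inr b) ↔ π a b ∧ ∃ m ∈ M, π a m :=
  ⟨fun h => ⟨h.1, h.2.resolve_left (by simp)⟩, fun h => ⟨h.1, Or.inr h.2⟩⟩

theorem top_symOf (π : Setoid (Fin k)) (M : Set (Fin k)) : top (symOf π M) = π :=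
  Setoid.ext fun _ _ => symOf_inl_inl

theorem flip_symOf (π : Setoid (Fin k)) (M : Set (Fin k)) : flip (symOf π M) = symOf π M := by
  refine Setoid.ext ?_
  rintro (a | a) (b | b)
  · exact symOf_inr_inr.trans symOf_inl_inl.symm
  · exact ⟨fun h => ⟨h.1, Or.inr (h.2.resolve_left (by simp))⟩,
      fun h => ⟨h.1, Or.inr (h.2.resolve_left (by simp))⟩⟩
  · exact ⟨fun h => ⟨h.1, Or.inr (h.2.resolve_left (by simp))⟩,
      fun h => ⟨h.1, Or.inr (h.2.resolve_left (by simp))⟩⟩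
  · exact symOf_inl_inl.trans symOf_inr_inr.symm

theorem pn_symOf (π : Setoid (Fin k)) (M : Set (Fin k)) :
    pn (symOf π M) = (Quotient.mk π '' M).ncard := by
  have h : propBlocks (symOf π M) = (fun c : Quotient π =>
      {x : Fin k ⊕ Fin k | Quotient.mk π (Sum.elim id id x) = c}) '' (Quotient.mk π '' M) := by
    ext c
    constructor
    · rintro ⟨⟨x, rfl⟩, ⟨a, ha⟩, b, hb⟩
      have hab : symOf π M (Sum.inl a) (Sum.inr b) := (symOf π M).trans ha ((symOf π M).symm hb)
      obtain ⟨h1, m, hm, h2⟩ := symOf_inl_inr.1 hab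
      refine ⟨_, ⟨m, hm, rfl⟩, ?_⟩
      ext y
      have h3 : π (Sum.elim id id x) m := π.trans (π.symm ha.1) h2
      constructor
      · intro hy
        have hy' : π (Sum.elim id id y) m := Quotient.exact hy
        exact ⟨π.trans hy' (π.symm h3), Or.inr ⟨m, hm, hy'⟩⟩
      · intro hy
        exact Quotient.sound (π.trans hy.1 h3)
    · rintro ⟨_, ⟨m, hm, rfl⟩, rfl⟩
      refine ⟨⟨Sum.inl m, ?_⟩, ⟨m, rfl⟩, m, rfl⟩
      ext y
      constructor
      · intro hy
        have hy' : π (Sum.elim id id y) m := Quotient.exact hy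
        exact ⟨hy', Or.inr ⟨m, hm, hy'⟩⟩
      · intro hy
        exact Quotient.sound hy.1
  rw [pn, h, Set.ncard_image_of_injective]
  intro c c' hcc'
  obtain ⟨a, rfl⟩ := Quotient.exists_rep c
  have h1 : (Sum.inl a : Fin k ⊕ Fin k) ∈ {x : Fin k ⊕ Fin k |
      Quotient.mk π (Sum.elim id id x) = Quotient.mk π a} := rfl
  have hcc'' : {x : Fin k ⊕ Fin k | Quotient.mk π (Sum.elim id id x) = Quotient.mk π a} =
    {x : Fin k ⊕ Fin k | Quotient.mk π (Sum.elim id id x) = c'} := hcc'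
  rw [hcc''] at h1
  exact h1

theorem isSymDiagram_symOf_iff {π : Setoid (Fin k)} {M : Set (Fin k)} :
    IsSymDiagram m (symOf π M) ↔ (Quotient.mk π '' M).ncard = m := by
  rw [← pn_symOf]
  refine ⟨fun h => h.2.1, fun h => ⟨flip_symOf π M, h, ?_⟩⟩
  rintro c ⟨⟨x, rfl⟩, ⟨a, ha⟩, b, hb⟩ a' ha'
  have hab : symOf π M (Sum.inl a') (Sum.inr b) := (symOf π M).trans ha' ((symOf π M).symm hb)
  obtain ⟨h1, h2⟩ := symOf_inl_inr.1 hab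
  have h3 : symOf π M (Sum.inr a') (Sum.inr b) := symOf_inr_inr.2 h1
  exact (symOf π M).trans h3 hb

/-- The symmetric diagram with both rows `π` and the propagating blocks marked by `p`. -/
def mkSym (π : Setoid (Fin k)) (p : Fin m → Fin k) (hp : ∀ i j, π (p i) (p j) → i = j) :
    SymDiagram k m :=
  ⟨symOf π (Set.range p), isSymDiagram_symOf_iff.2 (by
    rw [← Set.range_comp, ← Nat.card_coe_set_eq, Nat.card_range_of_injective, Nat.card_fin]
    exact fun i j h => hp i j (Quotient.exact h))⟩

theorem top_mkSym (π : Setoid (Fin k)) (p : Fin m → Fin k) (hp : ∀ i j, π (p i) (p j) → i = j) :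
    top (mkSym π p hp).1 = π := top_symOf _ _

end Fold

section PropEnum

variable {k m : ℕ} (w : SymDiagram k m)

theorem exists_block_propEnum (i : Fin m) : ∃ c ∈ propBlocks w.1, Sum.inl (propEnum w i) ∈ c ∧
    ∀ b, Sum.inl b ∈ c → b ≤ propEnum w i := by
  have h := Finset.orderEmbOfFin_mem (propMax w.1) ((card_propMax w.1).trans w.2.2.1) i
  have h1 : propEnum w i ∈ propMax w.1 := h
  simpa only [propMax, Finset.mem_filter, Finset.mem_univ, true_and] using h1

theorem propEnum_inl_inr (i : Fin m) : w.1 (Sum.inl (propEnum w i)) (Sum.inr (propEnum w i)) := by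
  obtain ⟨c, hc, h, -⟩ := exists_block_propEnum w i
  have h' := w.2.2.2 c hc _ h
  obtain ⟨⟨x, rfl⟩, -⟩ := hc
  exact w.1.trans h (w.1.symm h')

theorem le_propEnum {i : Fin m} {a : Fin k} (h : top w.1 a (propEnum w i)) : a ≤ propEnum w i := by
  obtain ⟨c, ⟨⟨x, rfl⟩, -⟩, h1, h2⟩ := exists_block_propEnum w i
  exact h2 a (w.1.trans (show w.1 (Sum.inl a) (Sum.inl (propEnum w i)) from h) h1)

theorem propEnum_distinct (i j : Fin m) (h : top w.1 (propEnum w i) (propEnum w j)) : i = j :=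
  (propEnum w).injective (le_antisymm (le_propEnum w h) (le_propEnum w ((top w.1).symm h)))

theorem exists_propEnum {a b : Fin k} (h : w.1 (Sum.inl a) (Sum.inr b)) :
    ∃ i, top w.1 a (propEnum w i) := by
  classical
  have hne : (Finset.univ.filter fun c : Fin k => top w.1 c a).Nonempty :=
    ⟨a, by simp⟩
  set e := (Finset.univ.filter fun c : Fin k => top w.1 c a).max' hne with he
  have hea : top w.1 e a := by simpa using Finset.max'_mem _ hne
  have hmem : e ∈ propMax w.1 := by
    simp only [propMax, Finset.mem_filter, Finset.mem_univ, true_and]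
    refine ⟨{x | w.1 x (Sum.inl a)}, ⟨⟨Sum.inl a, rfl⟩, ⟨a, w.1.refl _⟩, b, w.1.symm h⟩, hea, ?_⟩
    intro c hc
    exact Finset.le_max' _ _ (Finset.mem_filter.2 ⟨Finset.mem_univ c, hc⟩)
  have hr := Finset.range_orderEmbOfFin (propMax w.1) ((card_propMax w.1).trans w.2.2.1)
  have hmem' : e ∈ (propMax w.1 : Set (Fin k)) := hmem
  rw [← hr] at hmem'
  obtain ⟨i, hi⟩ := hmem'
  refine ⟨i, ?_⟩
  have : propEnum w i = e := hi
  rw [this]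
  exact (top w.1).symm hea

theorem inr_inr_iff {a b : Fin k} : w.1 (Sum.inr a) (Sum.inr b) ↔ top w.1 a b := by
  have h : flip w.1 (Sum.inl a) (Sum.inl b) ↔ w.1 (Sum.inl a) (Sum.inl b) := by rw [w.2.1]
  exact h

theorem eq_symOf : w.1 = symOf (top w.1) (Set.range (propEnum w)) := by
  have key : ∀ a b, w.1 (Sum.inl a) (Sum.inr b) ↔
      symOf (top w.1) (Set.range (propEnum w)) (Sum.inl a) (Sum.inr b) := by
    intro a b
    rw [symOf_inl_inr]
    constructor
    · intro h
      obtain ⟨i, hi⟩ := exists_propEnum w h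
      refine ⟨?_, _, ⟨i, rfl⟩, hi⟩
      have h1 : w.1 (Sum.inr a) (Sum.inr (propEnum w i)) := (inr_inr_iff w).2 hi
      have h2 := w.1.trans (w.1.trans hi (propEnum_inl_inr w i)) (w.1.symm h1)
      exact (inr_inr_iff w).1 (w.1.trans (w.1.symm h2) h)
    · rintro ⟨h, _, ⟨i, rfl⟩, hi⟩
      have h1 : w.1 (Sum.inr a) (Sum.inr (propEnum w i)) := (inr_inr_iff w).2 hi
      have h2 : w.1 (Sum.inl a) (Sum.inl (propEnum w i)) := hi
      exact w.1.trans (w.1.trans (w.1.trans h2 (propEnum_inl_inr w i)) (w.1.symm h1))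
        ((inr_inr_iff w).2 h)
  refine Setoid.ext ?_
  rintro (a | a) (b | b)
  · exact (symOf_inl_inl (π := top w.1)).symm
  · exact key a b
  · rw [Setoid.comm', key b a, Setoid.comm']
  · exact (inr_inr_iff w).trans symOf_inr_inr.symm

/-- Points in the different propagating blocks are, up to a permutation of the blocks, equivalent
to the maximal entries. -/
theorem exists_perm_propEnum {q : Fin m → Fin k} (hq : ∀ i j, top w.1 (q i) (q j) → i = j)
    (hq' : ∀ i, ∃ b, w.1 (Sum.inl (q i)) (Sum.inr b)) :
    ∃ σ : Equiv.Perm (Fin m), ∀ i, top w.1 (q i) (propEnum w (σ i)) := by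
  choose f hf using fun i => exists_propEnum w (hq' i).choose_spec
  have hinj : Function.Injective f := by
    intro i j hij
    refine hq i j ((top w.1).trans (hf i) ?_)
    rw [hij]
    exact (top w.1).symm (hf j)
  exact ⟨Equiv.ofBijective f (Finite.injective_iff_bijective.1 hinj), hf⟩

variable {w} in
/-- A symmetric diagram is determined by its top row and its marked blocks. -/
theorem symDiagram_ext {w' : SymDiagram k m} (h : top w.1 = top w'.1)
    {σ : Fin m → Fin m} (hσ : ∀ i, top w.1 (propEnum w i) (propEnum w' (σ i))) : w = w' := by
  refine Subtype.ext ?_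
  have hinj : Function.Injective σ := by
    intro i j hij
    refine propEnum_distinct w i j ((top w.1).trans (hσ i) ?_)
    rw [hij]
    exact (top w.1).symm (hσ j)
  have hsurj := Finite.surjective_of_injective hinj
  rw [eq_symOf w, eq_symOf w', ← h]
  have hM : ∀ a, (∃ m ∈ Set.range (propEnum w), top w.1 a m) ↔
      ∃ m ∈ Set.range (propEnum w'), top w.1 a m := by
    intro a
    constructor
    · rintro ⟨_, ⟨i, rfl⟩, hi⟩
      exact ⟨_, ⟨σ i, rfl⟩, (top w.1).trans hi (hσ i)⟩
    · rintro ⟨_, ⟨i, rfl⟩, hi⟩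
      obtain ⟨j, rfl⟩ := hsurj i
      exact ⟨_, ⟨j, rfl⟩, (top w.1).trans hi ((top w.1).symm (hσ j))⟩
  refine Setoid.ext fun x y => and_congr_right fun _ => or_congr_right ?_
  exact hM _

end PropEnum

section Conjugation

variable {k m : ℕ}

/-- The four rows of the diagrams `d`, `w`, `dᵀ` placed above each other form two copies of the
joined diagram of `d` and `π`, glued along the marked blocks. -/
theorem glue₄_symOf (d : Diag (Fin k) (Fin k)) (π : Setoid (Fin k)) (M : Set (Fin k)) :
    glue₄ d (symOf π M) (flip d) = foldSetoid (glue d (oneLine π))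
      (Sum.elim Sum.inl (Sum.elim mid (Sum.elim mid Sum.inl)))
      (Sum.elim (fun _ => true) (Sum.elim (fun _ => true) fun _ => false)) (mid '' M) := by
  set J := glue d (oneLine π) with hJ
  set G := glue₄ d (symOf π M) (flip d) with hG
  have hd : d.map up ≤ J := le_sup_left
  have hπ : (oneLine π).map down ≤ J := le_sup_right
  have hmid : ∀ {a b : Fin k}, π a b → J (mid a) (mid b) := fun {a b} h =>
    hπ (Setoid.le_comap_map (r := oneLine π) (f := down) (show oneLine π (Sum.inl a) (Sum.inl b) from h))
  have hup : ∀ {x y : Fin k ⊕ Fin k}, d x y → J (up x) (up y) := fun h =>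
    hd (Setoid.le_comap_map h)
  have h12 : (d.map up).map r123 ≤ G :=
    le_trans (by rw [glue, map_sup]; exact le_sup_left) (le_sup_left : _ ≤ G)
  have h23 : ((symOf π M).map down).map r123 ≤ G :=
    le_trans (by rw [glue, map_sup]; exact le_sup_right) (le_sup_left : _ ≤ G)
  have h34 : ((flip d).map down).map r134 ≤ G := le_sup_right
  rw [map_map, map_le_iff] at h12 h23 h34
  apply le_antisymm
  · rw [hG, glue₄, glue, map_sup, map_map, map_map, map_map]
    refine sup_le (sup_le ?_ ?_) ?_ <;> rw [map_le_iff]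
    · rintro (a | a) (b | b) h <;> exact ⟨hup h, Or.inl rfl⟩
    · rintro (a | a) (b | b) h
      · exact ⟨hmid h.1, Or.inl rfl⟩
      · obtain ⟨m, hm, h'⟩ := h.2.resolve_left (by simp)
        exact ⟨hmid h.1, Or.inr ⟨mid m, ⟨m, hm, rfl⟩, hmid h'⟩⟩
      · obtain ⟨m, hm, h'⟩ := h.2.resolve_left (by simp)
        exact ⟨hmid h.1, Or.inr ⟨mid m, ⟨m, hm, rfl⟩, hmid h'⟩⟩
      · exact ⟨hmid h.1, Or.inl rfl⟩
    · rintro (a | a) (b | b) h <;> exact ⟨hup h, Or.inl rfl⟩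
  · -- both copies of the joined diagram are contained in the diagram on four rows
    let u : Fin k ⊕ Fin k ⊕ Empty → Fin k ⊕ Fin k ⊕ Fin k ⊕ Fin k :=
      Sum.elim Sum.inl (Sum.elim (fun b => Sum.inr (Sum.inl b)) Empty.elim)
    let l : Fin k ⊕ Fin k ⊕ Empty → Fin k ⊕ Fin k ⊕ Fin k ⊕ Fin k :=
      Sum.elim (fun a => Sum.inr (Sum.inr (Sum.inr a)))
        (Sum.elim (fun b => Sum.inr (Sum.inr (Sum.inl b))) Empty.elim)
    have hu : J ≤ G.comap u := by
      rw [hJ, glue]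
      refine sup_le ?_ ?_ <;> rw [map_le_iff]
      · rintro (a | a) (b | b) h <;> exact h12 h
      · rintro (a | a) (b | b) h
        · exact h23 (symOf_inl_inl.2 h)
        · exact b.elim
        · exact a.elim
        · exact a.elim
    have hl : J ≤ G.comap l := by
      rw [hJ, glue]
      refine sup_le ?_ ?_ <;> rw [map_le_iff]
      · intro a b h
        have h' : (flip d) a.swap b.swap := by
          rcases a with a | a <;> rcases b with b | b <;> exact h
        have := h34 h'
        rcases a with a | a <;> rcases b with b | b <;> exact this
      · rintro (a | a) (b | b) h
        · exact h23 (symOf_inr_inr.2 h)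
        · exact b.elim
        · exact a.elim
        · exact a.elim
    have hcross : ∀ m ∈ M, G (u (mid m)) (l (mid m)) := fun m hm =>
      h23 (symOf_inl_inr.2 ⟨π.refl _, m, hm, π.refl _⟩)
    -- every point of the four rows lies in the upper or in the lower copy
    have hside : ∀ x : Fin k ⊕ Fin k ⊕ Fin k ⊕ Fin k,
        (Sum.elim (fun _ => true) (Sum.elim (fun _ => true) fun _ => false) x = true ∧
          x = u (Sum.elim Sum.inl (Sum.elim mid (Sum.elim mid Sum.inl)) x)) ∨
        (Sum.elim (fun _ => true) (Sum.elim (fun _ => true) fun _ => false) x = false ∧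
          x = l (Sum.elim Sum.inl (Sum.elim mid (Sum.elim mid Sum.inl)) x)) := by
      rintro (x | x | x | x)
      · exact Or.inl ⟨rfl, rfl⟩
      · exact Or.inl ⟨rfl, rfl⟩
      · exact Or.inr ⟨rfl, rfl⟩
      · exact Or.inr ⟨rfl, rfl⟩
    rintro x y ⟨h1, h2⟩
    rcases hside x with ⟨sx, ex⟩ | ⟨sx, ex⟩ <;> rcases hside y with ⟨sy, ey⟩ | ⟨sy, ey⟩ <;>
      rw [sx, sy] at h2 <;> rw [ex, ey]
    · exact hu h1
    · obtain ⟨_, ⟨m, hm, rfl⟩, h3⟩ := h2.resolve_left (by simp)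
      exact G.trans (hu h3) (G.trans (hcross m hm) (hl (J.trans (J.symm h3) h1)))
    · obtain ⟨_, ⟨m, hm, rfl⟩, h3⟩ := h2.resolve_left (by simp)
      exact G.trans (hl h3) (G.trans (G.symm (hcross m hm)) (hu (J.trans (J.symm h3) h1)))
    · exact hl h1

/-- Conjugation is concatenation with the top row; the marked blocks are those connected to a marked
block. -/
theorem conj_symOf (d : Diag (Fin k) (Fin k)) (π : Setoid (Fin k)) (M : Set (Fin k)) :
    conj d (symOf π M) = symOf (top (comp d (oneLine π)))
      {a | ∃ m ∈ M, glue d (oneLine π) (Sum.inl a) (mid m)} := by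
  rw [conj, comp.eq_1 d, ← comap_glue₄_r124, glue₄_symOf]
  set J := glue d (oneLine π) with hJ
  have hM : ∀ a, (∃ m ∈ (mid '' M : Set (Fin k ⊕ Fin k ⊕ Empty)), J (Sum.inl a) m) ↔
      ∃ b ∈ {a | ∃ m ∈ M, J (Sum.inl a) (mid m)}, top (comp d (oneLine π)) a b := by
    intro a
    constructor
    · rintro ⟨_, ⟨m, hm, rfl⟩, h⟩
      exact ⟨a, ⟨m, hm, h⟩, Setoid.refl' _ a⟩
    · rintro ⟨b, ⟨m, hm, h⟩, hab⟩
      exact ⟨mid m, ⟨m, hm, rfl⟩, J.trans hab h⟩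
  refine Setoid.ext ?_
  rintro (a | a) (b | b) <;> exact and_congr Iff.rfl (or_congr (by simp [outer, r124]) (hM a))

theorem glue_symOf_le (d : Diag (Fin k) (Fin k)) (π : Setoid (Fin k)) (M : Set (Fin k)) :
    glue d (symOf π M) ≤ foldSetoid (glue d (oneLine π))
      (Sum.elim Sum.inl (Sum.elim mid mid))
      (Sum.elim (fun _ => true) (Sum.elim (fun _ => true) fun _ => false)) (mid '' M) := by
  intro x y h
  have h1 : (glue d (symOf π M)).map r123 ≤ glue₄ d (symOf π M) (flip d) := le_sup_left
  have h2 := h1 (Setoid.le_comap_map h)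
  rw [glue₄_symOf] at h2
  rcases x with x | x | x <;> rcases y with y | y | y <;> exact h2

theorem glue_oneLine_le (d : Diag (Fin k) (Fin k)) (π : Setoid (Fin k)) (M : Set (Fin k)) :
    glue d (oneLine π) ≤ (glue d (symOf π M)).comap
      (Sum.map id (Sum.map id Empty.elim)) := by
  have h1 : d.map up ≤ glue d (symOf π M) := le_sup_left
  have h2 : (symOf π M).map down ≤ glue d (symOf π M) := le_sup_right
  rw [map_le_iff] at h1 h2
  rw [glue.eq_1 d (oneLine π)]
  refine sup_le ?_ ?_ <;> rw [map_le_iff]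
  · rintro (a | a) (b | b) h <;> exact h1 h
  · rintro (a | a) (b | b) h
    · exact h2 (symOf_inl_inl.2 h)
    · exact b.elim
    · exact a.elim
    · exact a.elim

/-- Above the bottom row, the components of `d` and a symmetric diagram are the components of `d`
and its top row. -/
theorem glue_symOf_iff {d : Diag (Fin k) (Fin k)} {π : Setoid (Fin k)} {M : Set (Fin k)}
    {x y : Fin k ⊕ Fin k ⊕ Empty} :
    glue d (symOf π M) (Sum.map id (Sum.map id Empty.elim) x) (Sum.map id (Sum.map id Empty.elim) y) ↔
      glue d (oneLine π) x y := by
  refine ⟨fun h => ?_, fun h => glue_oneLine_le d π M h⟩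
  have h1 := (glue_symOf_le d π M h).1
  rcases x with x | x | x <;> rcases y with y | y | y <;> first | exact h1 | exact x.elim | exact y.elim

/-- If all marked blocks are connected to the top row of `d`, then no component inside the middle row
touches the bottom row of the symmetric diagram. -/
theorem loops_symOf {d : Diag (Fin k) (Fin k)} {π : Setoid (Fin k)} {M : Set (Fin k)}
    (h : ∀ m ∈ M, ∃ a, glue d (oneLine π) (Sum.inl a) (mid m)) :
    loops d (symOf π M) = loops d (oneLine π) := by
  set g : Fin k ⊕ Fin k ⊕ Empty → Fin k ⊕ Fin k ⊕ Fin k := Sum.map id (Sum.map id Empty.elim) with hg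
  have hginj : Function.Injective g :=
    Function.injective_id.sumMap (Function.injective_id.sumMap fun e => e.elim)
  set J := glue d (oneLine π) with hJ
  set G := glue d (symOf π M) with hG
  have hGJ : ∀ {x y}, G (g x) (g y) ↔ J x y := glue_symOf_iff
  have himg : ∀ a, (∀ y, J y (mid a) → y ∈ Set.range mid) →
      {y | G y (mid a)} = g '' {y | J y (mid a)} := by
    intro a ha
    ext y
    constructor
    · intro hy
      rcases y with y | y | y
      · exact ⟨Sum.inl y, (hGJ (x := Sum.inl y) (y := mid a)).1 hy, rfl⟩
      · exact ⟨mid y, (hGJ (x := mid y) (y := mid a)).1 hy, rfl⟩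
      · exfalso
        obtain ⟨h1, h2⟩ := glue_symOf_le d π M hy
        obtain ⟨_, ⟨m, hm, rfl⟩, h3⟩ := h2.resolve_left (by simp [mid])
        obtain ⟨t, ht⟩ := h m hm
        obtain ⟨b, hb⟩ := ha (Sum.inl t) (J.trans ht (J.trans (J.symm h3) h1))
        simp [mid] at hb
    · rintro ⟨y, hy, rfl⟩
      exact (hGJ (x := y) (y := mid a)).2 hy
  have key : inside G (Set.range mid) = (fun c => g '' c) '' inside J (Set.range mid) := by
    ext c
    simp only [Set.mem_image, mem_inside]
    constructor
    · rintro ⟨x, rfl, hx⟩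
      obtain ⟨a, rfl⟩ := hx x (G.refl x)
      have ha : ∀ y, J y (mid a) → y ∈ Set.range mid := by
        intro y hy
        obtain ⟨b, hb⟩ := hx (g y) ((hGJ (y := mid a)).2 hy)
        exact ⟨b, hginj hb⟩
      exact ⟨_, ⟨mid a, rfl, ha⟩, (himg a ha).symm⟩
    · rintro ⟨_, ⟨x, rfl, hx⟩, rfl⟩
      obtain ⟨a, rfl⟩ := hx x (J.refl x)
      refine ⟨mid a, (himg a hx).symm, fun y hy => ?_⟩
      have hy' : y ∈ {y | G y (mid a)} := hy
      rw [himg a hx] at hy'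
      obtain ⟨z, hz, rfl⟩ := hy'
      obtain ⟨b, rfl⟩ := hx z hz
      exact ⟨b, rfl⟩
  rw [loops, loops, key, Set.ncard_image_of_injective _ hginj.image_injective]

theorem top_conj (d : Diag (Fin k) (Fin k)) (w : SymDiagram k m) :
    top (conj d w.1) = top (comp d (oneLine (top w.1))) := by
  rw [eq_symOf w, conj_symOf, top_symOf, top_symOf]

/-- Conjugation by `d` preserves the propagating number of `w` if and only if `d` separates the marked
blocks of `w` and connects them to its top row. -/
theorem isSymDiagram_conj_iff (d : Diag (Fin k) (Fin k)) (w : SymDiagram k m) :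
    IsSymDiagram m (conj d w.1) ↔ Transports d (top w.1) (propEnum w) := by
  classical
  have hw := congrArg (conj d) (eq_symOf w)
  rw [hw, conj_symOf, isSymDiagram_symOf_iff]
  set J := glue d (oneLine (top w.1)) with hJ
  set Q := top (comp d (oneLine (top w.1))) with hQ
  have hQJ : ∀ a b, Q a b ↔ J (Sum.inl a) (Sum.inl b) := fun a b => Iff.rfl
  let S : Set (Fin m) := {i | ∃ a, J (Sum.inl a) (mid (propEnum w i))}
  have hS : ∀ i : Fin m, ∃ c : Quotient Q, i ∈ S →
      ∃ a, Quotient.mk Q a = c ∧ J (Sum.inl a) (mid (propEnum w i)) := by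
    intro i
    by_cases hi : i ∈ S
    · obtain ⟨a, ha⟩ := hi
      exact ⟨Quotient.mk Q a, fun _ => ⟨a, rfl, ha⟩⟩
    · by_cases hk : Nonempty (Fin k)
      · exact ⟨Quotient.mk Q (Classical.choice hk), fun h => absurd h hi⟩
      · exact absurd ⟨propEnum w i⟩ hk
  choose f hf using hS
  have himg : Quotient.mk Q '' {a | ∃ m ∈ Set.range (propEnum w), J (Sum.inl a) (mid m)} = f '' S := by
    ext c
    constructor
    · rintro ⟨a, ⟨_, ⟨i, rfl⟩, h⟩, rfl⟩
      have hi : i ∈ S := ⟨a, h⟩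
      obtain ⟨b, hb, hb'⟩ := hf i hi
      refine ⟨i, hi, hb.symm.trans (Quotient.sound ?_)⟩
      exact J.trans hb' (J.symm h)
    · rintro ⟨i, hi, rfl⟩
      obtain ⟨b, hb, hb'⟩ := hf i hi
      exact ⟨b, ⟨_, ⟨i, rfl⟩, hb'⟩, hb⟩
  rw [himg]
  constructor
  · intro hcard
    have h1 : (f '' S).ncard ≤ S.ncard := Set.ncard_image_le (Set.toFinite S)
    have h2 : S.ncard ≤ (Set.univ : Set (Fin m)).ncard := Set.ncard_le_ncard (Set.subset_univ S)
    have h3 : (Set.univ : Set (Fin m)).ncard = m := by rw [Set.ncard_univ, Nat.card_fin]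
    have hSu : S = Set.univ := Set.eq_of_subset_of_ncard_le (Set.subset_univ S) (by omega)
    have hinj : Set.InjOn f S := (Set.ncard_image_iff (Set.toFinite S)).1 (by omega)
    have hall : ∀ i, i ∈ S := fun i => hSu ▸ Set.mem_univ i
    refine ⟨hall, fun i j hij => hinj (hall i) (hall j) ?_⟩
    obtain ⟨a, ha, ha'⟩ := hf i (hall i)
    obtain ⟨b, hb, hb'⟩ := hf j (hall j)
    rw [← ha, ← hb]
    exact Quotient.sound (J.trans ha' (J.trans hij (J.symm hb')))
  · rintro ⟨h1, h2⟩
    have hSu : S = Set.univ := Set.eq_univ_of_forall h1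
    have hinj : Set.InjOn f S := by
      intro i hi j hj hij
      obtain ⟨a, ha, ha'⟩ := hf i hi
      obtain ⟨b, hb, hb'⟩ := hf j hj
      rw [← ha, ← hb] at hij
      have hab : J (Sum.inl a) (Sum.inl b) := (hQJ a b).1 (Quotient.exact hij)
      exact h2 i j (J.trans (J.symm ha') (J.trans hab hb'))
    rw [hinj.ncard_image, hSu, Set.ncard_univ, Nat.card_fin]

theorem loops_eq_of_transports {d : Diag (Fin k) (Fin k)} {w : SymDiagram k m}
    (h : Transports d (top w.1) (propEnum w)) : loops d w.1 = loops d (oneLine (top w.1)) := by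
  have hw := congrArg (loops d) (eq_symOf w)
  rw [hw, loops_symOf]
  rintro _ ⟨i, rfl⟩
  exact h.1 i

theorem glue_iff {d : Diag (Fin k) (Fin k)} {w : SymDiagram k m} {a b : Fin k} :
    glue d w.1 (Sum.inl a) (mid b) ↔ glue d (oneLine (top w.1)) (Sum.inl a) (mid b) := by
  have h := glue_symOf_iff (d := d) (π := top w.1) (M := Set.range (propEnum w)) (x := Sum.inl a)
    (y := mid b)
  rw [← eq_symOf w] at h
  exact h

theorem isTwist_twist {d : Diag (Fin k) (Fin k)} {w : SymDiagram k m}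
    (h : IsSymDiagram m (conj d w.1)) :
    IsTwist d w ⟨conj d w.1, h⟩ (twist d w ⟨conj d w.1, h⟩) := by
  have hex : ∃ σ, IsTwist d w ⟨conj d w.1, h⟩ σ := by
    have hT := (isSymDiagram_conj_iff d w).1 h
    choose q hq using hT.1
    have htop := top_conj d w
    obtain ⟨σ, hσ⟩ := exists_perm_propEnum ⟨conj d w.1, h⟩ (q := q) (fun i j hij => by
        have htop' : top (conj d w.1) (q i) (q j) := hij
        rw [htop] at htop'
        have hij' : glue d (oneLine (top w.1)) (Sum.inl (q i)) (Sum.inl (q j)) := htop'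
        exact hT.2 i j (Setoid.trans' _ (Setoid.symm' _ (hq i)) (Setoid.trans' _ hij' (hq j))))
      (fun i => ⟨q i, by
        change conj d w.1 (Sum.inl (q i)) (Sum.inr (q i))
        rw [eq_symOf w, conj_symOf, symOf_inl_inr]
        refine ⟨Setoid.refl' _ _, q i, ⟨_, ⟨i, rfl⟩, ?_⟩, Setoid.refl' _ _⟩
        exact hq i⟩)
    refine ⟨σ, fun i => glue_iff.2 ?_⟩
    have h1 : top (conj d w.1) (q i) (propEnum ⟨conj d w.1, h⟩ (σ i)) := hσ i
    rw [htop] at h1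
    have h2 : glue d (oneLine (top w.1)) (Sum.inl (q i))
      (Sum.inl (propEnum ⟨conj d w.1, h⟩ (σ i))) := h1
    exact Setoid.trans' _ (Setoid.symm' _ h2) (hq i)
  rw [twist, dif_pos hex]
  exact hex.choose_spec

theorem Transports.comp_perm {d : Diag (Fin k) (Fin k)} {π : Setoid (Fin k)} {p : Fin m → Fin k}
    (τ : Equiv.Perm (Fin m)) : Transports d π (p ∘ τ) ↔ Transports d π p := by
  constructor
  · rintro ⟨h1, h2⟩
    refine ⟨fun i => ?_, fun i j hij => ?_⟩
    · obtain ⟨a, ha⟩ := h1 (τ.symm i)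
      exact ⟨a, by simpa using ha⟩
    · exact τ.symm.injective (h2 _ _ (by simpa using hij))
  · rintro ⟨h1, h2⟩
    exact ⟨fun i => h1 (τ i), fun i j hij => τ.injective (h2 _ _ hij)⟩

theorem colourMap_symDiagram {n : ℕ} {d : Diag (Fin k) (Fin k)} {w : SymDiagram k m}
    (h : IsSymDiagram m (conj d w.1)) (τ : Equiv.Perm (Fin m)) :
    colourMap n d (markedFunction n (top w.1) (propEnum w ∘ τ)) =
      (n : ℂ) ^ loops d w.1 • markedFunction n (top (conj d w.1))
        (propEnum ⟨conj d w.1, h⟩ ∘ (twist d w ⟨conj d w.1, h⟩ * τ)) := by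
  rw [colourMap_markedFunction (p := propEnum w ∘ τ)
    (q := propEnum ⟨conj d w.1, h⟩ ∘ ⇑(twist d w ⟨conj d w.1, h⟩ * τ)) d
    fun i => glue_iff.1 (isTwist_twist h (τ i)),
    loops_eq_of_transports ((isSymDiagram_conj_iff d w).1 h), top_conj]

theorem colourMap_symDiagram_eq_zero {n : ℕ} (hmn : 2 * m ≤ n) {d : Diag (Fin k) (Fin k)}
    {w : SymDiagram k m} (h : ¬ IsSymDiagram m (conj d w.1)) (τ : Equiv.Perm (Fin m)) :
    colourMap n d (markedFunction n (top w.1) (propEnum w ∘ τ)) = 0 :=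
  colourMap_markedFunction_eq_zero hmn fun hT =>
    h ((isSymDiagram_conj_iff d w).2 ((Transports.comp_perm τ).1 hT))

end Conjugation

/-! ### The twisted conjugation module -/

section Realization

variable {k n : ℕ} {μ : YoungDiagram}

/-- The part of `realization` over the diagram `w`. -/
noncomputable def realizationAt (n : ℕ) (w : SymDiagram k μ.card) :
    Specht μ →ₗ[ℂ] ColourSpace (Fin k) n where
  toFun v := ∑ τ : Equiv.Perm (Fin μ.card),
    v.1.coeff τ • markedFunction n (top w.1) (propEnum w ∘ τ)
  map_add' u v := by
    rw [← Finset.sum_add_distrib]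
    exact Finset.sum_congr rfl fun τ _ => add_smul _ _ _
  map_smul' r v := by
    rw [RingHom.id_apply, Finset.smul_sum]
    exact Finset.sum_congr rfl fun τ _ => (smul_smul _ _ _).symm

theorem realizationAt_apply (w : SymDiagram k μ.card) (v : Specht μ) :
    realizationAt n w v = ∑ τ : Equiv.Perm (Fin μ.card),
      v.1.coeff τ • markedFunction n (top w.1) (propEnum w ∘ τ) := rfl

theorem realizationAt_smul (w : SymDiagram k μ.card) (σ : Equiv.Perm (Fin μ.card)) (v : Specht μ) :
    realizationAt n w (MonoidAlgebra.of ℂ _ σ • v) = ∑ τ : Equiv.Perm (Fin μ.card),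
      v.1.coeff τ • markedFunction n (top w.1) (propEnum w ∘ ⇑(σ * τ)) := by
  rw [realizationAt_apply, ← Equiv.sum_comp (Equiv.mulLeft σ)]
  refine Finset.sum_congr rfl fun τ _ => ?_
  rw [Submodule.coe_smul, smul_eq_mul, coeff_of_mul, Equiv.coe_mulLeft, inv_mul_cancel_left]

/-- The realization of `W ⊗ S^μ` by functions of colourings: the tensor `w ⊗ σ` is sent to the
function of the top row of `w`, with the propagating blocks marked in the order given by `σ`. -/
noncomputable def realization (k n : ℕ) (μ : YoungDiagram) :
    SymModule k μ →ₗ[ℂ] ColourSpace (Fin k) n :=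
  TensorProduct.lift (Finsupp.linearCombination ℂ fun w : SymDiagram k μ.card => realizationAt n w)

theorem realization_single_tmul (w : SymDiagram k μ.card) (v : Specht μ) :
    realization k n μ (Finsupp.single w 1 ⊗ₜ v) = realizationAt n w v := by
  rw [realization, TensorProduct.lift.tmul, Finsupp.linearCombination_single, one_smul]

theorem symModule_hom_ext {X : Type*} [AddCommMonoid X] [Module ℂ X] {f g : SymModule k μ →ₗ[ℂ] X}
    (h : ∀ w v, f (Finsupp.single w 1 ⊗ₜ v) = g (Finsupp.single w 1 ⊗ₜ v)) : f = g := by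
  refine TensorProduct.ext (Finsupp.lhom_ext' fun w => LinearMap.ext_ring (LinearMap.ext fun v => ?_))
  exact h w v

@[elab_as_elim]
theorem symModule_induction {P : SymModule k μ → Prop} (zero : P 0)
    (add : ∀ x y, P x → P y → P (x + y)) (tmul : ∀ w v, P (Finsupp.single w 1 ⊗ₜ v))
    (u : SymModule k μ) : P u := by
  induction u using TensorProduct.induction_on with
  | zero => exact zero
  | add x y hx hy => exact add x y hx hy
  | tmul a v =>
    induction a using Finsupp.induction_linear with
    | zero =>
      rw [TensorProduct.zero_tmul]
      exact zero
    | add a b ha hb =>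
      rw [TensorProduct.add_tmul]
      exact add _ _ ha hb
    | single w r =>
      have h : Finsupp.single w r = r • Finsupp.single w (1 : ℂ) := by simp
      rw [h, TensorProduct.smul_tmul]
      exact tmul w _

/-- This is where the bound `2 k ≤ n` is needed: the pairs of a symmetric diagram and a permutation
give linearly independent functions. -/
theorem realization_injective (hn : 2 * k ≤ n) : Function.Injective (realization k n μ) := by
  classical
  rw [injective_iff_map_eq_zero]
  intro u hu
  let e := TensorProduct.finsuppScalarLeft ℂ (Specht μ) (SymDiagram k μ.card)
  have hsum : realization k n μ = (Finsupp.lsum ℂ fun w => realizationAt n w) ∘ₗ e.toLinearMap := by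
    refine symModule_hom_ext fun w v => ?_
    rw [realization_single_tmul, LinearMap.comp_apply, LinearEquiv.coe_coe,
      TensorProduct.finsuppScalarLeft_apply_tmul, Finsupp.sum_single_index (by simp), one_smul,
      Finsupp.lsum_single]
  rw [hsum, LinearMap.comp_apply, Finsupp.lsum_apply, Finsupp.sum] at hu
  simp only [realizationAt_apply] at hu
  have hli := linearIndependent_markedFunction hn
    (I := SymDiagram k μ.card × Equiv.Perm (Fin μ.card)) (π := fun a => top a.1.1)
    (p := fun a => propEnum a.1 ∘ a.2) (fun a i j h => a.2.injective (propEnum_distinct _ _ _ h))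
    (fun a b h h' => by
      obtain ⟨w, σ⟩ := a
      obtain ⟨w', σ'⟩ := b
      have hw : w = w' := by
        refine symDiagram_ext h (σ := fun i => σ' (σ.symm i)) fun i => ?_
        simpa using h' (σ.symm i)
      subst hw
      refine Prod.ext rfl (Equiv.ext fun i => ?_)
      exact propEnum_distinct _ _ _ (h' i))
  rw [linearIndependent_iff'] at hli
  have hzero := hli ((e u).support ×ˢ Finset.univ) (fun a => ((e u) a.1).1.coeff a.2) (by
    rw [Finset.sum_product]
    exact hu)
  have heu : e u = 0 := by
    ext1 w
    by_contra hw
    refine hw (Subtype.ext (MonoidAlgebra.ext (Finsupp.ext fun τ => ?_)))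
    exact hzero (w, τ) (Finset.mem_product.2 ⟨Finsupp.mem_support_iff.2 hw, Finset.mem_univ τ⟩)
  exact e.map_eq_zero_iff.1 heu

open Classical in
/-- The twisted conjugation action of a diagram as a linear operator. -/
noncomputable def twistedOp (n : ℂ) (d : Diag (Fin k) (Fin k)) : SymModule k μ →ₗ[ℂ] SymModule k μ :=
  TensorProduct.lift (Finsupp.linearCombination ℂ fun w : SymDiagram k μ.card =>
    if h : IsSymDiagram μ.card (conj d w.1) then
      n ^ loops d w.1 • (TensorProduct.mk ℂ (SymDiagram k μ.card →₀ ℂ) (Specht μ)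
        (Finsupp.single ⟨conj d w.1, h⟩ 1) ∘ₗ
        (Algebra.lsmul ℂ ℂ (Specht μ)
          (MonoidAlgebra.of ℂ _ (twist d w ⟨conj d w.1, h⟩) : SymGroupAlgebra μ.card)))
    else 0)

theorem twistedOp_single_tmul (n : ℂ) (d : Diag (Fin k) (Fin k)) (w : SymDiagram k μ.card)
    (v : Specht μ) : twistedOp n d (Finsupp.single w 1 ⊗ₜ v) = twistedAction n d w v := by
  rw [twistedOp, TensorProduct.lift.tmul, Finsupp.linearCombination_single, one_smul, twistedAction]
  split_ifs with h
  · rfl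
  · rfl

theorem realization_twistedOp (hmn : 2 * μ.card ≤ n) (d : Diag (Fin k) (Fin k)) (u : SymModule k μ) :
    realization k n μ (twistedOp (n : ℂ) d u) = colourMap n d (realization k n μ u) := by
  have h : realization k n μ ∘ₗ twistedOp (n : ℂ) d = colourMap n d ∘ₗ realization k n μ := by
    refine symModule_hom_ext fun w v => ?_
    rw [LinearMap.comp_apply, LinearMap.comp_apply, twistedOp_single_tmul, realization_single_tmul,
      realizationAt_apply, map_sum, twistedAction]
    split_ifs with h
    · rw [map_smul, realization_single_tmul, realizationAt_smul, Finset.smul_sum]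
      refine Finset.sum_congr rfl fun τ _ => ?_
      rw [map_smul, colourMap_symDiagram h, smul_comm]
    · rw [map_zero]
      refine (Finset.sum_eq_zero fun τ _ => ?_).symm
      rw [map_smul, colourMap_symDiagram_eq_zero hmn h, smul_zero]
  exact LinearMap.congr_fun h u

theorem twistedOp_twistedOp (hn : 2 * k ≤ n) (hmn : 2 * μ.card ≤ n) (d₁ d₂ : Diag (Fin k) (Fin k))
    (u : SymModule k μ) : twistedOp (n : ℂ) d₁ (twistedOp (n : ℂ) d₂ u) =
      (n : ℂ) ^ loops d₁ d₂ • twistedOp (n : ℂ) (comp d₁ d₂) u := by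
  refine realization_injective hn ?_
  rw [realization_twistedOp hmn, realization_twistedOp hmn, colourMap_colourMap, map_smul,
    realization_twistedOp hmn]

theorem twistedOp_idDiag (hn : 2 * k ≤ n) (hmn : 2 * μ.card ≤ n) (u : SymModule k μ) :
    twistedOp (n : ℂ) (idDiag (Fin k)) u = u := by
  refine realization_injective hn ?_
  rw [realization_twistedOp hmn, colourMap_idDiag]

/-- Operators indexed by the diagrams that multiply as the diagrams do define a module over the
partition algebra. -/
theorem exists_module {n : ℂ} {X : Type} [AddCommGroup X] [Module ℂ X]
    (f : Diag (Fin k) (Fin k) → X →ₗ[ℂ] X) (h1 : ∀ x, f (idDiag (Fin k)) x = x)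
    (hmul : ∀ d₁ d₂ x, f d₁ (f d₂ x) = n ^ loops d₁ d₂ • f (comp d₁ d₂) x) :
    ∃ (_ : Module (PartitionAlgebra k n) X) (_ : IsScalarTower ℂ (PartitionAlgebra k n) X),
      ∀ d x, PartitionAlgebra.diagram n d • x = f d x := by
  let F : PartitionAlgebra k n →ₗ[ℂ] Module.End ℂ X := PartitionAlgebra.lift f
  have hF : ∀ d, F (PartitionAlgebra.diagram n d) = f d := PartitionAlgebra.lift_diagram f
  have hFmul : ∀ a b, F (a * b) = F a * F b := by
    have h : (LinearMap.mul ℂ (PartitionAlgebra k n)).compr₂ F =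
        (LinearMap.mul ℂ (Module.End ℂ X)).compl₁₂ F F := by
      refine PartitionAlgebra.hom_ext fun d₁ => PartitionAlgebra.hom_ext fun d₂ => ?_
      rw [LinearMap.compr₂_apply, LinearMap.compl₁₂_apply, LinearMap.mul_apply', LinearMap.mul_apply',
        PartitionAlgebra.diagram_mul, map_smul, hF, hF, hF]
      exact LinearMap.ext fun x => (hmul d₁ d₂ x).symm
    exact fun a b => LinearMap.congr_fun (LinearMap.congr_fun h a) b
  have hFone : F 1 = 1 := by
    rw [PartitionAlgebra.one_def, hF]
    exact LinearMap.ext h1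
  let A : PartitionAlgebra k n →+* Module.End ℂ X :=
    { toFun := F, map_one' := hFone, map_mul' := hFmul, map_zero' := map_zero F, map_add' := map_add F }
  let inst : Module (PartitionAlgebra k n) X := Module.compHom X A
  refine ⟨inst, ⟨fun r a x => ?_⟩, fun d x => ?_⟩
  · change F (r • a) x = r • F a x
    rw [map_smul, LinearMap.smul_apply]
  · change F _ x = f d x
    rw [hF]

end Realization

/-! ### Irreducibility -/

section Irreducibility

variable {k n : ℕ} {m : ℕ} {μ : YoungDiagram}

theorem pow_loops_ne_zero {γ : Type} [Finite γ] (hn : 2 * k ≤ n) (d : Diag (Fin k) (Fin k))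
    (d' : Diag (Fin k) γ) :
    (n : ℂ) ^ loops d d' ≠ 0 := by
  rcases Nat.eq_zero_or_pos k with rfl | hk
  · have h : loops d d' = 0 := by
      rw [loops, Set.ncard_eq_zero (Set.toFinite _), Set.eq_empty_iff_forall_notMem]
      intro c hc
      obtain ⟨x, -, hx⟩ := mem_inside.1 hc
      obtain ⟨b, -⟩ := hx x (Setoid.refl' _ x)
      exact b.elim0
    rw [h, pow_zero]
    exact one_ne_zero
  · exact pow_ne_zero _ (Nat.cast_ne_zero.2 (by omega))

/-- Components of the top row of a joined diagram: they are blocks of the upper diagram, or they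
are connected to the middle row. -/
theorem glue_oneLine_inl {d : Diag (Fin k) (Fin k)} {π : Setoid (Fin k)} {a : Fin k}
    {y : Fin k ⊕ Fin k ⊕ Empty} (h : glue d (oneLine π) (Sum.inl a) y) :
    (∃ b, y = Sum.inl b ∧ d (Sum.inl a) (Sum.inl b)) ∨ ∃ b, d (Sum.inl a) (Sum.inr b) := by
  rw [glue] at h
  rcases sup_map_rel _ _ _ h with h | ⟨b, b', h, -, -⟩
  · rcases (map_rel up_injective).1 h with rfl | ⟨u, v, hu, hv, huv⟩
    · exact Or.inl ⟨a, rfl, d.refl _⟩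
    · rcases u with u | u
      · obtain rfl : u = a := Sum.inl_injective hu
        rcases v with v | v
        · exact Or.inl ⟨v, hv.symm, huv⟩
        · exact Or.inr ⟨v, huv⟩
      · simp [up] at hu
  · rcases (map_rel up_injective).1 h with h | ⟨u, v, hu, hv, huv⟩
    · simp [down] at h
    · rcases u with u | u
      · obtain rfl : u = a := Sum.inl_injective hu
        rcases v with v | v
        · simp [up, down] at hv
        · exact Or.inr ⟨v, huv⟩
      · simp [up] at hu

theorem glue_oneLine_of_rel {d : Diag (Fin k) (Fin k)} {π : Setoid (Fin k)} {x y : Fin k ⊕ Fin k}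
    (h : d x y) : glue d (oneLine π) (up x) (up y) :=
  (le_sup_left : d.map up ≤ glue d (oneLine π)) (Setoid.le_comap_map h)

/-- Conjugation by a symmetric `m`-diagram `w` preserves the rank of a symmetric `m`-diagram only if
the result is `w`, because each of the `m` propagating blocks of `w` is connected to exactly one
marked block. -/
theorem conj_eq_self_of_isSymDiagram (w w' : SymDiagram k m) (h : IsSymDiagram m (conj w.1 w'.1)) :
    conj w.1 w'.1 = w.1 := by
  let W : SymDiagram k m := ⟨conj w.1 w'.1, h⟩
  set J := glue w.1 (oneLine (top w'.1)) with hJ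
  have hWJ : ∀ a b, top W.1 a b ↔ J (Sum.inl a) (Sum.inl b) := by
    intro a b
    have := top_conj w.1 w'
    change top (conj w.1 w'.1) a b ↔ _
    rw [this]
    rfl
  have hprop : ∀ i, ∃ j, top w.1 (propEnum W i) (propEnum w j) := by
    intro i
    have h1 : conj w.1 w'.1 (Sum.inl (propEnum W i)) (Sum.inr (propEnum W i)) := propEnum_inl_inr W i
    have hw' := congrArg (conj w.1) (eq_symOf w')
    rw [hw', conj_symOf, symOf_inl_inr] at h1
    obtain ⟨-, a, ⟨_, ⟨j, rfl⟩, h2⟩, h3⟩ := h1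
    have h4 : J (Sum.inl (propEnum W i)) (mid (propEnum w' j)) := J.trans h3 h2
    rcases glue_oneLine_inl h4 with ⟨b, hb, -⟩ | ⟨b, hb⟩
    · simp [mid] at hb
    · exact exists_propEnum w hb
  choose f hf using hprop
  have hdown : ∀ {a b}, top w.1 a b → J (Sum.inl a) (Sum.inl b) := fun {a b} hab =>
    glue_oneLine_of_rel (x := Sum.inl a) (y := Sum.inl b) hab
  have hinj : Function.Injective f := by
    intro i j hij
    refine propEnum_distinct W i j ((hWJ _ _).2 (J.trans (hdown (hf i)) ?_))
    rw [hij]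
    exact J.symm (hdown (hf j))
  have hsurj := Finite.surjective_of_injective hinj
  have htop : top W.1 = top w.1 := by
    refine Setoid.ext fun a b => (hWJ a b).trans ⟨fun hab => ?_, hdown⟩
    rcases glue_oneLine_inl hab with ⟨b', hb', h1⟩ | ⟨c, hc⟩
    · obtain rfl : b = b' := Sum.inl_injective hb'
      exact h1
    · rcases glue_oneLine_inl (J.symm hab) with ⟨a', ha', h1⟩ | ⟨c', hc'⟩
      · obtain rfl : a = a' := Sum.inl_injective ha'
        exact (top w.1).symm h1
      · obtain ⟨i, hi⟩ := exists_propEnum w hc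
        obtain ⟨i', hi'⟩ := exists_propEnum w hc'
        obtain ⟨j, rfl⟩ := hsurj i
        obtain ⟨j', rfl⟩ := hsurj i'
        have h2 : J (Sum.inl (propEnum W j)) (Sum.inl (propEnum W j')) :=
          J.trans (hdown ((top w.1).trans (hf j) ((top w.1).symm hi)))
            (J.trans hab (hdown ((top w.1).trans hi' ((top w.1).symm (hf j')))))
        have h3 := propEnum_distinct W j j' ((hWJ _ _).2 h2)
        subst h3
        exact (top w.1).trans hi ((top w.1).symm hi')
  exact congrArg Subtype.val (symDiagram_ext (w := W) (w' := w) htop (σ := f) fun i => by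
    rw [htop]
    exact hf i)

/-- A symmetric diagram reproduces the functions of its own marked top row up to a power of `n`. -/
theorem colourMap_self (w : SymDiagram k m) (τ : Equiv.Perm (Fin m)) :
    colourMap n w.1 (markedFunction n (top w.1) (propEnum w ∘ τ)) =
      (n : ℂ) ^ loops w.1 (oneLine (top w.1)) • markedFunction n (top w.1) (propEnum w ∘ τ) := by
  rw [colourMap_markedFunction (p := propEnum w ∘ τ) (q := propEnum w ∘ τ) w.1
    fun i => glue_oneLine_of_rel (x := Sum.inl _) (y := Sum.inr _) (propEnum_inl_inr w (τ i))]
  congr 2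
  -- folding both rows onto `Fin k` maps the components of the joined diagram into blocks of `top w`
  let f : Fin k ⊕ Fin k ⊕ Empty → Fin k := Sum.elim id (Sum.elim id Empty.elim)
  have hle : glue w.1 (oneLine (top w.1)) ≤ (top w.1).comap f := by
    rw [glue]
    refine sup_le ?_ ?_ <;> rw [map_le_iff]
    · intro x y h
      rw [eq_symOf w] at h
      have h1 := h.1
      rcases x with x | x <;> rcases y with y | y <;> exact h1
    · rintro (x | x) (y | y) h
      · exact h
      · exact y.elim
      · exact x.elim
      · exact x.elim
  refine Setoid.ext fun a b => ⟨fun h => ?_, fun h => ?_⟩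
  · have h1 : glue w.1 (oneLine (top w.1)) (Sum.inl a) (Sum.inl b) := h
    exact hle h1
  · exact glue_oneLine_of_rel (x := Sum.inl a) (y := Sum.inl b) h

theorem conj_markedFunction (π : Setoid (Fin k)) (p : Fin m → Fin k) (x : Fin k → Fin n) :
    (starRingEnd ℂ) (markedFunction n π p x) = markedFunction n π p x := by
  rw [markedFunction]
  split_ifs
  · rw [map_prod]
    refine Finset.prod_congr rfl fun i _ => ?_
    rw [colourSign]
    split_ifs <;> simp
  · exact map_zero _

/-- A non-zero vector is not orthogonal to all marked functions, since it is realized by a linear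
combination of them. -/
theorem exists_sum_markedFunction_mul_ne_zero (hn : 2 * k ≤ n) {u : SymModule k μ} (hu : u ≠ 0) :
    ∃ (w : SymDiagram k μ.card) (τ : Equiv.Perm (Fin μ.card)),
      ∑ x, markedFunction n (top w.1) (propEnum w ∘ τ) x * realization k n μ u x ≠ 0 := by
  by_contra hcon
  push Not at hcon
  let B : ColourSpace (Fin k) n →ₗ[ℂ] ℂ :=
    ∑ x, (starRingEnd ℂ) (realization k n μ u x) • LinearMap.proj x
  have hB : ∀ φ, B φ = ∑ x, (starRingEnd ℂ) (realization k n μ u x) * φ x := by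
    intro φ
    simp [B]
  have hzero : B ∘ₗ realization k n μ = 0 := by
    refine symModule_hom_ext fun w v => ?_
    rw [LinearMap.comp_apply, realization_single_tmul, realizationAt_apply, map_sum]
    refine Finset.sum_eq_zero fun τ _ => ?_
    have h1 := congrArg (starRingEnd ℂ) (hcon w τ)
    rw [map_sum, map_zero] at h1
    rw [map_smul, hB]
    have h2 : ∑ x, (starRingEnd ℂ) (realization k n μ u x) *
        markedFunction n (top w.1) (propEnum w ∘ τ) x = 0 := by
      rw [← h1]
      refine Finset.sum_congr rfl fun x _ => ?_
      rw [map_mul, conj_markedFunction, mul_comm]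
    rw [h2, smul_zero]
  have h1 := LinearMap.congr_fun hzero u
  rw [LinearMap.comp_apply, hB, LinearMap.zero_apply] at h1
  simp only [← Complex.normSq_eq_conj_mul_self] at h1
  have h2 : ∑ x, Complex.normSq (realization k n μ u x) = 0 := by exact_mod_cast h1
  refine hu (realization_injective hn ?_)
  rw [map_zero]
  funext x
  exact Complex.normSq_eq_zero.1
    ((Finset.sum_eq_zero_iff_of_nonneg fun _ _ => Complex.normSq_nonneg _).1 h2 x (Finset.mem_univ x))

/-- Some symmetric diagram `w` maps a given non-zero vector to a non-zero vector of the form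
`w ⊗ v`. -/
theorem exists_twistedOp_eq_tmul (hn : 2 * k ≤ n) (hmn : 2 * μ.card ≤ n) {u : SymModule k μ}
    (hu : u ≠ 0) : ∃ (w : SymDiagram k μ.card) (v : Specht μ), v ≠ 0 ∧
      twistedOp (n : ℂ) w.1 u = Finsupp.single w 1 ⊗ₜ v := by
  obtain ⟨w, τ, hw⟩ := exists_sum_markedFunction_mul_ne_zero hn hu
  have hrange : ∀ u : SymModule k μ, ∃ v : Specht μ,
      twistedOp (n : ℂ) w.1 u = Finsupp.single w 1 ⊗ₜ v := by
    intro u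
    induction u using symModule_induction with
    | zero => exact ⟨0, by rw [map_zero, TensorProduct.tmul_zero]⟩
    | add u u' hu hu' =>
      obtain ⟨v, hv⟩ := hu
      obtain ⟨v', hv'⟩ := hu'
      exact ⟨v + v', by rw [map_add, hv, hv', TensorProduct.tmul_add]⟩
    | tmul w' v =>
      rw [twistedOp_single_tmul, twistedAction]
      split_ifs with h
      · have hs : (⟨conj w.1 w'.1, h⟩ : SymDiagram k μ.card) = w :=
          Subtype.ext (conj_eq_self_of_isSymDiagram w w' h)
        have e : Finsupp.single (⟨conj w.1 w'.1, h⟩ : SymDiagram k μ.card) (1 : ℂ) =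
          Finsupp.single w 1 := by rw [hs]
        rw [e]
        exact ⟨_, (TensorProduct.tmul_smul (R := ℂ) _ _ _).symm⟩
      · exact ⟨0, by rw [TensorProduct.tmul_zero]⟩
  obtain ⟨v, hv⟩ := hrange u
  refine ⟨w, v, ?_, hv⟩
  rintro rfl
  rw [TensorProduct.tmul_zero] at hv
  have h1 := realization_twistedOp hmn w.1 u
  rw [hv, map_zero] at h1
  have h2 := sum_mul_colourMap_of_flip_eq w.2.1 (markedFunction n (top w.1) (propEnum w ∘ τ))
    (realization k n μ u)
  rw [← h1, colourMap_self] at h2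
  simp only [Pi.zero_apply, mul_zero, Finset.sum_const_zero, Pi.smul_apply, smul_eq_mul,
    mul_assoc, ← Finset.mul_sum] at h2
  rcases mul_eq_zero.1 h2.symm with h3 | h3
  · exact pow_loops_ne_zero hn _ _ h3
  · exact hw h3

/-- For any two symmetric `m`-diagrams and any permutation there is a diagram whose twisted
conjugation maps the first diagram to the second one with the given permutation. It connects the
propagating blocks of `w'` and `w` as prescribed; the other blocks of `w` may be merged in its bottom
row. -/
theorem exists_link (hn : 2 * k ≤ n) (hmn : 2 * μ.card ≤ n) (w w' : SymDiagram k μ.card)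
    (σ : Equiv.Perm (Fin μ.card)) : ∃ (d : Diag (Fin k) (Fin k)) (c : ℂ), c ≠ 0 ∧ ∀ v : Specht μ,
      twistedOp (n : ℂ) d (Finsupp.single w 1 ⊗ₜ v) =
        c • (Finsupp.single w' 1 ⊗ₜ (MonoidAlgebra.of ℂ _ σ • v)) := by
  classical
  let h : Fin k ⊕ Fin k → Option (Quotient (top w'.1)) :=
    Sum.elim (fun a => some (Quotient.mk _ a)) fun b =>
      if hb : ∃ i, top w.1 b (propEnum w i) then
        some (Quotient.mk _ (propEnum w' (σ hb.choose))) else none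
  have hmark : ∀ b i, top w.1 b (propEnum w i) →
      h (Sum.inr b) = some (Quotient.mk _ (propEnum w' (σ i))) := by
    intro b i hbi
    have hb : ∃ i, top w.1 b (propEnum w i) := ⟨i, hbi⟩
    have hi : hb.choose = i :=
      propEnum_distinct w _ _ ((top w.1).trans ((top w.1).symm hb.choose_spec) hbi)
    simp only [h, Sum.elim_inr, dif_pos hb, hi]
  let d : Diag (Fin k) (Fin k) := Setoid.ker h
  have hle : glue d (oneLine (top w.1)) ≤
      Setoid.ker (Sum.elim (h ∘ Sum.inl) (Sum.elim (h ∘ Sum.inr) Empty.elim)) := by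
    rw [glue]
    refine sup_le ?_ ?_ <;> rw [map_le_iff]
    · rintro (x | x) (y | y) hxy <;> exact hxy
    · rintro (x | x) (y | y) hxy
      · change h (Sum.inr x) = h (Sum.inr y)
        have hxy' : top w.1 x y := hxy
        by_cases hx : ∃ i, top w.1 x (propEnum w i)
        · obtain ⟨i, hi⟩ := hx
          rw [hmark x i hi, hmark y i ((top w.1).trans ((top w.1).symm hxy') hi)]
        · have hy : ¬ ∃ i, top w.1 y (propEnum w i) := fun ⟨i, hi⟩ =>
            hx ⟨i, (top w.1).trans hxy' hi⟩
          simp only [h, Sum.elim_inr, dif_neg hx, dif_neg hy]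
      · exact y.elim
      · exact x.elim
      · exact x.elim
  have htop : top (comp d (oneLine (top w.1))) = top w'.1 := by
    refine Setoid.ext fun a b => ⟨fun hab => ?_, fun hab => ?_⟩
    · have h1 : glue d (oneLine (top w.1)) (Sum.inl a) (Sum.inl b) := hab
      have h2 : h (Sum.inl a) = h (Sum.inl b) := hle h1
      exact Quotient.exact (Option.some_injective _ h2)
    · refine glue_oneLine_of_rel (x := Sum.inl a) (y := Sum.inl b) ?_
      exact congrArg some (Quotient.sound hab)
  refine ⟨d, _, pow_loops_ne_zero hn d (oneLine (top w.1)), fun v => realization_injective hn ?_⟩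
  rw [realization_twistedOp hmn, map_smul, realization_single_tmul, realization_single_tmul,
    realizationAt_smul, realizationAt_apply, map_sum, Finset.smul_sum]
  refine Finset.sum_congr rfl fun τ _ => ?_
  rw [map_smul, colourMap_markedFunction (p := propEnum w ∘ τ) (q := propEnum w' ∘ ⇑(σ * τ)) d,
    htop, smul_comm]
  intro i
  refine glue_oneLine_of_rel (x := Sum.inl _) (y := Sum.inr _) ?_
  exact (hmark _ (τ i) ((top w.1).refl _)).symm

theorem single_tmul_ne_zero (w : SymDiagram k μ.card) {v : Specht μ} (hv : v ≠ 0) :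
    (Finsupp.single w (1 : ℂ) ⊗ₜ[ℂ] v : SymModule k μ) ≠ 0 := by
  classical
  intro h
  have h1 := congrArg (TensorProduct.finsuppScalarLeft ℂ (Specht μ) (SymDiagram k μ.card)) h
  rw [TensorProduct.finsuppScalarLeft_apply_tmul, Finsupp.sum_single_index (by simp), one_smul,
    map_zero] at h1
  exact hv (Finsupp.single_eq_zero.1 h1)

theorem isSimpleModule_symModule (hn : 2 * k ≤ n) (hk : μ.card ≤ k)
    [Module (PartitionAlgebra k n) (SymModule k μ)]
    [IsScalarTower ℂ (PartitionAlgebra k n) (SymModule k μ)]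
    (hact : ∀ d (x : SymModule k μ), PartitionAlgebra.diagram (n : ℂ) d • x = twistedOp (n : ℂ) d x) :
    IsSimpleModule (PartitionAlgebra k n) (SymModule k μ) := by
  have hmn : 2 * μ.card ≤ n := by omega
  have hw₀ : Nonempty (SymDiagram k μ.card) :=
    ⟨mkSym ⊥ (Fin.castLE hk) fun i j h => Fin.castLE_injective hk h⟩
  obtain ⟨w₀⟩ := hw₀
  have hnt : Nontrivial (SymModule k μ) := by
    refine ⟨_, 0, single_tmul_ne_zero w₀ (v := ⟨_, youngSymmetrizer_mem μ⟩) fun h => ?_⟩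
    exact youngSymmetrizer_ne_zero μ (congrArg Subtype.val h)
  rw [isSimpleModule_iff]
  refine { exists_pair_ne := ⟨⊥, ⊤, bot_ne_top⟩, eq_bot_or_eq_top := fun U => ?_ }
  by_cases hU : U = ⊥
  · exact Or.inl hU
  right
  obtain ⟨u, huU, hu⟩ := U.ne_bot_iff.1 hU
  obtain ⟨w, v, hv, he⟩ := exists_twistedOp_eq_tmul hn hmn hu
  have hwv : (Finsupp.single w 1 ⊗ₜ v : SymModule k μ) ∈ U := by
    rw [← he, ← hact]
    exact U.smul_mem _ huU
  have hperm : ∀ (w' : SymDiagram k μ.card) (x : SymGroupAlgebra μ.card),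
      (Finsupp.single w' 1 ⊗ₜ (x • v) : SymModule k μ) ∈ U := by
    intro w' x
    induction x using MonoidAlgebra.induction_on with
    | of σ =>
      obtain ⟨d, c, hc, hd⟩ := exists_link hn hmn w w' σ
      have h1 := U.smul_mem (PartitionAlgebra.diagram (n : ℂ) d) hwv
      rw [hact, hd] at h1
      have h2 := U.smul_of_tower_mem c⁻¹ h1
      rwa [smul_smul, inv_mul_cancel₀ hc, one_smul] at h2
    | add x y hx hy =>
      rw [add_smul, TensorProduct.tmul_add]
      exact U.add_mem hx hy
    | smul r x hx =>
      rw [smul_assoc, TensorProduct.tmul_smul]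
      exact U.smul_of_tower_mem r hx
  rw [eq_top_iff]
  rintro y -
  induction y using symModule_induction with
  | zero => exact U.zero_mem
  | add x y hx hy => exact U.add_mem hx hy
  | tmul w' v' =>
    obtain ⟨x, hx⟩ := exists_mul_eq_of_mem_specht v.2 (fun h => hv (Subtype.ext h)) v'.2
    have h1 := hperm w' x
    have h2 : x • v = v' := Subtype.ext hx
    rwa [h2] at h1

end Irreducibility

/-! ### Constructing set-partition tableaux -/

section ClassMax

variable {k : ℕ}

open Classical in
/-- The maximal entry of the block of `a`. -/
noncomputable def classMax (π : Setoid (Fin k)) (a : Fin k) : Fin k :=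
  (Finset.univ.filter fun x => π x a).max' ⟨a, by simp⟩

open Classical in
theorem classMax_rel (π : Setoid (Fin k)) (a : Fin k) : π (classMax π a) a := by
  have h : classMax π a ∈ Finset.univ.filter fun x => π x a := Finset.max'_mem _ _
  exact (Finset.mem_filter.1 h).2

theorem le_classMax {π : Setoid (Fin k)} {a x : Fin k} (h : π x a) : x ≤ classMax π a := by
  classical
  exact Finset.le_max' _ _ (by simpa using h)

theorem classMax_eq {π : Setoid (Fin k)} {a b : Fin k} (h : π a b) : classMax π a = classMax π b :=
  le_antisymm (le_classMax (π.trans (classMax_rel π a) h))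
    (le_classMax (π.trans (classMax_rel π b) (π.symm h)))

theorem classMax_classMax (π : Setoid (Fin k)) (a : Fin k) :
    classMax π (classMax π a) = classMax π a := classMax_eq (classMax_rel π a)

theorem rel_of_classMax_eq {π : Setoid (Fin k)} {a b : Fin k} (h : classMax π a = classMax π b) :
    π a b :=
  π.trans (π.symm (classMax_rel π a)) (h ▸ classMax_rel π b)

/-- Blocks are counted by their maximal entries. -/
theorem ncard_classes (π : Setoid (Fin k)) :
    π.classes.ncard = (Finset.univ.filter fun a => classMax π a = a).card := by
  have h : π.classes = (fun a => {x | π x a}) '' {a | classMax π a = a} := by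
    ext c
    constructor
    · rintro ⟨a, rfl⟩
      refine ⟨classMax π a, classMax_classMax π a, ?_⟩
      ext x
      exact ⟨fun hx => π.trans hx (classMax_rel π a), fun hx => π.trans hx (π.symm (classMax_rel π a))⟩
    · rintro ⟨a, -, rfl⟩
      exact ⟨a, rfl⟩
  rw [h, Set.InjOn.ncard_image, ← Set.ncard_coe_finset]
  · congr 1
    ext a
    simp
  · intro a ha b hb hab
    have h1 : π a b := (Set.ext_iff.1 hab a).1 (π.refl a)
    exact ha.symm.trans ((classMax_eq h1).trans hb)

theorem ncard_classes_le (π : Setoid (Fin k)) : π.classes.ncard ≤ k := by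
  rw [ncard_classes]
  simpa using Finset.card_filter_le (Finset.univ : Finset (Fin k)) fun a => classMax π a = a

end ClassMax

section Shape

variable {lam : YoungDiagram}

theorem card_eq_rowLen_add (lam : YoungDiagram) :
    lam.card = lam.rowLen 0 + (removeFirstRow lam).card := by
  have h := Finset.card_filter_add_card_filter_not (s := lam.cells) fun c => c.1 = 0
  rw [YoungDiagram.rowLen_eq_card, YoungDiagram.card, YoungDiagram.card, ← h]
  congr 1
  rw [removeFirstRow, Finset.card_image_of_injOn]
  · congr 1
    ext c
    simp only [Finset.mem_filter, Nat.one_le_iff_ne_zero]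
  · rintro ⟨a, b⟩ h1 ⟨a', b'⟩ h2 h3
    simp only [Finset.coe_filter, Set.mem_ofPred_eq] at h1 h2
    simp only [Prod.mk.injEq] at h3 ⊢
    omega

/-- The columns of `λ*` do not exceed its size. -/
theorem col_lt_card {μ : YoungDiagram} {i j : ℕ} (h : (i, j) ∈ μ) : j < μ.card := by
  have h1 : ((Finset.range (j + 1)).image fun b => ((i, b) : ℕ × ℕ)) ⊆ μ.cells := by
    intro c hc
    obtain ⟨b, hb, rfl⟩ := Finset.mem_image.1 hc
    exact μ.up_left_mem le_rfl (Nat.lt_succ_iff.1 (Finset.mem_range.1 hb)) h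
  have h2 := Finset.card_le_card h1
  rw [Finset.card_image_of_injective _ (fun a b h => (Prod.ext_iff.1 h).2), Finset.card_range] at h2
  exact h2

/-- The cell of `λ` below the first row that carries the entry `i` of the column-reading tableau
of `λ*`. -/
noncomputable def lowerCell (lam : YoungDiagram) (i : Fin (removeFirstRow lam).card) : ℕ × ℕ :=
  ((columnTableau (removeFirstRow lam) i).1 + 1, (columnTableau (removeFirstRow lam) i).2)

theorem lowerCell_mem (i : Fin (removeFirstRow lam).card) (t : ℕ) :
    lowerCell lam i ∈ skewCells lam t :=
  ⟨mem_removeFirstRow.1 (columnTableau_mem i), fun h => by simp [lowerCell] at h⟩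

theorem lowerCell_injective : Function.Injective (lowerCell lam) := by
  intro i j h
  simp only [lowerCell, Prod.mk.injEq, Nat.add_right_cancel_iff] at h
  exact eq_of_rowOf_colOf i j h.1 h.2

theorem exists_lowerCell {i j : ℕ} (h : (i + 1, j) ∈ lam) : ∃ a, lowerCell lam a = (i + 1, j) := by
  obtain ⟨a, ha⟩ := exists_columnTableau_eq (mem_removeFirstRow.2 h)
  exact ⟨a, by rw [lowerCell, ha]⟩

end Shape

namespace SPTableau

variable {lam : YoungDiagram} {k : ℕ}

/-- A set-partition tableau is given by a set partition and the choice of the blocks below the first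
row; the remaining blocks fill the first row in increasing order. -/
theorem exists_box (hn : 2 * k ≤ lam.card) (π : Setoid (Fin k))
    {p : Fin (removeFirstRow lam).card → Fin k} (hp : ∀ i j, π (p i) (p j) → i = j) :
    ∃ T : SPTableau lam k, T.content = π ∧ (∀ i, T.box (lowerCell lam i) = {x | π x (p i)}) ∧
      T.FirstRowIncreasing := by
  classical
  set A : Finset (Fin k) := Finset.univ.filter fun a => classMax π a = a with hA
  set B : Finset (Fin k) := Finset.univ.image fun i => classMax π (p i) with hB
  have ht : π.classes.ncard = A.card := ncard_classes π
  have hBA : B ⊆ A := by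
    intro a ha
    obtain ⟨i, -, rfl⟩ := Finset.mem_image.1 ha
    simpa [hA] using classMax_classMax π (p i)
  have hBc : B.card = (removeFirstRow lam).card := by
    rw [hB, Finset.card_image_of_injective, Finset.card_univ, Fintype.card_fin]
    exact fun i j h => hp i j (rel_of_classMax_eq h)
  have hmt : (removeFirstRow lam).card ≤ A.card := hBc ▸ Finset.card_le_card hBA
  have htk : A.card ≤ k := ht ▸ ncard_classes_le π
  have hMc : (A \ B).card = A.card - (removeFirstRow lam).card := by
    rw [Finset.card_sdiff_of_subset hBA, hBc]
  let e := (A \ B).orderEmbOfFin hMc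
  have heA : ∀ s, classMax π (e s) = e s ∧ ∀ i, ¬ π (e s) (p i) := by
    intro s
    have h := Finset.mem_sdiff.1 (Finset.orderEmbOfFin_mem (A \ B) hMc s)
    have h1 : classMax π (e s) = e s := (Finset.mem_filter.1 h.1).2
    refine ⟨h1, fun i hi => h.2 (Finset.mem_image.2 ⟨i, Finset.mem_univ _, ?_⟩)⟩
    rw [← classMax_eq hi]
    exact h1
  have hlen := card_eq_rowLen_add lam
  let box : ℕ × ℕ → Set (Fin k)
    | (0, j) => if h : lam.card - A.card ≤ j ∧ j < lam.rowLen 0 then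
        {x | π x (e ⟨j - (lam.card - A.card), by omega⟩)} else ∅
    | (i + 1, j) => if h : (i, j) ∈ (removeFirstRow lam).cells then
        {x | π x (p ((cellEquiv _).symm ⟨(i, j), h⟩))} else ∅
  have hcells0 : ∀ j, (0, j) ∈ skewCells lam A.card ↔
      lam.card - A.card ≤ j ∧ j < lam.rowLen 0 := by
    intro j
    rw [← YoungDiagram.mem_iff_lt_rowLen]
    exact ⟨fun h => ⟨h.2 rfl, h.1⟩, fun h => ⟨h.2, fun _ => h.1⟩⟩
  have hcells1 : ∀ i j, (i + 1, j) ∈ skewCells lam A.card ↔ (i, j) ∈ (removeFirstRow lam).cells := by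
    intro i j
    rw [YoungDiagram.mem_cells, mem_removeFirstRow]
    exact ⟨fun h => h.1, fun h => ⟨h, fun h0 => by simp at h0⟩⟩
  have hbox0 : ∀ j (h : lam.card - A.card ≤ j ∧ j < lam.rowLen 0),
      box (0, j) = {x | π x (e ⟨j - (lam.card - A.card), by omega⟩)} := fun j h => dif_pos h
  have hbox1 : ∀ i j (h : (i, j) ∈ (removeFirstRow lam).cells),
      box (i + 1, j) = {x | π x (p ((cellEquiv _).symm ⟨(i, j), h⟩))} := fun i j h => dif_pos h
  have hlow : ∀ i, box (lowerCell lam i) = {x | π x (p i)} := by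
    intro i
    refine (hbox1 _ _ (columnTableau_mem i)).trans ?_
    have h : (cellEquiv _).symm ⟨columnTableau (removeFirstRow lam) i, columnTableau_mem i⟩ = i :=
      (cellEquiv _).symm_apply_apply i
    exact congrArg (fun i => {x | π x (p i)}) h
  have hbij : Set.BijOn box (skewCells lam A.card) π.classes := by
    refine ⟨?_, ?_, ?_⟩
    · rintro ⟨_ | i, j⟩ hc
      · rw [hbox0 _ ((hcells0 j).1 hc)]
        exact ⟨_, rfl⟩
      · rw [hbox1 _ _ ((hcells1 i j).1 hc)]
        exact ⟨_, rfl⟩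
    · have hrel : ∀ {a b : Fin k}, ({x | π x a} : Set (Fin k)) = {x | π x b} → π a b := by
        intro a b h
        have h1 : a ∈ {x | π x b} := h ▸ π.refl a
        exact h1
      rintro ⟨_ | i, j⟩ hc ⟨_ | i', j'⟩ hc' h
      · have h1 := (hcells0 j).1 hc
        have h2 := (hcells0 j').1 hc'
        rw [hbox0 _ h1, hbox0 _ h2] at h
        have h3 := classMax_eq (hrel h)
        rw [(heA _).1, (heA _).1] at h3
        have h4 := congrArg Fin.val (e.injective h3)
        simp only at h4
        rw [Prod.mk.injEq]
        omega
      · rw [hbox0 _ ((hcells0 j).1 hc), hbox1 _ _ ((hcells1 i' j').1 hc')] at h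
        exact absurd (hrel h) ((heA _).2 _)
      · rw [hbox1 _ _ ((hcells1 i j).1 hc), hbox0 _ ((hcells0 j').1 hc')] at h
        exact absurd (π.symm (hrel h)) ((heA _).2 _)
      · rw [hbox1 _ _ ((hcells1 i j).1 hc), hbox1 _ _ ((hcells1 i' j').1 hc')] at h
        have h1 := congrArg Subtype.val ((cellEquiv _).symm.injective (hp _ _ (hrel h)))
        simp only [Prod.mk.injEq] at h1 ⊢
        omega
    · rintro _ ⟨a, rfl⟩
      by_cases ha : ∃ i, π a (p i)
      · obtain ⟨i, hi⟩ := ha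
        refine ⟨lowerCell lam i, lowerCell_mem i _, ?_⟩
        rw [hlow]
        ext x
        exact ⟨fun hx => π.trans hx (π.symm hi), fun hx => π.trans hx hi⟩
      · have h1 : classMax π a ∈ A \ B := by
          refine Finset.mem_sdiff.2 ⟨by simpa [hA] using classMax_classMax π a, fun h => ha ?_⟩
          obtain ⟨i, -, hi⟩ := Finset.mem_image.1 h
          exact ⟨i, rel_of_classMax_eq hi.symm⟩
        have h2 : classMax π a ∈ Set.range e := by
          rw [Finset.range_orderEmbOfFin]
          exact h1
        obtain ⟨s, hs⟩ := h2
        have hs' := s.2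
        have h3 : lam.card - A.card ≤ s + (lam.card - A.card) ∧
            s + (lam.card - A.card) < lam.rowLen 0 := by omega
        refine ⟨(0, s + (lam.card - A.card)), (hcells0 _).2 h3, ?_⟩
        rw [hbox0 _ h3]
        have h4 : (⟨s + (lam.card - A.card) - (lam.card - A.card), by omega⟩ :
            Fin (A.card - _)) = s := Fin.ext (by simp)
        rw [h4, hs]
        ext x
        exact ⟨fun hx => π.trans hx (classMax_rel π a), fun hx => π.trans hx (π.symm (classMax_rel π a))⟩
  refine ⟨⟨π, by rw [ht]; exact hmt, by rw [ht]; omega, box, by rw [ht]; exact hbij, ?_⟩, rfl, hlow, ?_⟩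
  · rintro ⟨_ | i, j⟩ hc
    · rw [ht, hcells0] at hc
      exact dif_neg hc
    · rw [ht, hcells1] at hc
      exact dif_neg hc
  · intro j j' hjj hj hj'
    have h1 := (hcells0 j).1 (ht ▸ hj)
    have h2 := (hcells0 j').1 (ht ▸ hj')
    change MaxLT (box (0, j)) (box (0, j'))
    rw [hbox0 _ h1, hbox0 _ h2]
    refine ⟨_, π.refl _, fun a ha => lt_of_le_of_lt (le_classMax ha) ?_⟩
    rw [(heA _).1]
    refine e.strictMono ?_
    rw [Fin.mk_lt_mk]
    omega

/-! ### The symmetric diagram and the permutation of a tableau -/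

variable (T : SPTableau lam k)

theorem exists_mark (i : Fin (removeFirstRow lam).card) :
    ∃ a ∈ T.box (lowerCell lam i), ∀ b ∈ T.box (lowerCell lam i), b ≤ a := by
  obtain ⟨a, ha⟩ := T.bijOn.mapsTo (lowerCell_mem i _)
  rw [ha]
  exact ⟨_, classMax_rel T.content a, fun b hb => le_classMax hb⟩

/-- The maximal entry of a propagating block of a tableau; the propagating blocks are numbered by
the column-reading tableau of `λ*`. -/
noncomputable def mark (i : Fin (removeFirstRow lam).card) : Fin k := (T.exists_mark i).choose

theorem mark_mem (i : Fin (removeFirstRow lam).card) : T.mark i ∈ T.box (lowerCell lam i) :=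
  (T.exists_mark i).choose_spec.1

theorem le_mark {i : Fin (removeFirstRow lam).card} {b : Fin k} (h : b ∈ T.box (lowerCell lam i)) :
    b ≤ T.mark i :=
  (T.exists_mark i).choose_spec.2 b h

variable {T} in
theorem mark_eq {i : Fin (removeFirstRow lam).card} {a : Fin k} (h : a ∈ T.box (lowerCell lam i))
    (h' : ∀ b ∈ T.box (lowerCell lam i), b ≤ a) : T.mark i = a :=
  le_antisymm (h' _ (T.mark_mem i)) (T.le_mark h)

theorem box_lowerCell (i : Fin (removeFirstRow lam).card) :
    T.box (lowerCell lam i) = {x | T.content x (T.mark i)} := by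
  have h := T.mark_mem i
  obtain ⟨a, ha⟩ := T.bijOn.mapsTo (lowerCell_mem i _)
  rw [ha] at h ⊢
  ext x
  exact ⟨fun hx => T.content.trans hx (T.content.symm h), fun hx => T.content.trans hx h⟩

theorem mark_distinct (i j : Fin (removeFirstRow lam).card) (h : T.content (T.mark i) (T.mark j)) :
    i = j := by
  refine lowerCell_injective (T.bijOn.injOn (lowerCell_mem i _) (lowerCell_mem j _) ?_)
  rw [box_lowerCell, box_lowerCell]
  ext x
  exact ⟨fun hx => T.content.trans hx h, fun hx => T.content.trans hx (T.content.symm h)⟩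

/-- The symmetric diagram of a tableau: both rows carry the content, and the blocks below the first
row are connected to their mirror images. -/
noncomputable def sym : SymDiagram k (removeFirstRow lam).card :=
  mkSym T.content T.mark T.mark_distinct

theorem top_sym : top T.sym.1 = T.content := top_mkSym _ _ _

theorem exists_perm : ∃ σ : Equiv.Perm (Fin (removeFirstRow lam).card),
    ∀ i, propEnum T.sym (σ i) = T.mark i := by
  obtain ⟨σ, hσ⟩ := exists_perm_propEnum T.sym (q := T.mark)
    (fun i j h => T.mark_distinct i j (T.top_sym ▸ h)) fun i =>
      ⟨T.mark i, symOf_inl_inr.2 ⟨T.content.refl _, _, ⟨i, rfl⟩, T.content.refl _⟩⟩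
  refine ⟨σ, fun i => le_antisymm (T.le_mark ?_) (le_propEnum _ (hσ i))⟩
  have h := T.sym.1.symm (hσ i)
  rw [box_lowerCell, ← T.top_sym]
  exact h

/-- The permutation of a tableau: the entry `i` of the column-reading tableau is replaced with the
position, in max-entry order, of the propagating block in its cell. -/
noncomputable def perm : Equiv.Perm (Fin (removeFirstRow lam).card) := T.exists_perm.choose

theorem propEnum_perm (i : Fin (removeFirstRow lam).card) :
    propEnum T.sym (T.perm i) = T.mark i := T.exists_perm.choose_spec i

theorem maxLT_lowerCell_iff {i j : Fin (removeFirstRow lam).card} :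
    MaxLT (T.box (lowerCell lam i)) (T.box (lowerCell lam j)) ↔ T.perm i < T.perm j := by
  rw [← (propEnum T.sym).lt_iff_lt, propEnum_perm, propEnum_perm]
  constructor
  · rintro ⟨b, hb, h⟩
    exact (h _ (T.mark_mem i)).trans_le (T.le_mark hb)
  · intro h
    exact ⟨_, T.mark_mem j, fun a ha => (T.le_mark ha).trans_lt h⟩

/-- A cell of the first row is never above a cell of `λ*`. -/
theorem not_mem_lower (hn : 2 * k ≤ lam.card) (hk : (removeFirstRow lam).card ≤ k) {i j : ℕ}
    (h : (0, j) ∈ T.cells) (h' : (i + 1, j) ∈ lam) : False := by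
  have h1 := h.2 rfl
  have h2 := col_lt_card (mem_removeFirstRow.2 h')
  have h3 := ncard_classes_le T.content
  simp only at h1
  omega

/-- A tableau with increasing first row is standard if and only if its permutation is. -/
theorem isStandard_iff (hn : 2 * k ≤ lam.card) (hk : (removeFirstRow lam).card ≤ k)
    (hT : T.FirstRowIncreasing) : T.IsStandard ↔
      IsStandardFilling (rowOf (removeFirstRow lam)) (colOf (removeFirstRow lam))
        fun i => (T.perm i : ℕ) := by
  constructor
  · rintro ⟨h1, h2⟩
    refine ⟨fun i j hij hlt => T.maxLT_lowerCell_iff.1 ?_, fun i j hij hlt => T.maxLT_lowerCell_iff.1 ?_⟩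
    · have h3 := h1 (rowOf _ i + 1) _ _ hlt (lowerCell_mem i _) (hij ▸ lowerCell_mem j _)
      have h4 : lowerCell lam j = (rowOf _ i + 1, colOf _ j) := by rw [hij]; rfl
      rw [h4]
      exact h3
    · have h3 := h2 _ _ (colOf _ i) (Nat.add_lt_add_right hlt 1) (lowerCell_mem i _)
        (hij ▸ lowerCell_mem j _)
      have h4 : lowerCell lam j = (rowOf _ j + 1, colOf _ i) := by rw [hij]; rfl
      rw [h4]
      exact h3
  · rintro ⟨h1, h2⟩
    constructor
    · rintro (_ | i) j j' hjj hj hj'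
      · exact hT j j' hjj hj hj'
      · obtain ⟨a, ha⟩ := exists_lowerCell hj.1
        obtain ⟨b, hb⟩ := exists_lowerCell hj'.1
        rw [← ha, ← hb, T.maxLT_lowerCell_iff]
        simp only [lowerCell, Prod.mk.injEq, Nat.add_right_cancel_iff] at ha hb
        refine h1 a b (ha.1.trans hb.1.symm) ?_
        rw [colOf, colOf, ha.2, hb.2]
        exact hjj
    · rintro (_ | i) (_ | i') j hii hi hi'
      · omega
      · exact (T.not_mem_lower hn hk hi hi'.1).elim
      · omega
      · obtain ⟨a, ha⟩ := exists_lowerCell hi.1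
        obtain ⟨b, hb⟩ := exists_lowerCell hi'.1
        rw [← ha, ← hb, T.maxLT_lowerCell_iff]
        simp only [lowerCell, Prod.mk.injEq, Nat.add_right_cancel_iff] at ha hb
        refine h2 a b (ha.2.trans hb.2.symm) ?_
        rw [rowOf, rowOf, ha.1, hb.1]
        omega

/-! ### Permuting the blocks of a tableau -/

variable (g : Equiv.Perm (removeFirstRow lam).cells)

theorem lowerPerm_lowerCell (i : Fin (removeFirstRow lam).card) :
    lowerPerm g (lowerCell lam i) = lowerCell lam ((cellEquiv _).symm.permCongr g i) := by
  have h : columnTableau (removeFirstRow lam) ((cellEquiv _).symm.permCongr g i) =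
      (g (cellEquiv _ i)).1 := by
    rw [Equiv.permCongr_apply, columnTableau_cellEquiv_symm, Equiv.symm_symm]
  rw [lowerCell, lowerCell, h]
  simp only [lowerPerm]
  rw [Equiv.Perm.ofSubtype_apply_of_mem g (columnTableau_mem i)]
  rfl

theorem mark_permute (i : Fin (removeFirstRow lam).card) :
    (T.permute g).mark i = T.mark ((cellEquiv _).symm.permCongr g i) := by
  have h : (T.permute g).box (lowerCell lam i) =
      T.box (lowerCell lam ((cellEquiv _).symm.permCongr g i)) := by
    rw [← lowerPerm_lowerCell]
    rfl
  refine mark_eq ?_ ?_ <;> rw [h]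
  · exact T.mark_mem _
  · exact fun b hb => T.le_mark hb

theorem sym_permute : (T.permute g).sym = T.sym := by
  refine Subtype.ext ?_
  have h : Set.range (T.permute g).mark = Set.range T.mark := by
    rw [funext (T.mark_permute g)]
    exact ((cellEquiv _).symm.permCongr g).surjective.range_comp T.mark
  exact congrArg (symOf T.content) h

theorem perm_permute : (T.permute g).perm = T.perm * (cellEquiv _).symm.permCongr g := by
  refine Equiv.ext fun i => (propEnum T.sym).injective ?_
  have h := (T.permute g).propEnum_perm i
  rw [sym_permute, mark_permute] at h
  rw [h, Equiv.Perm.mul_apply, propEnum_perm]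

end SPTableau

/-! ### Column and Garnir relations for functions of tableaux -/

section Relations

variable {lam : YoungDiagram} {k : ℕ}

open Classical in
/-- The column relations and the Garnir relations for a function of set-partition tableaux with
values in an arbitrary vector space. -/
structure SatisfiesGarnir {V : Type*} [AddCommGroup V] [Module ℂ V] (N : SPTbar lam k → V) :
    Prop where
  column : ∀ (T : SPTbar lam k) (g : Equiv.Perm (removeFirstRow lam).cells),
    (∀ c, (g c).1.2 = c.1.2) → N (T.permute g) = ((Equiv.Perm.sign g : ℤ) : ℂ) • N T
  garnir : ∀ (T : SPTbar lam k) (i j : ℕ), (i, j + 1) ∈ removeFirstRow lam →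
    ∑ g : Equiv.Perm (removeFirstRow lam).cells with ∀ c, ¬ GarnirBelt i j c.1 → g c = c,
      ((Equiv.Perm.sign g : ℤ) : ℂ) • N (T.permute g) = 0

theorem IsStraightening.satisfiesGarnir {N : SPTbar lam k → NaturalModule lam k}
    (h : IsStraightening N) : SatisfiesGarnir N := ⟨h.column, h.garnir⟩

variable {V : Type*} [AddCommGroup V] [Module ℂ V] {N N' : SPTbar lam k → V}

theorem SatisfiesGarnir.sub (h : SatisfiesGarnir N) (h' : SatisfiesGarnir N') :
    SatisfiesGarnir fun T => N T - N' T where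
  column T g hg := by rw [h.column T g hg, h'.column T g hg, smul_sub]
  garnir T i j hij := by
    simp only [smul_sub, Finset.sum_sub_distrib]
    rw [h.garnir T i j hij, h'.garnir T i j hij, sub_zero]

theorem SatisfiesGarnir.map {V' : Type*} [AddCommGroup V'] [Module ℂ V'] (h : SatisfiesGarnir N)
    (f : V →ₗ[ℂ] V') : SatisfiesGarnir fun T => f (N T) where
  column T g hg := by rw [h.column T g hg, map_smul]
  garnir T i j hij := by
    rw [← map_zero f, ← h.garnir T i j hij, map_sum]
    exact Finset.sum_congr rfl fun g _ => (map_smul f _ _).symm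

theorem SPTbar.permute_mul (T : SPTbar lam k) (g h : Equiv.Perm (removeFirstRow lam).cells) :
    (T.permute g).permute h = T.permute (g * h) := by
  refine Subtype.ext (SPTableau.ext rfl (funext fun c => ?_))
  exact congrArg T.1.box (SPTableau.lowerPerm_lowerPerm g h c)

theorem SPTbar.permute_one (T : SPTbar lam k) : T.permute 1 = T :=
  Subtype.ext (SPTableau.ext rfl (funext fun c => congrArg T.1.box (SPTableau.lowerPerm_one c)))

/-- The values of a function that satisfies the relations are integral linear combinations of
its values at the standard tableaux. -/
theorem SatisfiesGarnir.mem_of_standard (hn : 2 * k ≤ lam.card) (hk : (removeFirstRow lam).card ≤ k)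
    (h : SatisfiesGarnir N) (P : AddSubgroup V)
    (hP : ∀ T : SSPT lam k, N ⟨T.1, T.2.firstRowIncreasing⟩ ∈ P) (T : SPTbar lam k) : N T ∈ P := by
  classical
  let v : (removeFirstRow lam).cells → ℕ := fun c => (T.1.perm ((cellEquiv _).symm c) : ℕ)
  have hv : Function.Injective v := fun c c' hc =>
    (cellEquiv _).symm.injective (T.1.perm.injective (Fin.ext hc))
  have h1 := straightening hv (F := fun g => N (T.permute g))
    (fun g g' hg' => by
      rw [← SPTbar.permute_mul]
      exact h.column _ _ hg')
    (fun g i j hij => by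
      simp only [← SPTbar.permute_mul]
      exact (h.garnir (T.permute g) i j hij :)) P ?_ 1
  · rwa [SPTbar.permute_one] at h1
  · intro g hg
    have hstd : (T.permute g).1.IsStandard := by
      rw [SPTableau.isStandard_iff _ hn hk (T.permute g).2]
      have key : ∀ i, ((T.permute g).1.perm i : ℕ) = v (g (cellEquiv _ i)) := by
        intro i
        have h2 : (T.permute g).1.perm = T.1.perm * (cellEquiv _).symm.permCongr g :=
          T.1.perm_permute g
        rw [h2]
        rfl
      simp only [key]
      exact ⟨fun i j hij hlt => hg.1 (cellEquiv _ i) (cellEquiv _ j) hij hlt,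
        fun i j hij hlt => hg.2 (cellEquiv _ i) (cellEquiv _ j) hij hlt⟩
    exact hP ⟨_, hstd⟩

end Relations

/-! ### The vector of a tableau -/

namespace SPTableau

variable {lam : YoungDiagram} {k : ℕ}

/-- The vector of `W ⊗ S^{λ*}` given by a tableau: the tensor product of its symmetric diagram and the
polytabloid of its permutation. -/
noncomputable def vec (T : SPTableau lam k) : SymModule k (removeFirstRow lam) :=
  Finsupp.single T.sym 1 ⊗ₜ polytabloid _ T.perm

theorem realization_vec (n : ℕ) (T : SPTableau lam k) : realization k n (removeFirstRow lam) T.vec =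
    ∑ τ, (youngSymmetrizer (removeFirstRow lam)).coeff τ • markedFunction n T.content (T.mark ∘ τ) := by
  rw [vec, realization_single_tmul, polytabloid, realizationAt_smul, top_sym]
  refine Finset.sum_congr rfl fun τ _ => ?_
  have h : propEnum T.sym ∘ ⇑(T.perm * τ) = T.mark ∘ τ := funext fun i => T.propEnum_perm (τ i)
  rw [h]

theorem satisfiesGarnir_vec : SatisfiesGarnir fun T : SPTbar lam k => T.1.vec := by
  classical
  have hperm : ∀ (T : SPTbar lam k) g, (T.permute g).1.vec = Finsupp.single T.1.sym 1 ⊗ₜ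
      polytabloid _ (T.1.perm * (cellEquiv _).symm.permCongr g) := by
    intro T g
    have h1 : (T.permute g).1.sym = T.1.sym := T.1.sym_permute g
    have h2 : (T.permute g).1.perm = T.1.perm * (cellEquiv _).symm.permCongr g :=
      T.1.perm_permute g
    rw [vec, h1, h2]
  constructor
  · intro T g hg
    simp only [hperm]
    rw [polytabloid_mul_of_column, TensorProduct.tmul_smul, Equiv.Perm.sign_permCongr, vec]
    intro i
    rw [colOf, colOf, Equiv.permCongr_apply, columnTableau_cellEquiv_symm, hg, Equiv.symm_symm,
      coe_cellEquiv]
  · intro T i j hij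
    have h1 := sum_polytabloid_garnir T.1.perm hij
    have h2 := congrArg (TensorProduct.mk ℂ _ (Specht (removeFirstRow lam))
      (Finsupp.single T.1.sym (1 : ℂ))) h1
    rw [map_sum, map_zero] at h2
    rw [← h2]
    refine Finset.sum_equiv (cellEquiv _).symm.permCongr (fun g => ?_) fun g _ => ?_
    · simp only [Finset.mem_filter, Finset.mem_univ, true_and]
      constructor
      · intro hg c hc
        rw [Equiv.permCongr_apply, Equiv.symm_symm, hg _ hc, Equiv.symm_apply_apply]
      · intro hg c hc
        have h3 := hg ((cellEquiv _).symm c) (by rwa [columnTableau_cellEquiv_symm])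
        rw [Equiv.permCongr_apply, Equiv.symm_symm, Equiv.apply_symm_apply] at h3
        exact (cellEquiv _).symm.injective h3
    · simp only [hperm]
      rw [map_smul, Equiv.Perm.sign_permCongr]
      rfl

/-! ### The action of diagrams on tableaux -/

theorem glue_mark_of_isAct {d : Diag (Fin k) (Fin k)} {T T' : SPTableau lam k} (h : IsAct d T T')
    (i : Fin (removeFirstRow lam).card) :
    glue d (oneLine T.content) (Sum.inl (T'.mark i)) (mid (T.mark i)) := by
  have h1 := T'.mark_mem i
  have h2 : T'.box (lowerCell lam i) = connected d T (lowerCell lam i) :=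
    h.2.1 _ _ (lowerCell_mem i 0).1
  rw [h2] at h1
  obtain ⟨y, hy, h3⟩ := h1
  rw [box_lowerCell] at hy
  refine (glue d (oneLine T.content)).trans h3 ?_
  have h4 : (oneLine T.content) (Sum.inl y) (Sum.inl (T.mark i)) := hy
  exact (le_sup_right : (oneLine T.content).map down ≤ glue d (oneLine T.content))
    (Setoid.le_comap_map h4)

/-- If `d` separates the propagating blocks and connects them to its top row, then `d(T)` exists. -/
theorem exists_isAct (hn : 2 * k ≤ lam.card) {d : Diag (Fin k) (Fin k)} {T : SPTableau lam k}
    (h : Transports d T.content T.mark) : ∃ T', IsAct d T T' := by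
  obtain ⟨h1, h2⟩ := h
  choose q hq using h1
  have hQ : ∀ a b, top (comp d (oneLine T.content)) a b ↔
      glue d (oneLine T.content) (Sum.inl a) (Sum.inl b) := fun a b => Iff.rfl
  set J := glue d (oneLine T.content) with hJ
  obtain ⟨T', hc, hbox, hT'⟩ := exists_box hn (top (comp d (oneLine T.content))) (p := q)
    fun i j hij => h2 i j (J.trans (J.symm (hq i)) (J.trans ((hQ _ _).1 hij) (hq j)))
  refine ⟨T', hc, fun i j hij => ?_, hT'⟩
  obtain ⟨a, ha⟩ := exists_lowerCell hij
  rw [← ha, hbox]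
  ext x
  constructor
  · intro hx
    exact ⟨T.mark a, T.mark_mem a, J.trans ((hQ _ _).1 hx) (hq a)⟩
  · rintro ⟨y, hy, hxy⟩
    rw [box_lowerCell] at hy
    have h4 : (oneLine T.content) (Sum.inl y) (Sum.inl (T.mark a)) := hy
    have h5 : J (mid y) (mid (T.mark a)) :=
      (le_sup_right : (oneLine T.content).map down ≤ J) (Setoid.le_comap_map h4)
    exact (hQ _ _).2 (J.trans hxy (J.trans h5 (J.symm (hq a))))

/-- Twisted conjugation acts on the vectors of tableaux as the diagrams act on tableaux. -/
theorem twistedOp_vec (hn : 2 * k ≤ lam.card) (hk : (removeFirstRow lam).card ≤ k)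
    (d : Diag (Fin k) (Fin k)) (T : SPTableau lam k) :
    twistedOp (lam.card : ℂ) d T.vec =
      match act d T with
      | some T' => (lam.card : ℂ) ^ loops d (oneLine T.content) • T'.1.vec
      | none => 0 := by
  have hmn : 2 * (removeFirstRow lam).card ≤ lam.card := by omega
  refine realization_injective hn ?_
  rw [realization_twistedOp hmn, realization_vec, map_sum]
  by_cases hT : ∃ T', IsAct d T T'
  · have ha : act d T = some ⟨hT.choose, hT.choose_spec.2.2⟩ := by rw [act, dif_pos hT]
    rw [ha]
    simp only [map_smul]
    rw [realization_vec, Finset.smul_sum]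
    refine Finset.sum_congr rfl fun τ _ => ?_
    rw [colourMap_markedFunction (p := T.mark ∘ τ) (q := hT.choose.mark ∘ τ) d
      fun i => glue_mark_of_isAct hT.choose_spec (τ i), hT.choose_spec.1, smul_comm]
  · have ha : act d T = none := by rw [act, dif_neg hT]
    rw [ha, map_zero]
    refine Finset.sum_eq_zero fun τ _ => ?_
    rw [map_smul, colourMap_markedFunction_eq_zero hmn (p := T.mark ∘ τ)
      fun h => hT (exists_isAct hn ((Transports.comp_perm τ).1 h)), smul_zero]

/-! ### The basis of standard tableaux -/

theorem isAct_idDiag {T T' : SPTableau lam k} (hT' : T'.FirstRowIncreasing)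
    (hc : T.content = T'.content) (hm : ∀ i, T.mark i = T'.mark i) : IsAct (idDiag (Fin k)) T T' := by
  refine ⟨?_, fun i j hij => ?_, hT'⟩
  · rw [id_comp, hc]
    rfl
  · obtain ⟨a, ha⟩ := exists_lowerCell hij
    rw [← ha, box_lowerCell, connected, id_glue, ← hm, ← hc, box_lowerCell]
    ext x
    constructor
    · intro hx
      exact ⟨x, hx, T.content.refl x⟩
    · rintro ⟨y, hy, hxy⟩
      exact T.content.trans hxy hy

/-- A tableau with increasing first row is determined by its symmetric diagram and its
permutation. -/
theorem eq_of_sym_of_perm {T T' : SPTbar lam k} (hs : T.1.sym = T'.1.sym)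
    (hp : T.1.perm = T'.1.perm) : T = T' := by
  have hc : T.1.content = T'.1.content := by rw [← top_sym, ← top_sym, hs]
  have hm : ∀ i, T.1.mark i = T'.1.mark i := fun i => by
    rw [← propEnum_perm, ← propEnum_perm, hs, hp]
  exact Subtype.ext (IsAct.unique (isAct_idDiag T.2 rfl fun _ => rfl) (isAct_idDiag T'.2 hc hm))

theorem exists_sym_perm (hn : 2 * k ≤ lam.card) (w : SymDiagram k (removeFirstRow lam).card)
    (σ : Equiv.Perm (Fin (removeFirstRow lam).card)) :
    ∃ T : SPTbar lam k, T.1.sym = w ∧ T.1.perm = σ := by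
  obtain ⟨T, hc, hbox, hT⟩ := exists_box hn (top w.1) (p := propEnum w ∘ σ)
    fun i j h => σ.injective (propEnum_distinct w _ _ h)
  have hm : ∀ i, T.mark i = propEnum w (σ i) := by
    intro i
    refine mark_eq ?_ ?_ <;> rw [hbox]
    · exact (top w.1).refl _
    · exact fun b hb => le_propEnum w hb
  have hs : T.sym = w := by
    refine symDiagram_ext (T.top_sym.trans hc) (σ := σ ∘ T.perm.symm) fun i => ?_
    have h := T.propEnum_perm (T.perm.symm i)
    rw [Equiv.apply_symm_apply, hm] at h
    rw [h]
    exact T.sym.1.refl _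
  refine ⟨⟨T, hT⟩, hs, Equiv.ext fun i => (propEnum T.sym).injective ?_⟩
  rw [propEnum_perm, hm, hs]

/-- The vectors are tensor products of different basis diagrams with standard polytabloids. -/
theorem linearIndependent_vec (hn : 2 * k ≤ lam.card) (hk : (removeFirstRow lam).card ≤ k) :
    LinearIndependent ℂ fun T : SSPT lam k => T.1.vec := by
  classical
  let e := TensorProduct.finsuppScalarLeft ℂ (Specht (removeFirstRow lam))
    (SymDiagram k (removeFirstRow lam).card)
  have h1 := Finsupp.linearIndependent_single (R := ℂ)
    (fun (_ : SymDiagram k (removeFirstRow lam).card) (σ : StandardPerm (removeFirstRow lam)) =>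
      polytabloid (removeFirstRow lam) σ.1) fun _ => linearIndependent_polytabloid _
  let ι : SSPT lam k → (_ : SymDiagram k (removeFirstRow lam).card) × StandardPerm (removeFirstRow lam) :=
    fun T => ⟨T.1.sym, ⟨T.1.perm, (T.1.isStandard_iff hn hk T.2.firstRowIncreasing).1 T.2⟩⟩
  have hι : Function.Injective ι := by
    intro T T' h
    have h2 : T.1.sym = T'.1.sym := congrArg Sigma.fst h
    have h3 : T.1.perm = T'.1.perm := congrArg (fun x => x.2.1) h
    have h4 := eq_of_sym_of_perm (T := ⟨T.1, T.2.firstRowIncreasing⟩)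
      (T' := ⟨T'.1, T'.2.firstRowIncreasing⟩) h2 h3
    exact Subtype.ext (Subtype.mk.inj h4)
  refine LinearIndependent.of_comp e.toLinearMap ?_
  have h2 : ⇑e.toLinearMap ∘ (fun T : SSPT lam k => T.1.vec) = (fun ix :
      (_ : SymDiagram k (removeFirstRow lam).card) × StandardPerm (removeFirstRow lam) =>
      Finsupp.single ix.1 (polytabloid (removeFirstRow lam) ix.2.1)) ∘ ι := by
    funext T
    simp only [Function.comp_apply, LinearEquiv.coe_coe, vec, e]
    rw [TensorProduct.finsuppScalarLeft_apply_tmul, Finsupp.sum_single_index (by simp), one_smul]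
  rw [h2]
  exact h1.comp ι hι

theorem span_vec (hn : 2 * k ≤ lam.card) (hk : (removeFirstRow lam).card ≤ k) :
    ⊤ ≤ Submodule.span ℂ (Set.range fun T : SSPT lam k => T.1.vec) := by
  set P := Submodule.span ℂ (Set.range fun T : SSPT lam k => T.1.vec) with hP
  have h1 : ∀ T : SPTbar lam k, T.1.vec ∈ P := fun T =>
    satisfiesGarnir_vec.mem_of_standard hn hk P.toAddSubgroup
      (fun T => Submodule.subset_span (Set.mem_range_self T)) T
  rintro u -
  induction u using symModule_induction with
  | zero => exact P.zero_mem
  | add x y hx hy => exact P.add_mem hx hy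
  | tmul w v =>
    have h2 : Submodule.span ℂ (Set.range (polytabloid (removeFirstRow lam))) ≤
        P.comap (TensorProduct.mk ℂ _ _ (Finsupp.single w 1)) := by
      rw [Submodule.span_le]
      rintro _ ⟨σ, rfl⟩
      obtain ⟨T, rfl, rfl⟩ := exists_sym_perm hn w σ
      exact h1 T
    rw [span_polytabloid] at h2
    exact h2 (Submodule.mem_top (x := v))

/-- The vectors of the standard tableaux form a basis of `W ⊗ S^{λ*}`. -/
noncomputable def basis (hn : 2 * k ≤ lam.card) (hk : (removeFirstRow lam).card ≤ k) :
    Module.Basis (SSPT lam k) ℂ (SymModule k (removeFirstRow lam)) :=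
  Module.Basis.mk (linearIndependent_vec hn hk) (span_vec hn hk)

theorem basis_apply (hn : 2 * k ≤ lam.card) (hk : (removeFirstRow lam).card ≤ k) (T : SSPT lam k) :
    basis hn hk T = T.1.vec := Module.Basis.mk_apply _ _ _

theorem repr_vec (hn : 2 * k ≤ lam.card) (hk : (removeFirstRow lam).card ≤ k) (T : SSPT lam k) :
    (basis hn hk).repr T.1.vec = naturalBasis T := by
  rw [← basis_apply hn hk, Module.Basis.repr_self]
  rfl

end SPTableau

/-! ### The two modules -/

section Comparison

variable {lam : YoungDiagram} {k : ℕ}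

theorem isStraightening_repr (hn : 2 * k ≤ lam.card) (hk : (removeFirstRow lam).card ≤ k) :
    IsStraightening fun T : SPTbar lam k => (SPTableau.basis hn hk).repr T.1.vec := by
  have h := SPTableau.satisfiesGarnir_vec.map (SPTableau.basis hn hk).repr.toLinearMap
  exact ⟨SPTableau.repr_vec hn hk, h.column, h.garnir⟩

theorem IsStraightening.unique (hn : 2 * k ≤ lam.card) (hk : (removeFirstRow lam).card ≤ k)
    {N N' : SPTbar lam k → NaturalModule lam k} (h : IsStraightening N) (h' : IsStraightening N') :
    N' = N := by
  funext T
  have h1 := (h'.satisfiesGarnir.sub h.satisfiesGarnir).mem_of_standard hn hk ⊥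
    (fun S => by rw [h.standard, h'.standard, sub_self]; exact AddSubgroup.zero_mem _) T
  exact sub_eq_zero.1 h1

theorem IsStraightening.integral (hn : 2 * k ≤ lam.card) (hk : (removeFirstRow lam).card ≤ k)
    {N : SPTbar lam k → NaturalModule lam k} (h : IsStraightening N) (T : SPTbar lam k)
    (S : SSPT lam k) : ∃ z : ℤ, N T S = z := by
  classical
  let P : AddSubgroup (NaturalModule lam k) :=
    (Int.castAddHom ℂ).range.comap (Finsupp.applyAddHom S)
  have h1 : N T ∈ P := h.satisfiesGarnir.mem_of_standard hn hk P (fun S' => by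
    rw [h.standard]
    refine ⟨if S' = S then 1 else 0, ?_⟩
    change ((if S' = S then 1 else 0 : ℤ) : ℂ) = Finsupp.single S' (1 : ℂ) S
    rw [Finsupp.single_apply]
    split_ifs <;> simp) T
  obtain ⟨z, hz⟩ := h1
  exact ⟨z, hz.symm⟩

/-- A linear equivalence of modules over the partition algebra that commutes with the diagrams is an
isomorphism. -/
theorem nonempty_linearEquiv {n : ℂ} {X Y : Type} [AddCommGroup X] [Module ℂ X] [AddCommGroup Y]
    [Module ℂ Y] [Module (PartitionAlgebra k n) X] [IsScalarTower ℂ (PartitionAlgebra k n) X]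
    [Module (PartitionAlgebra k n) Y] [IsScalarTower ℂ (PartitionAlgebra k n) Y] (e : X ≃ₗ[ℂ] Y)
    (he : ∀ (d : Diag (Fin k) (Fin k)) x,
      e (PartitionAlgebra.diagram n d • x) = PartitionAlgebra.diagram n d • e x) :
    Nonempty (X ≃ₗ[PartitionAlgebra k n] Y) := by
  refine ⟨{ e with map_smul' := fun a x => ?_ }⟩
  let f : PartitionAlgebra k n →ₗ[ℂ] Y :=
    { toFun := fun a => e (a • x)
      map_add' := fun a b => by rw [add_smul, map_add]
      map_smul' := fun r a => by rw [smul_assoc, map_smul, RingHom.id_apply] }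
  let g : PartitionAlgebra k n →ₗ[ℂ] Y :=
    { toFun := fun a => a • e x
      map_add' := fun a b => add_smul _ _ _
      map_smul' := fun r a => smul_assoc _ _ _ }
  have h : f = g := PartitionAlgebra.hom_ext fun d => he d x
  exact LinearMap.congr_fun h a

end Comparison

end PartAlg

open PartAlg

theorem mainTheorem2 (k n : ℕ) (hn : 2 * k ≤ n) (lam : YoungDiagram) (hlam : lam.card = n)
    (hk : (removeFirstRow lam).card ≤ k) :
    ∃ N : SPTbar lam k → NaturalModule lam k,
      -- straightening is well defined, unique and integral
      IsStraightening N ∧ (∀ N', IsStraightening N' → N' = N) ∧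
      (∀ T S, ∃ z : ℤ, N T S = z) ∧
      -- the action on the natural basis and the twisted conjugation action are module structures
      ∃ (_ : Module (PartitionAlgebra k n) (NaturalModule lam k))
        (_ : IsScalarTower ℂ (PartitionAlgebra k n) (NaturalModule lam k))
        (_ : Module (PartitionAlgebra k n) (SymModule k (removeFirstRow lam)))
        (_ : IsScalarTower ℂ (PartitionAlgebra k n) (SymModule k (removeFirstRow lam))),
        (∀ d T, PartitionAlgebra.diagram (n : ℂ) d • naturalBasis T =
          naturalAction (n : ℂ) N d T) ∧
        (∀ d w v, PartitionAlgebra.diagram (n : ℂ) d •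
            (Finsupp.single w (1 : ℂ) ⊗ₜ[ℂ] v : SymModule k (removeFirstRow lam)) =
          twistedAction (n : ℂ) d w v) ∧
        -- the second module is irreducible and the first one is isomorphic to it
        IsSimpleModule (PartitionAlgebra k n) (SymModule k (removeFirstRow lam)) ∧
        Nonempty (NaturalModule lam k ≃ₗ[PartitionAlgebra k n]
          SymModule k (removeFirstRow lam)) := by
  subst hlam
  have hmn : 2 * (removeFirstRow lam).card ≤ lam.card := by omega
  have hN := isStraightening_repr hn hk
  let b := (SPTableau.basis hn hk).repr
  obtain ⟨inst₁, tower₁, h₁⟩ := exists_module (k := k)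
    (n := ((lam.card : ℕ) : ℂ)) (X := SymModule k (removeFirstRow lam))
    (twistedOp (μ := removeFirstRow lam) ((lam.card : ℕ) : ℂ))
    (twistedOp_idDiag hn hmn) (twistedOp_twistedOp hn hmn)
  obtain ⟨inst₂, tower₂, h₂⟩ := exists_module (k := k) (n := ((lam.card : ℕ) : ℂ))
    (X := NaturalModule lam k)
    (fun d => b.toLinearMap ∘ₗ twistedOp ((lam.card : ℕ) : ℂ) d ∘ₗ b.symm.toLinearMap)
    (fun x => by
      simp only [LinearMap.comp_apply, LinearEquiv.coe_coe]
      rw [twistedOp_idDiag hn hmn, LinearEquiv.apply_symm_apply])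
    (fun d₁ d₂ x => by
      simp only [LinearMap.comp_apply, LinearEquiv.coe_coe]
      rw [LinearEquiv.symm_apply_apply, twistedOp_twistedOp hn hmn, map_smul])
  refine ⟨_, hN, fun N' hN' => hN.unique hn hk hN', hN.integral hn hk, inst₂, tower₂, inst₁, tower₁,
    fun d T => ?_, fun d w v => ?_, isSimpleModule_symModule hn hk h₁, ?_⟩
  · rw [h₂, ← SPTableau.repr_vec hn hk]
    simp only [LinearMap.comp_apply, LinearEquiv.coe_coe, b]
    rw [LinearEquiv.symm_apply_apply, SPTableau.twistedOp_vec hn hk, naturalAction]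
    cases act d T.1 with
    | none => exact map_zero _
    | some T' => exact map_smul _ _ _
  · rw [h₁, twistedOp_single_tmul]
  · refine nonempty_linearEquiv b.symm fun d x => ?_
    rw [h₁, h₂]
    simp only [LinearMap.comp_apply, LinearEquiv.coe_coe]
    rw [LinearEquiv.symm_apply_apply]
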